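/- **Setting.** Let $x_{ij}=\left(\frac{i-1/2}{n},\frac{j-1/2}{n}\right)$, $i,j=1,\dots,n$, and observe $Y_{ij}=m(x_{ij})+\varepsilon_{ij}$ with i.i.d. errors $\varepsilon_{ij}$ of distribution $P$ on $\mathbb R$, where $m=\mu+d\,\mathbb 1_D$, $\mu$ is continuous on $[0,1]^2$, $d>0$, and $D\subset[0,1]^2$ is a nonempty closed set with $D=\overline{\operatorname{int}D}$ whose boundary $\partial D$ (in $\mathbb R^2$) is the disjoint union of finitely many edge curves. An edge curve is a simple closed plane curve with a unit-speed parametrization having a bounded second derivative, except at finitely many corner points, at which the two one-sided tangent rays exist and meet at an angle in $(0,\pi)\cup(\pi,2\pi)$. The kernel $K:\mathbb R^2\to[0,\infty)$ is Lipschitz, zero outside $(-1,1)^2$, with $K(0)>0$ and $\int K=1$. For $L:\mathbb R\to[0,\infty)$ and bandwidths $h_n,g_n>0$ put $$H_{n,x}(y)=\frac1{n^2}\sum_{i,j=1}^n \frac1{h_n^2}K\Big(\frac{x-x_{ij}}{h_n}\Big)\frac1{g_n}L\Big(\frac{y-Y_{ij}}{g_n}\Big).$$ Let $x_{i_0j_0}$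 be the design point nearest to $x$ (ties: in each coordinate the smaller index). The M-smoother $m_n(x)$ is the point closest to $Y_{i_0j_0}$ in the set of those local maxima $y$ of $H_{n,x}$ that satisfy $y\le Y_{i_0j_0}$ if $H_{n,x}'(Y_{i_0j_0})\le 0$ and $y>Y_{i_0j_0}$ if $H_{n,x}'(Y_{i_0j_0})>0$ (in the closure of this set if the minimal distance is not attained, and $0$ if the set is empty). **Robustness.** For probability measures on $\mathbb R$ with distribution functions $F,G$ let $d_L(P,Q)=\inf\{\varepsilon\ge0: F(y-\varepsilon)-\varepsilon\le G(y)\le F(y+\varepsilon)+\varepsilon\ \forall y\in\mathbb R\}$ (Lévy metric), and let $(Q)^{m_n(x)}$ be the distribution of $m_n(x)$ when the errors are i.i.d. with distribution $Q$. The smoother is *robust for large samples at $P$ in $x$* if for every $\varepsilon^*>0$ there are $\varepsilon>0$ and $N\in\mathbb N$ such that $d_L\big((P)^{m_n(x)},(Q)^{m_n(x)}\big)\le\varepsilon^*$ for all probability measures $Q$ with $d_L(P,Q)\le\varepsilon$ and all $n\ge N$. **Theorem.** Let $x_0\in(0,1)^2$. (a) Suppose that $L$ is nonnegative with Lipschitz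 continuous derivative, $L(0)\ne0$, $\int L=1$, $\int L(v)|v|\,dv<\infty$, and $L'(v)|v|$ is integrable; that $g_n\to0$, $h_n\to0$, $n^{-1}h_n^{-2}\to0$ and $n^{-1}h_n^{-1}g_n^{-2}\to0$; and that $P$ has a differentiable density $f$ on $\mathbb R$ with Lipschitz continuous derivative, vanishing outside an interval $\mathcal I$, with $f'(y)\neq0$ for all $y\in\mathcal I\setminus\{0\}$. Then the M-smoother is not robust for large samples at $P$ in $x_0$. (b) Suppose that $L$ is nonnegative, symmetric, zero outside $(-1,1)$, twice differentiable with $L'$ and $L''$ Lipschitz continuous, $L'>0$ on $(-1,0)$, and $L''$ has finitely many zeros in $(-1,1)$; that $g_n=g>0$ is constant, $h_n\to0$ and $n^{-1}h_n^{-1}\to0$; and that $P$ has a density $f$ vanishing outside an interval $\mathcal I\ni0$, symmetric on $[-g,g]$, strictly decreasing on $(0,\infty)\cap\mathcal I$ and strictly increasing on $(-\infty,0)\cap\mathcal I$. If $x_0\notin\partial D$, then the M-smoother is robust for large samples at $P$ in $x_0$. If moreover $f$ vanishes outside an interval $(-a,a)$ with $2a+2g<d$, then the M-smoother is also robust for large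 samples at $P$ in every $x_0\in\partial D\cap(0,1)^2$ (in particular, every corner point) that is a design point $x_{ij}$ for some $n$. -/

import Mathlib

open MeasureTheory Filter Topology Set
open scoped ENNReal NNReal

noncomputable section

namespace MSmoother

/-- The plane `ℝ²` with its Euclidean norm. -/
abbrev Plane : Type := EuclideanSpace ℝ (Fin 2)

/-- The closed unit square `[0,1]²`, the domain of an image. -/
def unitSquare : Set Plane := {x | ∀ k, x k ∈ Icc (0 : ℝ) 1}

/-- The open unit square `(0,1)²`. -/
def openUnitSquare : Set Plane := {x | ∀ k, x k ∈ Ioo (0 : ℝ) 1}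

/-! ### Edge curves and the regression function -/

/-- `γ` is an edge curve: a simple closed curve with a natural (unit speed) parametrization `c`
and a bounded second derivative, except at a finite number of corner points. The closed curve is
parametrized periodically, so that the closing point is treated like every other point.
At a corner the one-sided limits `bl`, `br` of the unit tangent exist, and the two directional
tangents, the rays spanned by `-bl` and `br`, meet neither at angle `0` (a cusp) nor at angle `π`
(no corner). The unoriented angle lies in `(0, π)` exactly if the oriented one lies in
`(0, π) ∪ (π, 2π)`. -/
def IsEdgeCurve (γ : Set Plane) : Prop :=
  ∃ (T : ℝ) (c : ℝ → Plane) (corners : Finset ℝ),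
    0 < T ∧ Continuous c ∧ Function.Periodic c T ∧ InjOn c (Ico 0 T) ∧ γ = range c ∧
    (∀ t ∈ Ico 0 T, t ∉ corners →
      DifferentiableAt ℝ c t ∧ ‖deriv c t‖ = 1 ∧ DifferentiableAt ℝ (deriv c) t) ∧
    (∃ M : ℝ, ∀ t ∈ Ico 0 T, t ∉ corners → ‖deriv (deriv c) t‖ ≤ M) ∧
    (∀ t ∈ Ico 0 T, t ∈ corners → ∃ bl br : Plane,
      Tendsto (deriv c) (𝓝[<] t) (𝓝 bl) ∧ Tendsto (deriv c) (𝓝[>] t) (𝓝 br) ∧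
      InnerProductGeometry.angle (-bl) br ∈ Ioo 0 Real.pi)

/-- The shape of the image: `μ` is continuous on the unit square, the jump height `d` is positive,
and `D` is a nonempty closed region in the unit square whose boundary is the disjoint union of
finitely many edge curves. A region is the closure of its interior, that is, `D` has no
parts that consist of a curve only. -/
structure IsImage (μ : Plane → ℝ) (d : ℝ) (D : Set Plane) : Prop where
  continuousOn : ContinuousOn μ unitSquare
  jump_pos : 0 < d
  nonempty : D.Nonempty
  subset : D ⊆ unitSquare
  isClosed : IsClosed D
  region : D = closure (interior D)
  boundary : ∃ (k : ℕ) (γ : Fin k → Set Plane),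
    (∀ i, IsEdgeCurve (γ i)) ∧ Pairwise (fun i j => Disjoint (γ i) (γ j)) ∧
      frontier D = ⋃ i, γ i

/-- The regression function `m = μ + d 1_D`. -/
def regression (μ : Plane → ℝ) (d : ℝ) (D : Set Plane) (x : Plane) : ℝ :=
  μ x + D.indicator (fun _ => d) x

/-! ### The M-smoother -/

/-- The pixel indices; `(i, j)` with `0 ≤ i, j < n` stands for `(i + 1, j + 1)`. -/
abbrev Pixel (n : ℕ) : Type := Fin n × Fin n

/-- The design points `((i - 1/2)/n, (j - 1/2)/n)`, `i, j = 1, …, n`. -/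
def designPoint (n : ℕ) (p : Pixel n) : Plane :=
  !₂[((p.1 : ℝ) + 1 / 2) / n, ((p.2 : ℝ) + 1 / 2) / n]

/-- `p` is the index `(i₀, j₀)` of the design point next to `x`; in the case of ties, in each
coordinate the smaller index. -/
def IsCentre (n : ℕ) (x : Plane) (p : Pixel n) : Prop :=
  (∀ q, ‖x - designPoint n p‖ ≤ ‖x - designPoint n q‖) ∧
  ∀ q, ‖x - designPoint n q‖ = ‖x - designPoint n p‖ → p.1 ≤ q.1 ∧ p.2 ≤ q.2

open Classical in
/-- The observation `Y_{i₀ j₀}` at the centre of the window, from which the search starts. -/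
def startValue (n : ℕ) (x : Plane) (Y : Pixel n → ℝ) : ℝ :=
  if h : ∃ p, IsCentre n x p then Y h.choose else 0

/-- The density estimate `H_{n,x}(y) = n⁻² ∑ K_h(x - x_{ij}) L_g(y - Y_{ij})`, where
`K_h(u) = h⁻² K(u / h)` and `L_g(v) = g⁻¹ L(v / g)`. -/
def densityEstimate (K : Plane → ℝ) (L : ℝ → ℝ) (n : ℕ) (h g : ℝ) (x : Plane)
    (Y : Pixel n → ℝ) (y : ℝ) : ℝ :=
  1 / (n : ℝ) ^ 2 * ∑ p : Pixel n,
    (1 / h ^ 2 * K (h⁻¹ • (x - designPoint n p))) * (1 / g * L ((y - Y p) / g))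

/-- The local maxima of the density estimate that lie in ascending direction from the
starting value. -/
def ascendingModes (K : Plane → ℝ) (L : ℝ → ℝ) (n : ℕ) (h g : ℝ) (x : Plane)
    (Y : Pixel n → ℝ) : Set ℝ :=
  {y | IsLocalMax (densityEstimate K L n h g x Y) y ∧
    (deriv (densityEstimate K L n h g x Y) (startValue n x Y) ≤ 0 → y ≤ startValue n x Y) ∧
    (0 < deriv (densityEstimate K L n h g x Y) (startValue n x Y) → startValue n x Y < y)}

open Classical in
/-- The M-smoother: the element of `ascendingModes` closest to the starting value. All elements
lie on the same side of the starting value, so the closest one is the smallest or the largest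
one. It is taken in the closure of the set, in case the minimal distance is not attained;
the value is `0` if the set is empty. -/
def mSmoother (K : Plane → ℝ) (L : ℝ → ℝ) (n : ℕ) (h g : ℝ) (x : Plane)
    (Y : Pixel n → ℝ) : ℝ :=
  if 0 < deriv (densityEstimate K L n h g x Y) (startValue n x Y) then
    sInf (ascendingModes K L n h g x Y)
  else sSup (ascendingModes K L n h g x Y)

/-- If the set of ascending modes has an element that is closest to the starting value, then this
element is the value of the M-smoother. -/
theorem mSmoother_eq_of_closest {K : Plane → ℝ} {L : ℝ → ℝ} {n : ℕ} {h g : ℝ} {x : Plane}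
    {Y : Pixel n → ℝ} {y : ℝ} (hy : y ∈ ascendingModes K L n h g x Y)
    (hmin : ∀ z ∈ ascendingModes K L n h g x Y,
      |y - startValue n x Y| ≤ |z - startValue n x Y|) :
    mSmoother K L n h g x Y = y := by
  unfold mSmoother
  split_ifs with hpos
  · have hle : IsLeast (ascendingModes K L n h g x Y) y := by
      refine ⟨hy, fun z hz => ?_⟩
      have h1 := hy.2.2 hpos
      have h2 := hz.2.2 hpos
      have h3 := hmin z hz
      rw [abs_of_pos (by linarith), abs_of_pos (by linarith)] at h3
      linarith
    exact hle.csInf_eq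
  · have hge : IsGreatest (ascendingModes K L n h g x Y) y := by
      refine ⟨hy, fun z hz => ?_⟩
      have h1 := hy.2.1 (not_lt.mp hpos)
      have h2 := hz.2.1 (not_lt.mp hpos)
      have h3 := hmin z hz
      rw [abs_of_nonpos (by linarith), abs_of_nonpos (by linarith)] at h3
      linarith
    exact hge.csSup_eq

/-! ### Robustness for large samples -/

/-- The Lévy metric on probability measures on `ℝ`. -/
def levyDist (P Q : Measure ℝ) : ℝ :=
  sInf {ε : ℝ | 0 ≤ ε ∧ ∀ y : ℝ,
    P.real (Iic (y - ε)) - ε ≤ Q.real (Iic y) ∧ Q.real (Iic y) ≤ P.real (Iic (y + ε)) + ε}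

/-- The distribution of the estimator `mhat` on `n × n` pixels if the residuals
`Y_{ij} - m(x_{ij})` are independent with distribution `P`. -/
def estimatorLaw (m : Plane → ℝ) {n : ℕ} (mhat : (Pixel n → ℝ) → ℝ) (P : Measure ℝ) :
    Measure ℝ :=
  (Measure.pi fun _ : Pixel n => P).map fun e => mhat fun p => m (designPoint n p) + e p

/-- The sequence of estimators `mhat` is robust for large samples at `P`, for the regression
function `m`. -/
def RobustForLargeSamples (m : Plane → ℝ) (mhat : ∀ n : ℕ, (Pixel n → ℝ) → ℝ)
    (P : Measure ℝ) : Prop :=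
  ∀ εstar : ℝ, 0 < εstar → ∃ ε : ℝ, 0 < ε ∧ ∃ N : ℕ,
    ∀ Q : Measure ℝ, IsProbabilityMeasure Q → levyDist P Q ≤ ε → ∀ n : ℕ, N ≤ n →
      levyDist (estimatorLaw m (mhat n) P) (estimatorLaw m (mhat n) Q) ≤ εstar

/-! ### Assumptions on the kernel, the score function, the bandwidths and the errors -/

/-- The window kernel `K`. -/
structure IsWindowKernel (K : Plane → ℝ) : Prop where
  nonneg : ∀ u, 0 ≤ K u
  support : ∀ u, (∃ k, 1 ≤ |u k|) → K u = 0
  lipschitz : ∃ C : ℝ≥0, LipschitzWith C K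
  pos_zero : 0 < K 0
  integral_eq : ∫ u, K u = 1

/-- The score function `L` for scale parameters that tend to zero. -/
structure IsScore (L : ℝ → ℝ) : Prop where
  nonneg : ∀ v, 0 ≤ L v
  differentiable : Differentiable ℝ L
  lipschitz_deriv : ∃ C : ℝ≥0, LipschitzWith C (deriv L)
  ne_zero : L 0 ≠ 0
  integral_eq : ∫ v, L v = 1
  integrable_mul_abs : Integrable fun v => L v * |v|
  integrable_deriv_mul_abs : Integrable fun v => deriv L v * |v|

/-- The score function `L` for a fixed scale parameter. -/
structure IsUnimodalScore (L : ℝ → ℝ) : Prop where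
  nonneg : ∀ v, 0 ≤ L v
  differentiable : Differentiable ℝ L
  lipschitz_deriv : ∃ C : ℝ≥0, LipschitzWith C (deriv L)
  differentiable_deriv : Differentiable ℝ (deriv L)
  lipschitz_deriv_deriv : ∃ C : ℝ≥0, LipschitzWith C (deriv (deriv L))
  symm : ∀ v, L (-v) = L v
  support : ∀ v, v ∉ Ioo (-1 : ℝ) 1 → L v = 0
  deriv_pos : ∀ v ∈ Ioo (-1 : ℝ) 0, 0 < deriv L v
  finite_zeros : {v ∈ Ioo (-1 : ℝ) 1 | deriv (deriv L) v = 0}.Finite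

/-- The assumptions for a scale parameter `g n` that tends to zero. -/
structure VanishingScale (K : Plane → ℝ) (L : ℝ → ℝ) (μ : Plane → ℝ) (d : ℝ) (D : Set Plane)
    (h g : ℕ → ℝ) : Prop where
  image : IsImage μ d D
  kernel : IsWindowKernel K
  score : IsScore L
  h_pos : ∀ n, 0 < h n
  g_pos : ∀ n, 0 < g n
  g_tendsto : Tendsto g atTop (𝓝 0)
  h_tendsto : Tendsto h atTop (𝓝 0)
  rate_h : Tendsto (fun n : ℕ => (n : ℝ)⁻¹ * (h n ^ 2)⁻¹) atTop (𝓝 0)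
  rate_g : Tendsto (fun n : ℕ => (n : ℝ)⁻¹ * (h n)⁻¹ * (g n ^ 2)⁻¹) atTop (𝓝 0)

/-- The assumptions for a fixed scale parameter `g`. -/
structure FixedScale (K : Plane → ℝ) (L : ℝ → ℝ) (μ : Plane → ℝ) (d : ℝ) (D : Set Plane)
    (h : ℕ → ℝ) (g : ℝ) : Prop where
  image : IsImage μ d D
  kernel : IsWindowKernel K
  score : IsUnimodalScore L
  h_pos : ∀ n, 0 < h n
  g_pos : 0 < g
  h_tendsto : Tendsto h atTop (𝓝 0)
  rate_h : Tendsto (fun n : ℕ => (n : ℝ)⁻¹ * (h n)⁻¹) atTop (𝓝 0)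

/-- `P` has the density `f` (with respect to Lebesgue measure), which is supported on the
bounded or unbounded interval `I`. -/
structure HasDensityOn (P : Measure ℝ) (f : ℝ → ℝ) (I : Set ℝ) : Prop where
  measurable : Measurable f
  nonneg : ∀ y, 0 ≤ f y
  eq_withDensity : P = volume.withDensity fun y => ENNReal.ofReal (f y)
  interval : I.OrdConnected
  support : ∀ y, y ∉ I → f y = 0

/-- The error distribution has a strongly unimodal density with Lipschitz continuous
derivative. -/
def SmoothUnimodalError (P : Measure ℝ) : Prop :=
  ∃ (f : ℝ → ℝ) (I : Set ℝ), HasDensityOn P f I ∧ Differentiable ℝ f ∧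
    (∃ C : ℝ≥0, LipschitzWith C (deriv f)) ∧ ∀ y ∈ I \ {0}, deriv f y ≠ 0

/-- `f` is symmetric on `[-g, g]`, strictly increasing on the negative and strictly decreasing on
the positive part of the interval `I`, which contains the mode `0`. -/
structure IsUnimodalOn (g : ℝ) (f : ℝ → ℝ) (I : Set ℝ) : Prop where
  zero_mem : (0 : ℝ) ∈ I
  symm : ∀ y ∈ Icc (-g) g, f (-y) = f y
  strictAnti : StrictAntiOn f (Ioi 0 ∩ I)
  strictMono : StrictMonoOn f (Iio 0 ∩ I)

/-- The error distribution has a (weakly) unimodal density which is symmetric on `[-g, g]`. -/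
def UnimodalError (g : ℝ) (P : Measure ℝ) : Prop :=
  ∃ (f : ℝ → ℝ) (I : Set ℝ), HasDensityOn P f I ∧ IsUnimodalOn g f I

/-- As `UnimodalError`, and the density is supported on an interval `(-a, a)` with
`2 a + 2 g < d`. -/
def NarrowUnimodalError (g d : ℝ) (P : Measure ℝ) : Prop :=
  ∃ (f : ℝ → ℝ) (I : Set ℝ) (a : ℝ), HasDensityOn P f I ∧ IsUnimodalOn g f I ∧
    (∀ y, y ∉ Ioo (-a) a → f y = 0) ∧ 2 * a + 2 * g < d

end MSmoother

end

namespace MSmoother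

/-! ### Local maxima and the search for modes -/

/-! Up to a positive factor, the derivative of the density estimate is a weighted mean of `deriv L
((y - Y p) / g)` over the pixels in a small window. By a Bernstein bound on a grid
(`measureReal_exists_le_abs_sum_le`) it is, with high probability and uniformly for `y` in a bounded
interval, close to the weighted mean of `scoreMean L g Q (y - m (designPoint n p))`. In the window
the regression function takes only two values up to a small `τ`: `m₀` on the side of the centre
pixel and possibly `m₁` across the boundary. Since an edge curve has no cusps, the boundary near
each of its points is a graph over a line, so both sides fill a fixed share of small discs
(`exists_balls_on_both_sides`). Hence pixels of level `m₀` carry at least a fixed share `α` of the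
weight (`exists_localModel`). Which side the centre lies on may change with `n`.

Fixed scale. Pairing the points `t - w` and `t + w` shows that the mean score under `P` is negative
at each positive `t` of the support interval and positive at each negative one. If the other side
contributes nothing, either because there is none or because its errors are out of reach of `L`, the
density estimate increases on compact intervals left of `m₀` and decreases on those right of it. The
ascent then ends near `m₀` unless the centre error is very small or very large. Because `P` has a
density, Lévy-close `Q` have uniformly close distribution functions, and integration by parts makes
their mean scores uniformly close. So the argument works for `P` and `Q` with the same `m₀`, and two
laws concentrated near one point are Lévy-close (`levyDist_le_of_concentrated`).

Vanishing scale. Integration by parts gives mean score divided by `g ^ 2` close to the derivative of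
the error density (`HasSmoothDensity.abs_scoreMean_div_sub_le`). Under `P` there is an interval of
positive density on which both levels pull in the same direction; it contains no mode with high
probability, so the smoother misses it. Adding to the distribution function a bump of height of
order `s` that oscillates with wavelength of order `s` moves `P` by at most a small Lévy distance.
It changes the derivative of the density by order `1 / s`, which beats the influence of the other
level (`HasSmoothDensity.exists_oscillating`). Then a start on a rising flank is trapped within
about one period, so the smoother stays in the interval with probability bounded below independently
of `s`. This keeps the two laws apart. -/

/-- A differentiable function that increases at `a` and decreases at `b > a` has a local maximum
strictly between. -/
theorem exists_isLocalMax_of_deriv {H : ℝ → ℝ} (hH : Differentiable ℝ H) {a b : ℝ} (hab : a < b)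
    (ha : 0 < deriv H a) (hb : deriv H b < 0) : ∃ y ∈ Ioo a b, IsLocalMax H y := by
  obtain ⟨y, hy, hmax⟩ := isCompact_Icc.exists_isMaxOn (nonempty_Icc.2 hab.le)
    hH.continuous.continuousOn (s := Icc a b)
  have hya : y ≠ a := by
    rintro rfl
    -- At an endpoint, the derivative of a maximum in the inward direction is nonpositive, against
    -- the assumed sign.
    have h1 := (hmax.localize).hasFDerivWithinAt_nonpos
      (hH y).hasDerivAt.hasFDerivAt.hasFDerivWithinAt
      (mem_posTangentConeAt_of_segment_subset (y := b - y)
        (by rw [add_sub_cancel, segment_eq_Icc hab.le]))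
    simp at h1
    nlinarith
  have hyb : y ≠ b := by
    rintro rfl
    have h1 := (hmax.localize).hasFDerivWithinAt_nonpos
      (hH y).hasDerivAt.hasFDerivAt.hasFDerivWithinAt
      (mem_posTangentConeAt_of_segment_subset (y := a - y)
        (by rw [add_sub_cancel, segment_symm, segment_eq_Icc hab.le]))
    simp at h1
    nlinarith
  have hy' : y ∈ Ioo a b := ⟨lt_of_le_of_ne hy.1 hya.symm, lt_of_le_of_ne hy.2 hyb⟩
  exact ⟨y, hy', hmax.isLocalMax (Icc_mem_nhds hy'.1 hy'.2)⟩

theorem differentiable_densityEstimate {K : Plane → ℝ} {L : ℝ → ℝ} (hL : Differentiable ℝ L)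
    (n : ℕ) (h g : ℝ) (x : Plane) (Y : Pixel n → ℝ) :
    Differentiable ℝ (densityEstimate K L n h g x Y) := by
  unfold densityEstimate
  fun_prop

/-- The weight of a pixel in the window centred at `x`. -/
noncomputable def weight (K : Plane → ℝ) (n : ℕ) (h : ℝ) (x : Plane) (p : Pixel n) : ℝ :=
  K (h⁻¹ • (x - designPoint n p))

/-- The weighted sum of scores, proportional to the derivative of the density estimate. -/
noncomputable def scoreSum (K : Plane → ℝ) (L : ℝ → ℝ) (n : ℕ) (h g : ℝ) (x : Plane)
    (Y : Pixel n → ℝ) (y : ℝ) : ℝ :=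
  ∑ p : Pixel n, weight K n h x p * deriv L ((y - Y p) / g)

theorem deriv_densityEstimate {K : Plane → ℝ} {L : ℝ → ℝ} (hL : Differentiable ℝ L)
    (n : ℕ) (h g : ℝ) (x : Plane) (Y : Pixel n → ℝ) (y : ℝ) :
    deriv (densityEstimate K L n h g x Y) y =
      1 / ((n : ℝ) ^ 2 * h ^ 2 * g ^ 2) * scoreSum K L n h g x Y y := by
  have h1 : ∀ p : Pixel n, HasDerivAt (fun y => (1 / h ^ 2 * K (h⁻¹ • (x - designPoint n p))) *
      (1 / g * L ((y - Y p) / g)))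
      ((1 / h ^ 2 * K (h⁻¹ • (x - designPoint n p))) *
        (1 / g * (deriv L ((y - Y p) / g) * (1 / g)))) y := by
    intro p
    have h2 : HasDerivAt (fun y => (y - Y p) / g) (1 / g) y :=
      ((hasDerivAt_id y).sub_const _).div_const _
    have h3 : HasDerivAt (fun y => L ((y - Y p) / g)) (deriv L ((y - Y p) / g) * (1 / g)) y :=
      (hL _).hasDerivAt.comp y h2
    exact (h3.const_mul _).const_mul _
  have h4 := (HasDerivAt.fun_sum (u := Finset.univ) fun p _ => h1 p).const_mul (1 / (n : ℝ) ^ 2)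
  have h5 : deriv (densityEstimate K L n h g x Y) y = _ := h4.deriv
  rw [h5, scoreSum, Finset.mul_sum, Finset.mul_sum]
  refine Finset.sum_congr rfl fun p _ => ?_
  simp only [weight, one_div, mul_inv]
  ring

theorem deriv_densityEstimate_pos_iff {K : Plane → ℝ} {L : ℝ → ℝ} (hL : Differentiable ℝ L)
    {n : ℕ} (hn : 0 < n) {h g : ℝ} (hh : 0 < h) (hg : 0 < g) (x : Plane) (Y : Pixel n → ℝ)
    (y : ℝ) :
    0 < deriv (densityEstimate K L n h g x Y) y ↔ 0 < scoreSum K L n h g x Y y := by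
  rw [deriv_densityEstimate hL]
  have : (0 : ℝ) < n := by exact_mod_cast hn
  exact mul_pos_iff_of_pos_left (by positivity)

theorem deriv_densityEstimate_neg_iff {K : Plane → ℝ} {L : ℝ → ℝ} (hL : Differentiable ℝ L)
    {n : ℕ} (hn : 0 < n) {h g : ℝ} (hh : 0 < h) (hg : 0 < g) (x : Plane) (Y : Pixel n → ℝ)
    (y : ℝ) :
    deriv (densityEstimate K L n h g x Y) y < 0 ↔ scoreSum K L n h g x Y y < 0 := by
  rw [deriv_densityEstimate hL]
  have : (0 : ℝ) < n := by exact_mod_cast hn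
  exact ⟨fun h' => by
      by_contra hc
      exact absurd h' (not_lt.2 (mul_nonneg (by positivity) (not_lt.1 hc))),
    fun h' => mul_neg_of_pos_of_neg (by positivity) h'⟩

section Search

variable {K : Plane → ℝ} {L : ℝ → ℝ} {n : ℕ} {h g : ℝ} {x : Plane} {Y : Pixel n → ℝ}

/-- An ascent to the right stops before the next point where the density estimate decreases. -/
theorem mSmoother_mem_Icc_of_pos (hL : Differentiable ℝ L) {z : ℝ}
    (hs : 0 < deriv (densityEstimate K L n h g x Y) (startValue n x Y))
    (hsz : startValue n x Y < z) (hz : deriv (densityEstimate K L n h g x Y) z < 0) :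
    mSmoother K L n h g x Y ∈ Icc (startValue n x Y) z := by
  obtain ⟨y, hy, hmax⟩ := exists_isLocalMax_of_deriv
    (differentiable_densityEstimate (K := K) hL n h g x Y) hsz hs hz
  have hmem : y ∈ ascendingModes K L n h g x Y :=
    ⟨hmax, fun h0 => absurd hs (not_lt.2 h0), fun _ => hy.1⟩
  have hlb : ∀ u ∈ ascendingModes K L n h g x Y, startValue n x Y ≤ u := fun u hu => (hu.2.2 hs).le
  rw [mSmoother, if_pos hs]
  exact ⟨le_csInf ⟨y, hmem⟩ hlb, (csInf_le ⟨_, hlb⟩ hmem).trans hy.2.le⟩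

/-- If the density estimate increases between the starting value and `lo` and decreases at
`hi > lo`, the ascent ends between `lo` and `hi`. -/
theorem mSmoother_mem_Icc_of_left (hL : Differentiable ℝ L) {lo hi : ℝ} (hlh : lo < hi)
    (hs : startValue n x Y ≤ lo)
    (hpos : ∀ y ∈ Icc (startValue n x Y) lo, 0 < deriv (densityEstimate K L n h g x Y) y)
    (hneg : deriv (densityEstimate K L n h g x Y) hi < 0) :
    mSmoother K L n h g x Y ∈ Icc lo hi := by
  have hs0 := hpos _ ⟨le_rfl, hs⟩
  obtain ⟨y, hy, hmax⟩ := exists_isLocalMax_of_deriv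
    (differentiable_densityEstimate (K := K) hL n h g x Y) hlh (hpos _ ⟨hs, le_rfl⟩) hneg
  have hmem : y ∈ ascendingModes K L n h g x Y :=
    ⟨hmax, fun h0 => absurd hs0 (not_lt.2 h0), fun _ => hs.trans_lt hy.1⟩
  have hlb : ∀ u ∈ ascendingModes K L n h g x Y, lo ≤ u := by
    intro u hu
    by_contra hlt
    have := hpos u ⟨(hu.2.2 hs0).le, (not_le.1 hlt).le⟩
    rw [hu.1.deriv_eq_zero] at this
    exact lt_irrefl _ this
  rw [mSmoother, if_pos hs0]
  exact ⟨le_csInf ⟨y, hmem⟩ hlb, (csInf_le ⟨_, hlb⟩ hmem).trans hy.2.le⟩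

/-- If the density estimate decreases between `hi` and the starting value and increases at
`lo < hi`, the ascent ends between `lo` and `hi`. -/
theorem mSmoother_mem_Icc_of_right (hL : Differentiable ℝ L) {lo hi : ℝ} (hlh : lo < hi)
    (hs : hi ≤ startValue n x Y)
    (hneg : ∀ y ∈ Icc hi (startValue n x Y), deriv (densityEstimate K L n h g x Y) y < 0)
    (hpos : 0 < deriv (densityEstimate K L n h g x Y) lo) :
    mSmoother K L n h g x Y ∈ Icc lo hi := by
  have hs0 := hneg _ ⟨hs, le_rfl⟩
  obtain ⟨y, hy, hmax⟩ := exists_isLocalMax_of_deriv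
    (differentiable_densityEstimate (K := K) hL n h g x Y) hlh hpos (hneg _ ⟨le_rfl, hs⟩)
  have hmem : y ∈ ascendingModes K L n h g x Y :=
    ⟨hmax, fun _ => (hy.2.trans_le hs).le, fun h0 => absurd h0 (not_lt.2 hs0.le)⟩
  have hub : ∀ u ∈ ascendingModes K L n h g x Y, u ≤ hi := by
    intro u hu
    by_contra hlt
    have := hneg u ⟨(not_le.1 hlt).le, hu.2.1 hs0.le⟩
    rw [hu.1.deriv_eq_zero] at this
    exact lt_irrefl _ this
  rw [mSmoother, if_neg (not_lt.2 hs0.le)]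
  exact ⟨hy.1.le.trans (le_csSup ⟨_, hub⟩ hmem), csSup_le ⟨y, hmem⟩ hub⟩

/-- The M-smoother avoids intervals without critical points that do not contain `0`. -/
theorem mSmoother_notMem_Ioo {a b : ℝ} (h0 : (0 : ℝ) ∉ Ioo a b)
    (hne : ∀ y ∈ Ioo a b, deriv (densityEstimate K L n h g x Y) y ≠ 0) :
    mSmoother K L n h g x Y ∉ Ioo a b := by
  have hA : ∀ y ∈ ascendingModes K L n h g x Y, y ∉ Ioo a b :=
    fun y hy hm => hne y hm hy.1.deriv_eq_zero
  intro hmem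
  rcases (ascendingModes K L n h g x Y).eq_empty_or_nonempty with he | hne'
  -- Without any mode the value is the default `0`; this is why `0` has to lie outside the interval.
  · rw [mSmoother, he] at hmem
    simp only [Real.sInf_empty, Real.sSup_empty, ite_self] at hmem
    exact h0 hmem
  · rw [mSmoother] at hmem
    split_ifs at hmem with hs
    -- The infimum need not be a mode itself, but an infimum inside the open interval forces some
    -- mode into it.
    · obtain ⟨y, hy, hlt⟩ := exists_lt_of_csInf_lt hne' hmem.2
      exact hA y hy ⟨hmem.1.trans_le
        (csInf_le ⟨startValue n x Y, fun u hu => (hu.2.2 hs).le⟩ hy), hlt⟩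
    · obtain ⟨y, hy, hlt⟩ := exists_lt_of_lt_csSup hne' hmem.1
      exact hA y hy ⟨hlt, (le_csSup ⟨startValue n x Y, fun u hu => hu.2.1 (not_lt.1 hs)⟩
        hy).trans_lt hmem.2⟩

end Search

/-! ### Measurability of the M-smoother -/

section Measurability

variable {X : Type*} [TopologicalSpace X] {F : X → ℝ → ℝ} {s : X → ℝ}

theorem isClosed_forall_le (hF : Continuous (Function.uncurry F)) (a b : ℝ) :
    IsClosed {q : X × ℝ | ∀ z ∈ Icc a b, F q.1 z ≤ F q.1 q.2} := by
  simp only [ofPred_forall]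
  refine isClosed_iInter fun z => isClosed_iInter fun _ => isClosed_le ?_ ?_
  · exact hF.comp (continuous_fst.prodMk continuous_const)
  · exact hF.comp (continuous_fst.prodMk continuous_snd)

/-- Projection along the compact factor `Icc a' b'` is a closed map, so the existential quantifier
over the maximizer preserves closedness. -/
theorem isClosed_exists_forall_le (hF : Continuous (Function.uncurry F)) (a a' b' b : ℝ) :
    IsClosed {x | ∃ c ∈ Icc a' b', ∀ z ∈ Icc a b, F x z ≤ F x c} := by
  have h1 : IsClosed {q : X × Icc a' b' | ∀ z ∈ Icc a b, F q.1 z ≤ F q.1 q.2} :=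
    (isClosed_forall_le hF a b).preimage
      (continuous_fst.prodMk (continuous_subtype_val.comp continuous_snd))
  have h2 := isClosedMap_fst_of_compactSpace _ h1
  convert h2 using 1
  ext x
  constructor
  · rintro ⟨c, hc, hz⟩
    exact ⟨(x, ⟨c, hc⟩), hz, rfl⟩
  · rintro ⟨⟨x', c⟩, hz, rfl⟩
    exact ⟨c, c.2, hz⟩

variable [MeasurableSpace X] [OpensMeasurableSpace X]

/-- A local maximum is a maximum over some interval with rational ends, located in a smaller
rational interval. Countably many closed conditions thus describe the existence of a mode, which
yields measurability. -/
theorem exists_isLocalMax_iff {H : ℝ → ℝ} {u v : ℝ} :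
    (∃ y, IsLocalMax H y ∧ u < y ∧ y < v) ↔
      ∃ a a' b' b : ℚ, (a : ℝ) < a' ∧ (b' : ℝ) < b ∧ u < a' ∧ (b' : ℝ) < v ∧
        ∃ c ∈ Icc (a' : ℝ) b', ∀ z ∈ Icc (a : ℝ) b, H z ≤ H c := by
  constructor
  · rintro ⟨y, hy, huy, hyv⟩
    obtain ⟨ε, hε, hball⟩ := Metric.eventually_nhds_iff.1 hy
    obtain ⟨a, ha1, ha2⟩ := exists_rat_btwn (show y - ε < y by linarith)
    obtain ⟨b, hb1, hb2⟩ := exists_rat_btwn (show y < y + ε by linarith)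
    obtain ⟨a', ha'1, ha'2⟩ := exists_rat_btwn (max_lt huy ha2)
    obtain ⟨b', hb'1, hb'2⟩ := exists_rat_btwn (lt_min hyv hb1)
    refine ⟨a, a', b', b, (le_max_right _ _).trans_lt ha'1, hb'2.trans_le (min_le_right _ _),
      (le_max_left _ _).trans_lt ha'1, hb'2.trans_le (min_le_left _ _), y,
      ⟨ha'2.le, hb'1.le⟩, fun z hz => hball ?_⟩
    rw [Real.dist_eq, abs_lt]
    constructor <;> linarith [hz.1, hz.2]
  · rintro ⟨a, a', b', b, h1, h2, h3, h4, c, hc, hmax⟩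
    refine ⟨c, ?_, h3.trans_le hc.1, hc.2.trans_lt h4⟩
    filter_upwards [Icc_mem_nhds (h1.trans_le hc.1) (hc.2.trans_lt h2)] with z hz
    exact hmax z hz

theorem measurableSet_exists_isLocalMax (hF : Continuous (Function.uncurry F))
    {u v : X → ℝ} (hu : Measurable u) (hv : Measurable v) :
    MeasurableSet {x | ∃ y, IsLocalMax (F x) y ∧ u x < y ∧ y < v x} := by
  simp only [exists_isLocalMax_iff, ofPred_exists]
  refine MeasurableSet.iUnion fun a => MeasurableSet.iUnion fun a' => MeasurableSet.iUnion fun b' =>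
    MeasurableSet.iUnion fun b => ?_
  simp only [ofPred_and]
  refine (MeasurableSet.const _).inter ((MeasurableSet.const _).inter
    ((measurableSet_lt hu measurable_const).inter ((measurableSet_lt measurable_const hv).inter ?_)))
  exact (isClosed_exists_forall_le hF _ _ _ _).measurableSet

theorem measurableSet_isLocalMax_self (hF : Continuous (Function.uncurry F)) (hs : Continuous s) :
    MeasurableSet {x | IsLocalMax (F x) (s x)} := by
  have : {x | IsLocalMax (F x) (s x)} = ⋃ (a : ℚ) (b : ℚ),
      {x | (a : ℝ) < s x} ∩ ({x | s x < b} ∩ {x | ∀ z ∈ Icc (a : ℝ) b, F x z ≤ F x (s x)}) := by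
    ext x
    simp only [mem_iUnion, mem_inter_iff, mem_ofPred_eq]
    constructor
    · intro hy
      obtain ⟨ε, hε, hball⟩ := Metric.eventually_nhds_iff.1 hy
      obtain ⟨a, ha1, ha2⟩ := exists_rat_btwn (show s x - ε < s x by linarith)
      obtain ⟨b, hb1, hb2⟩ := exists_rat_btwn (show s x < s x + ε by linarith)
      refine ⟨a, b, ha2, hb1, fun z hz => hball ?_⟩
      rw [Real.dist_eq, abs_lt]
      constructor <;> linarith [hz.1, hz.2]
    · rintro ⟨a, b, h1, h2, h3⟩
      filter_upwards [Icc_mem_nhds h1 h2] with z hz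
      exact h3 z hz
  rw [this]
  refine MeasurableSet.iUnion fun a => MeasurableSet.iUnion fun b =>
    (measurableSet_lt measurable_const hs.measurable).inter
      ((measurableSet_lt hs.measurable measurable_const).inter ?_)
  exact ((isClosed_forall_le hF a b).preimage (continuous_id.prodMk hs)).measurableSet

theorem measurable_sInf_isLocalMax (hF : Continuous (Function.uncurry F)) (hs : Continuous s) :
    Measurable fun x => sInf {y | IsLocalMax (F x) y ∧ s x < y} := by
  have hne : MeasurableSet {x | {y | IsLocalMax (F x) y ∧ s x < y}.Nonempty} := by
    have : {x | {y | IsLocalMax (F x) y ∧ s x < y}.Nonempty} =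
        ⋃ k : ℕ, {x | ∃ y, IsLocalMax (F x) y ∧ s x < y ∧ y < (fun _ => (k : ℝ)) x} := by
      ext x
      simp only [mem_iUnion, mem_ofPred_eq]
      constructor
      · rintro ⟨y, h1, h2⟩
        obtain ⟨k, hk⟩ := exists_nat_gt y
        exact ⟨k, y, h1, h2, hk⟩
      · rintro ⟨k, y, h1, h2, _⟩
        exact ⟨y, h1, h2⟩
    rw [this]
    exact MeasurableSet.iUnion fun k =>
      measurableSet_exists_isLocalMax hF hs.measurable measurable_const
  refine measurable_of_Iio fun t => ?_
  -- The infimum of the empty set is `0`, so the samples without modes belong to the preimage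
  -- exactly when `0 < t`.
  have : (fun x => sInf {y | IsLocalMax (F x) y ∧ s x < y}) ⁻¹' Iio t =
      {x | ∃ y, IsLocalMax (F x) y ∧ s x < y ∧ y < (fun _ => t) x} ∪
        ({x | {y | IsLocalMax (F x) y ∧ s x < y}.Nonempty}ᶜ ∩ {_x | 0 < t}) := by
    ext x
    simp only [mem_preimage, mem_Iio, mem_union, mem_inter_iff, mem_compl_iff, mem_ofPred_eq]
    rcases {y | IsLocalMax (F x) y ∧ s x < y}.eq_empty_or_nonempty with he | hne
    · have hno : ¬ ∃ y, IsLocalMax (F x) y ∧ s x < y ∧ y < t := by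
        rintro ⟨y, h1, h2, _⟩
        have : y ∈ {y | IsLocalMax (F x) y ∧ s x < y} := ⟨h1, h2⟩
        rw [he] at this
        exact this
      simp [he, hno]
    · simp only [hne, not_true_eq_false, false_and, or_false]
      rw [csInf_lt_iff ⟨s x, fun y hy => hy.2.le⟩ hne]
      constructor
      · rintro ⟨y, ⟨h1, h2⟩, h3⟩
        exact ⟨y, h1, h2, h3⟩
      · rintro ⟨y, h1, h2, h3⟩
        exact ⟨y, ⟨h1, h2⟩, h3⟩
  rw [this]
  exact (measurableSet_exists_isLocalMax hF hs.measurable measurable_const).union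
    (hne.compl.inter (MeasurableSet.const _))

theorem measurable_sSup_isLocalMax (hF : Continuous (Function.uncurry F)) (hs : Continuous s) :
    Measurable fun x => sSup {y | IsLocalMax (F x) y ∧ y ≤ s x} := by
  have hex : ∀ t : ℝ, MeasurableSet {x | ∃ y, IsLocalMax (F x) y ∧ t < y ∧ y ≤ s x} := by
    intro t
    -- In the descending direction the starting value itself is admissible and has to be split off.
    have : {x | ∃ y, IsLocalMax (F x) y ∧ t < y ∧ y ≤ s x} =
        {x | ∃ y, IsLocalMax (F x) y ∧ (fun _ => t) x < y ∧ y < s x} ∪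
          ({x | IsLocalMax (F x) (s x)} ∩ {x | t < s x}) := by
      ext x
      simp only [mem_union, mem_inter_iff, mem_ofPred_eq]
      constructor
      · rintro ⟨y, h1, h2, h3⟩
        rcases h3.lt_or_eq with h4 | rfl
        · exact Or.inl ⟨y, h1, h2, h4⟩
        · exact Or.inr ⟨h1, h2⟩
      · rintro (⟨y, h1, h2, h3⟩ | ⟨h1, h2⟩)
        · exact ⟨y, h1, h2, h3.le⟩
        · exact ⟨_, h1, h2, le_rfl⟩
    rw [this]
    exact (measurableSet_exists_isLocalMax hF measurable_const hs.measurable).union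
      ((measurableSet_isLocalMax_self hF hs).inter
        (measurableSet_lt measurable_const hs.measurable))
  have hne : MeasurableSet {x | {y | IsLocalMax (F x) y ∧ y ≤ s x}.Nonempty} := by
    have : {x | {y | IsLocalMax (F x) y ∧ y ≤ s x}.Nonempty} =
        ⋃ k : ℕ, {x | ∃ y, IsLocalMax (F x) y ∧ -(k : ℝ) < y ∧ y ≤ s x} := by
      ext x
      simp only [mem_iUnion, mem_ofPred_eq]
      constructor
      · rintro ⟨y, h1, h2⟩
        obtain ⟨k, hk⟩ := exists_nat_gt (-y)
        exact ⟨k, y, h1, by linarith, h2⟩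
      · rintro ⟨k, y, h1, _, h2⟩
        exact ⟨y, h1, h2⟩
    rw [this]
    exact MeasurableSet.iUnion fun k => hex _
  refine measurable_of_Ioi fun t => ?_
  have : (fun x => sSup {y | IsLocalMax (F x) y ∧ y ≤ s x}) ⁻¹' Ioi t =
      {x | ∃ y, IsLocalMax (F x) y ∧ t < y ∧ y ≤ s x} ∪
        ({x | {y | IsLocalMax (F x) y ∧ y ≤ s x}.Nonempty}ᶜ ∩ {_x | t < 0}) := by
    ext x
    simp only [mem_preimage, mem_Ioi, mem_union, mem_inter_iff, mem_compl_iff, mem_ofPred_eq]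
    rcases {y | IsLocalMax (F x) y ∧ y ≤ s x}.eq_empty_or_nonempty with he | hne
    · have hno : ¬ ∃ y, IsLocalMax (F x) y ∧ t < y ∧ y ≤ s x := by
        rintro ⟨y, h1, _, h2⟩
        have : y ∈ {y | IsLocalMax (F x) y ∧ y ≤ s x} := ⟨h1, h2⟩
        rw [he] at this
        exact this
      simp [he, hno]
    · simp only [hne, not_true_eq_false, false_and, or_false]
      rw [lt_csSup_iff ⟨s x, fun y hy => hy.2⟩ hne]
      constructor
      · rintro ⟨y, ⟨h1, h2⟩, h3⟩
        exact ⟨y, h1, h3, h2⟩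
      · rintro ⟨y, h1, h2, h3⟩
        exact ⟨y, ⟨h1, h3⟩, h2⟩
  rw [this]
  exact (hex t).union (hne.compl.inter (MeasurableSet.const _))

end Measurability

theorem continuous_startValue (n : ℕ) (x : Plane) : Continuous (startValue n x) := by
  unfold startValue
  split_ifs
  · exact continuous_apply _
  · exact continuous_const

/-- The M-smoother is a measurable function of the data. -/
theorem measurable_mSmoother (K : Plane → ℝ) {L : ℝ → ℝ} (hL : Differentiable ℝ L)
    (hL' : Continuous (deriv L)) (n : ℕ) (h g : ℝ) (x : Plane) :
    Measurable (mSmoother K L n h g x) := by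
  have hF : Continuous (Function.uncurry (densityEstimate K L n h g x)) := by
    have := hL.continuous
    unfold densityEstimate Function.uncurry
    fun_prop
  have hD : Continuous fun Y =>
      deriv (densityEstimate K L n h g x Y) (startValue n x Y) := by
    have := continuous_startValue n x
    simp only [deriv_densityEstimate hL, scoreSum]
    fun_prop
  have hs := continuous_startValue n x
  have key : mSmoother K L n h g x = fun Y =>
      if 0 < deriv (densityEstimate K L n h g x Y) (startValue n x Y) then
        sInf {y | IsLocalMax (densityEstimate K L n h g x Y) y ∧ startValue n x Y < y}
      else sSup {y | IsLocalMax (densityEstimate K L n h g x Y) y ∧ y ≤ startValue n x Y} := by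
    funext Y
    unfold mSmoother ascendingModes
    split_ifs with hp
    · simp [hp, not_le.2 hp]
    · simp [hp, not_lt.1 hp]
  rw [key]
  exact Measurable.ite (measurableSet_lt measurable_const hD.measurable)
    (measurable_sInf_isLocalMax hF hs) (measurable_sSup_isLocalMax hF hs)

end MSmoother

namespace MSmoother

/-! ### The Lévy metric -/

theorem levyDist_le {P Q : Measure ℝ} {ε : ℝ} (hε : 0 ≤ ε) (h : ∀ y : ℝ,
    P.real (Iic (y - ε)) - ε ≤ Q.real (Iic y) ∧ Q.real (Iic y) ≤ P.real (Iic (y + ε)) + ε) :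
    levyDist P Q ≤ ε :=
  csInf_le ⟨0, fun _ h' => h'.1⟩ ⟨hε, h⟩

section Levy

variable {P Q : Measure ℝ} [IsProbabilityMeasure P] [IsProbabilityMeasure Q]

theorem exists_of_levyDist_lt {ε : ℝ} (hε : levyDist P Q < ε) : ∃ δ, 0 ≤ δ ∧ δ < ε ∧ ∀ y : ℝ,
    P.real (Iic (y - δ)) - δ ≤ Q.real (Iic y) ∧ Q.real (Iic y) ≤ P.real (Iic (y + δ)) + δ := by
  have hne : {ε : ℝ | 0 ≤ ε ∧ ∀ y : ℝ,
    P.real (Iic (y - ε)) - ε ≤ Q.real (Iic y) ∧ Q.real (Iic y) ≤ P.real (Iic (y + ε)) + ε}.Nonempty :=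
    ⟨1, zero_le_one, fun y => ⟨by
      have h1 : P.real (Iic (y - 1)) ≤ 1 := measureReal_le_one
      have h2 : 0 ≤ Q.real (Iic y) := measureReal_nonneg
      linarith, by
      have h1 : Q.real (Iic y) ≤ 1 := measureReal_le_one
      have h2 : 0 ≤ P.real (Iic (y + 1)) := measureReal_nonneg
      linarith⟩⟩
  obtain ⟨δ, ⟨h0, h1⟩, h2⟩ := exists_lt_of_csInf_lt hne hε
  exact ⟨δ, h0, h2, h1⟩

/-- If `y` is right of the interval, `Q` has almost all its mass below `y`. Otherwise `y - ε` is
left of the interval because `2 * δ ≤ ε`, and `P` has almost no mass below it. -/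
theorem measureReal_Iic_sub_le_of_concentrated {P Q : Measure ℝ} [IsProbabilityMeasure P]
    [IsProbabilityMeasure Q] {m δ κ ε : ℝ} (hδ : 2 * δ ≤ ε) (hκ : κ ≤ ε)
    (hP : P.real (Icc (m - δ) (m + δ))ᶜ ≤ κ) (hQ : Q.real (Icc (m - δ) (m + δ))ᶜ ≤ κ) (y : ℝ) :
    P.real (Iic (y - ε)) - ε ≤ Q.real (Iic y) := by
  rcases le_or_gt (m + δ) y with hy | hy
  · have h1 : P.real (Iic (y - ε)) ≤ 1 := measureReal_le_one
    have h2 : Q.real (Iic y)ᶜ ≤ κ := by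
      refine (measureReal_mono (compl_subset_compl.2 ?_)).trans hQ
      exact fun z hz => hz.2.trans hy
    rw [probReal_compl_eq_one_sub measurableSet_Iic] at h2
    linarith
  · have h1 : P.real (Iic (y - ε)) ≤ κ := by
      refine (measureReal_mono ?_).trans hP
      intro z hz hz'
      have h3 : z ≤ y - ε := hz
      linarith [hz'.1]
    have h2 : 0 ≤ Q.real (Iic y) := measureReal_nonneg
    linarith

/-- Two probability measures that are both concentrated near the same point are close. -/
theorem levyDist_le_of_concentrated {m δ κ ε : ℝ} (hε : 0 ≤ ε) (hδ : 2 * δ ≤ ε) (hκ : κ ≤ ε)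
    (hP : P.real (Icc (m - δ) (m + δ))ᶜ ≤ κ) (hQ : Q.real (Icc (m - δ) (m + δ))ᶜ ≤ κ) :
    levyDist P Q ≤ ε := by
  refine levyDist_le hε fun y => ⟨measureReal_Iic_sub_le_of_concentrated hδ hκ hP hQ y, ?_⟩
  have := measureReal_Iic_sub_le_of_concentrated hδ hκ hQ hP (y + ε)
  rw [add_sub_cancel_right] at this
  linarith

/-- Used to separate laws: an interval likely under `Q` and surrounded by a slightly larger one
unlikely under `P` bounds the Lévy distance from below. -/
theorem measureReal_Icc_le_of_levyDist_lt {ε : ℝ} (hε : levyDist P Q < ε) {u v : ℝ}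
    (huv : u ≤ v) : Q.real (Icc u v) ≤ P.real (Ioo (u - ε) (v + ε)) + 2 * ε := by
  obtain ⟨δ, h0, hlt, h⟩ := exists_of_levyDist_lt hε
  have h1 := (h v).2
  -- Evaluation strictly left of `u` avoids a possible atom of `Q` at `u`; the slack `ε - δ` pays
  -- for it.
  have h2 := (h (u - (ε - δ))).1
  rw [show u - (ε - δ) - δ = u - ε by ring] at h2
  have h3 : Q.real (Icc u v) = Q.real (Iic v) - Q.real (Iio u) := by
    have hsub : Iio u ⊆ Iic v := fun z hz => (le_of_lt hz).trans huv
    rw [← measureReal_sdiff hsub measurableSet_Iio]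
    congr 1
    ext z
    simp
  have h4 : P.real (Ioc (u - ε) (v + δ)) = P.real (Iic (v + δ)) - P.real (Iic (u - ε)) := by
    rw [← measureReal_sdiff (Iic_subset_Iic.2 (by linarith)) measurableSet_Iic]
    congr 1
    ext z
    simp [and_comm]
  have h5 : Q.real (Iic (u - (ε - δ))) ≤ Q.real (Iio u) :=
    measureReal_mono fun z (hz : z ≤ u - (ε - δ)) => show z < u by linarith
  have h6 : P.real (Ioc (u - ε) (v + δ)) ≤ P.real (Ioo (u - ε) (v + ε)) :=
    measureReal_mono fun z hz => ⟨hz.1, by linarith [hz.2]⟩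
  linarith

end Levy

/-! ### Distributions with a density -/

namespace HasDensityOn

variable {P : Measure ℝ} {f : ℝ → ℝ} {I : Set ℝ}

theorem lintegral_eq_one [hP : IsProbabilityMeasure P] (h : HasDensityOn P f I) :
    ∫⁻ y, ENNReal.ofReal (f y) = 1 := by
  have := hP.measure_univ
  rwa [h.eq_withDensity, withDensity_apply _ MeasurableSet.univ, Measure.restrict_univ] at this

theorem integrable [IsProbabilityMeasure P] (h : HasDensityOn P f I) : Integrable f := by
  refine ⟨h.measurable.aestronglyMeasurable, ?_⟩
  rw [hasFiniteIntegral_iff_ofReal (Eventually.of_forall h.nonneg), h.lintegral_eq_one]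
  exact ENNReal.one_lt_top

theorem integral_eq_one [IsProbabilityMeasure P] (h : HasDensityOn P f I) : ∫ y, f y = 1 := by
  rw [integral_eq_lintegral_of_nonneg_ae (Eventually.of_forall h.nonneg)
    h.measurable.aestronglyMeasurable, h.lintegral_eq_one, ENNReal.toReal_one]

theorem integral_eq (h : HasDensityOn P f I) (φ : ℝ → ℝ) : ∫ y, φ y ∂P = ∫ y, φ y * f y := by
  rw [h.eq_withDensity, integral_withDensity_eq_integral_toReal_smul h.measurable.ennreal_ofReal
    (Eventually.of_forall fun _ => ENNReal.ofReal_lt_top)]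
  refine integral_congr_ae (Eventually.of_forall fun y => ?_)
  simp only [ENNReal.toReal_ofReal (h.nonneg y), smul_eq_mul, mul_comm]

theorem measureReal_eq [IsProbabilityMeasure P] (h : HasDensityOn P f I) {s : Set ℝ}
    (hs : MeasurableSet s) : P.real s = ∫ y in s, f y := by
  rw [integral_eq_lintegral_of_nonneg_ae (Eventually.of_forall h.nonneg)
    h.measurable.aestronglyMeasurable, measureReal_def]
  conv_lhs => rw [h.eq_withDensity]
  rw [withDensity_apply _ hs]

/-- Short intervals have small probability. -/
theorem exists_measureReal_Icc_le [IsProbabilityMeasure P] (h : HasDensityOn P f I) {κ : ℝ}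
    (hκ : 0 < κ) : ∃ δ > 0, ∀ a b : ℝ, b - a ≤ δ → P.real (Icc a b) ≤ κ := by
  have hfin : ∫⁻ y, ENNReal.ofReal (f y) ≠ ∞ := by rw [h.lintegral_eq_one]; exact ENNReal.one_ne_top
  obtain ⟨δ, hδ, hδ'⟩ := exists_pos_setLIntegral_lt_of_measure_lt hfin
    (ENNReal.ofReal_pos.2 hκ).ne'
  obtain ⟨δ', h1, h2⟩ : ∃ δ' : ℝ, 0 < δ' ∧ ENNReal.ofReal δ' < δ := by
    rcases eq_or_ne δ ∞ with rfl | hne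
    · exact ⟨1, one_pos, ENNReal.ofReal_lt_top⟩
    · refine ⟨δ.toReal / 2, by have := ENNReal.toReal_pos hδ.ne' hne; positivity, ?_⟩
      rw [ENNReal.ofReal_lt_iff_lt_toReal (by positivity) hne]
      linarith [ENNReal.toReal_pos hδ.ne' hne]
  refine ⟨δ', h1, fun a b hab => ?_⟩
  have h3 : P (Icc a b) < ENNReal.ofReal κ := by
    rw [h.eq_withDensity, withDensity_apply _ measurableSet_Icc]
    refine hδ' _ ?_
    rw [Real.volume_Icc]
    exact (ENNReal.ofReal_le_ofReal hab).trans_lt h2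
  rw [measureReal_def]
  exact (ENNReal.toReal_le_of_le_ofReal hκ.le h3.le)

/-- Near a distribution with a density, the Lévy metric controls the Kolmogorov metric. -/
theorem exists_abs_measureReal_Iic_sub_le [IsProbabilityMeasure P] (h : HasDensityOn P f I)
    {κ : ℝ} (hκ : 0 < κ) : ∃ ε > 0, ∀ Q : Measure ℝ, IsProbabilityMeasure Q → levyDist P Q ≤ ε →
      ∀ y, |Q.real (Iic y) - P.real (Iic y)| ≤ κ := by
  obtain ⟨δ, hδ, hP⟩ := h.exists_measureReal_Icc_le (half_pos hκ)
  refine ⟨min δ (κ / 2) / 2, by positivity, fun Q hQ hle y => ?_⟩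
  have hm : 0 < min δ (κ / 2) := by positivity
  obtain ⟨η, h0, h1, h2⟩ := exists_of_levyDist_lt (hle.trans_lt (half_lt_self hm))
  have hη1 : η ≤ δ := h1.le.trans (min_le_left _ _)
  have hη2 : η ≤ κ / 2 := h1.le.trans (min_le_right _ _)
  have h3 : P.real (Iic (y + η)) ≤ P.real (Iic y) + P.real (Icc y (y + η)) := by
    refine (measureReal_mono ?_).trans (measureReal_union_le _ _)
    intro z hz
    rcases le_total z y with h' | h'
    · exact Or.inl h'
    · exact Or.inr ⟨h', hz⟩
  have h4 : P.real (Iic y) ≤ P.real (Iic (y - η)) + P.real (Icc (y - η) y) := by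
    refine (measureReal_mono ?_).trans (measureReal_union_le _ _)
    intro z hz
    rcases le_total z (y - η) with h' | h'
    · exact Or.inl h'
    · exact Or.inr ⟨h', hz⟩
  have h5 := hP y (y + η) (by linarith)
  have h6 := hP (y - η) y (by linarith)
  rw [abs_le]
  constructor <;> linarith [(h2 y).1, (h2 y).2]

end HasDensityOn

/-! ### Expectations and distribution functions -/

/-- The expectation of a smooth function with compact support in terms of the distribution
function. -/
theorem integral_eq_neg_integral_deriv_mul {φ : ℝ → ℝ} (hφ : ContDiff ℝ 1 φ)
    (hc : HasCompactSupport φ) (Q : Measure ℝ) [IsProbabilityMeasure Q] :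
    ∫ u, φ u ∂Q = -∫ v, deriv φ v * Q.real (Iic v) := by
  have hd : Continuous (deriv φ) := hφ.continuous_deriv le_rfl
  have hdi : Integrable (deriv φ) := hd.integrable_of_hasCompactSupport hc.deriv
  -- `φ u` is minus the integral of the derivative beyond `u`. As an integral over the whole line
  -- with an indicator, it can be swapped with the integral over `Q`.
  have h1 : ∀ u, φ u = -∫ v, deriv φ v * (Iic v).indicator (fun _ => (1 : ℝ)) u := by
    intro u
    have h2 : ∫ v in Ioi u, deriv φ v = -φ u := hc.integral_Ioi_deriv_eq hφ u
    rw [← integral_indicator measurableSet_Ioi] at h2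
    rw [← neg_eq_iff_eq_neg, ← h2]
    refine integral_congr_ae ?_
    have : ∀ᵐ v : ℝ, v ≠ u := by simp [ae_iff]
    filter_upwards [this] with v hv
    rcases lt_or_gt_of_ne hv with h3 | h3
    · simp [indicator, not_lt.2 h3.le, not_le.2 h3]
    · simp [indicator, h3, h3.le]
  have hmeas : Measurable fun q : ℝ × ℝ => deriv φ q.2 * (Iic q.2).indicator (fun _ => (1 : ℝ)) q.1 := by
    have : (fun q : ℝ × ℝ => deriv φ q.2 * (Iic q.2).indicator (fun _ => (1 : ℝ)) q.1) =
        {q : ℝ × ℝ | q.1 ≤ q.2}.indicator fun q => deriv φ q.2 := by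
      ext q
      by_cases hq : q.1 ≤ q.2 <;> simp [indicator, hq]
    rw [this]
    exact (hd.measurable.comp measurable_snd).indicator
      (measurableSet_le measurable_fst measurable_snd)
  have hint : Integrable (Function.uncurry fun u v : ℝ =>
      deriv φ v * (Iic v).indicator (fun _ => (1 : ℝ)) u) (Q.prod volume) := by
    refine Integrable.mono' (hdi.norm.comp_snd Q) hmeas.aestronglyMeasurable
      (Eventually.of_forall fun q => ?_)
    simp only [Function.uncurry, norm_mul]
    refine mul_le_of_le_one_right (norm_nonneg _) ?_
    by_cases hq : q.1 ≤ q.2 <;> simp [indicator, hq]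
  calc ∫ u, φ u ∂Q = ∫ u, (-∫ v, deriv φ v * (Iic v).indicator (fun _ => (1 : ℝ)) u) ∂Q :=
        integral_congr_ae (Eventually.of_forall h1)
    _ = -∫ u, (∫ v, deriv φ v * (Iic v).indicator (fun _ => (1 : ℝ)) u) ∂Q := integral_neg _
    _ = -∫ v, ∫ u, deriv φ v * (Iic v).indicator (fun _ => (1 : ℝ)) u ∂Q := by
        rw [integral_integral_swap hint]
    _ = -∫ v, deriv φ v * Q.real (Iic v) := by
        congr 1
        refine integral_congr_ae (Eventually.of_forall fun v => ?_)
        simp only [integral_const_mul]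
        rw [integral_indicator measurableSet_Iic]
        simp

/-- Expectations of translates of a smooth function with compact support are uniformly close for
distributions that are close in the Kolmogorov metric. -/
theorem abs_integral_sub_integral_le {ψ : ℝ → ℝ} (hψ : ContDiff ℝ 1 ψ)
    (hc : HasCompactSupport ψ) {P Q : Measure ℝ} [IsProbabilityMeasure P]
    [IsProbabilityMeasure Q] {κ : ℝ} (h : ∀ y, |Q.real (Iic y) - P.real (Iic y)| ≤ κ) {g : ℝ}
    (hg : 0 < g) (y : ℝ) :
    |∫ u, ψ ((y - u) / g) ∂Q - ∫ u, ψ ((y - u) / g) ∂P| ≤ κ * ∫ v, |deriv ψ v| := by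
  set φ : ℝ → ℝ := fun u => ψ ((y - u) / g) with hφdef
  have hφ : ContDiff ℝ 1 φ := hψ.comp (by fun_prop)
  have hcφ : HasCompactSupport φ := by
    have : φ = ψ ∘ ((Homeomorph.subLeft y).trans (Homeomorph.mulRight₀ g⁻¹ (inv_ne_zero hg.ne'))) := by
      ext u
      simp [hφdef, div_eq_mul_inv]
    rw [this]
    exact hc.comp_homeomorph _
  have hd : Continuous (deriv φ) := hφ.continuous_deriv le_rfl
  have hdi : Integrable (deriv φ) := hd.integrable_of_hasCompactSupport hcφ.deriv
  have hF : ∀ R : Measure ℝ, IsProbabilityMeasure R → Integrable fun v => deriv φ v * R.real (Iic v) := by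
    intro R hR
    have hmono : Monotone fun v => R.real (Iic v) :=
      fun a b hab => measureReal_mono (Iic_subset_Iic.2 hab)
    refine hdi.mul_bdd (c := 1) hmono.measurable.aestronglyMeasurable (Eventually.of_forall fun v => ?_)
    rw [Real.norm_eq_abs, abs_of_nonneg measureReal_nonneg]
    exact measureReal_le_one
  have hderiv : ∀ v, deriv φ v = deriv ψ ((y - v) / g) * (-1 / g) := by
    intro v
    have h1 : HasDerivAt (fun u => (y - u) / g) (-1 / g) v :=
      ((hasDerivAt_id v).const_sub y).div_const g
    exact (((hψ.differentiable one_ne_zero _).hasDerivAt).comp v h1).deriv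
  -- Total variation is invariant under reflection, translation and scaling, so the bound depends
  -- neither on `y` nor on `g`.
  have habs : ∫ v, |deriv φ v| = ∫ v, |deriv ψ v| := by
    have h1 : ∀ v, |deriv φ v| = g⁻¹ * (fun w => |deriv ψ (w / g)|) (y - v) := by
      intro v
      rw [hderiv, abs_mul, abs_div, abs_neg, abs_one, abs_of_pos hg, one_div, mul_comm]
    simp_rw [h1]
    rw [integral_const_mul, integral_sub_left_eq_self (fun w => |deriv ψ (w / g)|) volume y,
      Measure.integral_comp_div (fun v => |deriv ψ v|), abs_of_pos hg, smul_eq_mul,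
      inv_mul_cancel_left₀ hg.ne']
  rw [integral_eq_neg_integral_deriv_mul hφ hcφ Q, integral_eq_neg_integral_deriv_mul hφ hcφ P]
  rw [neg_sub_neg, ← integral_sub (hF P inferInstance) (hF Q inferInstance), ← habs,
    ← integral_const_mul, ← Real.norm_eq_abs]
  refine norm_integral_le_of_norm_le (hdi.abs.const_mul κ) (Eventually.of_forall fun v => ?_)
  rw [← mul_sub, norm_mul, Real.norm_eq_abs, Real.norm_eq_abs, abs_sub_comm, mul_comm]
  exact mul_le_mul_of_nonneg_right (h v) (abs_nonneg _)

end MSmoother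

namespace MSmoother

/-! ### Uniform deviations of weighted sums of independent random variables -/

section Deviation

variable {ι : Type*} [Fintype ι] {Q : Measure ℝ} [IsProbabilityMeasure Q] {a : ι → ℝ}
  {B V ω τ : ℝ}

theorem integrable_of_abs_le {X : ℝ → ℝ} (hX : Measurable X) {C : ℝ} (hC : ∀ u, |X u| ≤ C) :
    Integrable X Q :=
  Integrable.of_bound hX.aestronglyMeasurable C (Eventually.of_forall hC)

/-- The exponent is at most `1` in absolute value, where the exponential of `x` is at most `1 + x +
x ^ 2`. The linear term has mean zero and the quadratic one is at most the second moment. -/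
theorem integral_exp_le {X : ℝ → ℝ} (hX : Measurable X) (hB : ∀ u, |X u| ≤ B)
    (hV : ∫ u, X u ^ 2 ∂Q ≤ V) {t : ℝ} (ht : 0 ≤ t) (htB : t * (2 * B) ≤ 1) :
    ∫ u, Real.exp (t * (X u - ∫ v, X v ∂Q)) ∂Q ≤ Real.exp (t ^ 2 * V) := by
  set E := ∫ v, X v ∂Q with hE
  have hXi : Integrable X Q := integrable_of_abs_le hX hB
  have hEB : |E| ≤ B := by
    have := norm_integral_le_of_norm_le_const (μ := Q) (f := X) (C := B) (Eventually.of_forall hB)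
    simpa using this
  have hb : ∀ u, |t * (X u - E)| ≤ 1 := by
    intro u
    rw [abs_mul, abs_of_nonneg ht]
    refine (mul_le_mul_of_nonneg_left ?_ ht).trans htB
    calc |X u - E| ≤ |X u| + |E| := abs_sub _ _
      _ ≤ 2 * B := by linarith [hB u]
  have hXm : Measurable fun u => X u - E := hX.sub_const _
  have hX2 : Integrable (fun u => (X u - E) ^ 2) Q := by
    refine integrable_of_abs_le (C := (2 * B) ^ 2) (hXm.pow_const 2) fun u => ?_
    rw [abs_pow]
    refine pow_le_pow_left₀ (abs_nonneg _) ?_ 2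
    calc |X u - E| ≤ |X u| + |E| := abs_sub _ _
      _ ≤ 2 * B := by linarith [hB u]
  have hXsq : Integrable (fun u => X u ^ 2) Q := by
    refine integrable_of_abs_le (C := B ^ 2) (hX.pow_const 2) fun u => ?_
    rw [abs_pow]
    exact pow_le_pow_left₀ (abs_nonneg _) (hB u) 2
  have hexp : Integrable (fun u => Real.exp (t * (X u - E))) Q := by
    refine integrable_of_abs_le (C := Real.exp 1) (hXm.const_mul t).exp fun u => ?_
    rw [abs_of_pos (Real.exp_pos _)]
    exact Real.exp_le_exp.2 ((le_abs_self _).trans (hb u))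
  have hlin : Integrable (fun u => t * (X u - E)) Q := (hXi.sub (integrable_const _)).const_mul t
  have hzero : ∫ u, t * (X u - E) ∂Q = 0 := by
    rw [integral_const_mul, integral_sub hXi (integrable_const _)]
    simp [hE]
  have hvar : ∫ u, (X u - E) ^ 2 ∂Q ≤ V := by
    have h1 : ∀ u, (X u - E) ^ 2 = X u ^ 2 - 2 * E * X u + E ^ 2 := fun u => by ring
    simp_rw [h1]
    have h2 : Integrable (fun u => X u ^ 2 - 2 * E * X u) Q := hXsq.sub (hXi.const_mul _)
    rw [integral_add h2 (integrable_const _),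
      integral_sub hXsq (hXi.const_mul _), integral_const_mul, ← hE]
    simp
    nlinarith [sq_nonneg E]
  calc ∫ u, Real.exp (t * (X u - E)) ∂Q
      ≤ ∫ u, (1 + t * (X u - E) + t ^ 2 * (X u - E) ^ 2) ∂Q := by
        refine integral_mono hexp (((integrable_const _).add hlin).add (hX2.const_mul _)) fun u => ?_
        have h1 := Real.abs_exp_sub_one_sub_id_le (hb u)
        have h2 := le_of_abs_le h1
        rw [mul_pow] at h2
        simp only
        linarith
    _ = 1 + t ^ 2 * ∫ u, (X u - E) ^ 2 ∂Q := by
        have h1 : Integrable (fun u => 1 + t * (X u - E)) Q := (integrable_const _).add hlin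
        rw [integral_add h1 (hX2.const_mul _),
          integral_add (integrable_const _) hlin, hzero, integral_const_mul]
        simp
    _ ≤ 1 + t ^ 2 * V := by gcongr
    _ ≤ Real.exp (t ^ 2 * V) := by linarith [Real.add_one_le_exp (t ^ 2 * V)]

theorem sum_sq_le_of_le (ha : ∀ p, 0 ≤ a p) (hsum : ∑ p, a p = 1) (hω : ∀ p, a p ≤ ω) :
    ∑ p, a p ^ 2 ≤ ω := by
  calc ∑ p, a p ^ 2 ≤ ∑ p, ω * a p :=
        Finset.sum_le_sum fun p _ => by rw [sq]; exact mul_le_mul_of_nonneg_right (hω p) (ha p)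
    _ = ω := by rw [← Finset.mul_sum, hsum, mul_one]

/-- Chernoff's method: independence factorizes the exponential moment, and the squared weights sum
to at most `ω`. -/
theorem measureReal_le_sum_le (ha : ∀ p, 0 ≤ a p) (hsum : ∑ p, a p = 1) (hω : ∀ p, a p ≤ ω)
    (hω0 : 0 < ω) (hV0 : 0 < V) (hτ : 0 < τ) (hτB : τ * B ≤ V) {X : ι → ℝ → ℝ}
    (hX : ∀ p, Measurable (X p)) (hB : ∀ p u, |X p u| ≤ B) (hV : ∀ p, ∫ u, X p u ^ 2 ∂Q ≤ V) :
    (Measure.pi fun _ : ι => Q).real {e | τ ≤ ∑ p, a p * (X p (e p) - ∫ v, X p v ∂Q)} ≤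
      Real.exp (-(τ ^ 2 / (4 * ω * V))) := by
  -- This `t` minimizes `t ^ 2 * V * ω - t * τ`; the condition `τ * B ≤ V` keeps all exponents in
  -- the range of the quadratic bound.
  set t := τ / (2 * ω * V) with ht
  have ht0 : 0 < t := by positivity
  set μ := Measure.pi fun _ : ι => Q with hμ
  have hmgf : ∫ e, Real.exp (t * ∑ p, a p * (X p (e p) - ∫ v, X p v ∂Q)) ∂μ ≤
      Real.exp (t ^ 2 * V * ω) := by
    have h1 : ∀ e : ι → ℝ, Real.exp (t * ∑ p, a p * (X p (e p) - ∫ v, X p v ∂Q)) =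
        ∏ p, Real.exp (t * a p * (X p (e p) - ∫ v, X p v ∂Q)) := by
      intro e
      rw [← Real.exp_sum, Finset.mul_sum]
      simp only [mul_assoc]
    simp_rw [h1]
    rw [hμ, integral_fintype_prod_eq_prod
      (f := fun p u => Real.exp (t * a p * (X p u - ∫ v, X p v ∂Q)))]
    calc ∏ p, ∫ u, Real.exp (t * a p * (X p u - ∫ v, X p v ∂Q)) ∂Q
        ≤ ∏ p, Real.exp ((t * a p) ^ 2 * V) := by
          refine Finset.prod_le_prod (fun p _ => integral_nonneg fun u => (Real.exp_pos _).le)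
            fun p _ => integral_exp_le (hX p) (hB p) (hV p) (mul_nonneg ht0.le (ha p)) ?_
          have hBn : 0 ≤ B := (abs_nonneg _).trans (hB p 0)
          calc t * a p * (2 * B) ≤ t * ω * (2 * B) := by gcongr; exact hω p
            _ = τ * B / V := by rw [ht]; field_simp
            _ ≤ 1 := (div_le_one hV0).2 hτB
      _ = Real.exp (t ^ 2 * V * ∑ p, a p ^ 2) := by
          rw [← Real.exp_sum, Finset.mul_sum]
          congr 1
          exact Finset.sum_congr rfl fun p _ => by ring
      _ ≤ Real.exp (t ^ 2 * V * ω) := by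
          refine Real.exp_le_exp.2 (mul_le_mul_of_nonneg_left (sum_sq_le_of_le ha hsum hω) ?_)
          positivity
  have hBn : ∀ p, 0 ≤ B := fun p => (abs_nonneg _).trans (hB p 0)
  have hint : Integrable (fun e => Real.exp (t * ∑ p, a p * (X p (e p) - ∫ v, X p v ∂Q))) μ := by
    refine Integrable.of_bound (C := Real.exp (t * ∑ p, a p * (2 * B))) ?_
      (Eventually.of_forall fun e => ?_)
    · refine (Measurable.exp (Measurable.const_mul ?_ t)).aestronglyMeasurable
      exact Finset.measurable_sum _ fun p _ =>
        (((hX p).comp (measurable_pi_apply p)).sub_const _).const_mul _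
    · rw [Real.norm_eq_abs, abs_of_pos (Real.exp_pos _)]
      refine Real.exp_le_exp.2 (mul_le_mul_of_nonneg_left (Finset.sum_le_sum fun p _ =>
        mul_le_mul_of_nonneg_left ?_ (ha p)) ht0.le)
      have hEB : |∫ v, X p v ∂Q| ≤ B := by
        have := norm_integral_le_of_norm_le_const (μ := Q) (f := X p) (C := B)
          (Eventually.of_forall (hB p))
        simpa using this
      have h1 := le_of_abs_le (hB p (e p))
      have h2 := neg_le_of_abs_le hEB
      linarith
  have hmarkov := mul_meas_ge_le_integral_of_nonneg (μ := μ)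
    (f := fun e => Real.exp (t * ∑ p, a p * (X p (e p) - ∫ v, X p v ∂Q)))
    (Eventually.of_forall fun e => (Real.exp_pos _).le) hint (Real.exp (t * τ))
  have hset : {e : ι → ℝ | Real.exp (t * τ) ≤
      Real.exp (t * ∑ p, a p * (X p (e p) - ∫ v, X p v ∂Q))} =
      {e | τ ≤ ∑ p, a p * (X p (e p) - ∫ v, X p v ∂Q)} := by
    ext e
    simp only [mem_ofPred_eq, Real.exp_le_exp]
    exact mul_le_mul_iff_right₀ ht0
  rw [hset] at hmarkov
  have h3 : μ.real {e | τ ≤ ∑ p, a p * (X p (e p) - ∫ v, X p v ∂Q)} ≤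
      Real.exp (t ^ 2 * V * ω) / Real.exp (t * τ) := by
    rw [le_div_iff₀ (Real.exp_pos _), mul_comm]
    exact hmarkov.trans hmgf
  refine h3.trans ?_
  rw [← Real.exp_sub]
  refine Real.exp_le_exp.2 (le_of_eq ?_)
  rw [ht]
  field_simp
  ring

/-- Bernstein's inequality for weighted sums. -/
theorem measureReal_le_abs_sum_le (ha : ∀ p, 0 ≤ a p) (hsum : ∑ p, a p = 1)
    (hω : ∀ p, a p ≤ ω) (hω0 : 0 < ω) (hV0 : 0 < V) (hτ : 0 < τ) (hτB : τ * B ≤ V)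
    {X : ι → ℝ → ℝ} (hX : ∀ p, Measurable (X p)) (hB : ∀ p u, |X p u| ≤ B)
    (hV : ∀ p, ∫ u, X p u ^ 2 ∂Q ≤ V) :
    (Measure.pi fun _ : ι => Q).real {e | τ ≤ |∑ p, a p * (X p (e p) - ∫ v, X p v ∂Q)|} ≤
      2 * Real.exp (-(τ ^ 2 / (4 * ω * V))) := by
  have h1 := measureReal_le_sum_le ha hsum hω hω0 hV0 hτ hτB hX hB hV
  have h2 := measureReal_le_sum_le ha hsum hω hω0 hV0 hτ hτB (X := fun p u => -X p u)
    (fun p => (hX p).neg) (fun p u => by rw [abs_neg]; exact hB p u) (by simpa using hV)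
  have hset : {e : ι → ℝ | τ ≤ |∑ p, a p * (X p (e p) - ∫ v, X p v ∂Q)|} ⊆
      {e | τ ≤ ∑ p, a p * (X p (e p) - ∫ v, X p v ∂Q)} ∪
        {e | τ ≤ ∑ p, a p * (-X p (e p) - ∫ v, -X p v ∂Q)} := by
    intro e he
    rcases le_abs.1 (show τ ≤ _ from he) with h | h
    · exact Or.inl h
    · right
      have : ∑ p, a p * (-X p (e p) - ∫ v, -X p v ∂Q) =
          -∑ p, a p * (X p (e p) - ∫ v, X p v ∂Q) := by
        rw [← Finset.sum_neg_distrib]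
        refine Finset.sum_congr rfl fun p _ => ?_
        rw [integral_neg]
        ring
      show τ ≤ _
      rwa [this]
  calc _ ≤ _ := measureReal_mono hset
    _ ≤ _ := measureReal_union_le _ _
    _ ≤ _ := by linarith

/-- A uniform version of Bernstein's inequality for weighted sums of Lipschitz functions. -/
theorem measureReal_exists_le_abs_sum_le (ha : ∀ p, 0 ≤ a p) (hsum : ∑ p, a p = 1)
    (hω : ∀ p, a p ≤ ω) (hω0 : 0 < ω) (hV0 : 0 < V) (hτ : 0 < τ) (hτB : τ * B ≤ V)
    {X : ι → ℝ → ℝ → ℝ} (hX : ∀ p y, Measurable (X p y)) (hB : ∀ p y u, |X p y u| ≤ B)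
    (hV : ∀ p y, ∫ u, X p y u ^ 2 ∂Q ≤ V) {Λ : ℝ} (hΛ : 0 < Λ)
    (hLip : ∀ p u y y', |X p y u - X p y' u| ≤ Λ * |y - y'|) (lo hi : ℝ) (hlh : lo ≤ hi) :
    (Measure.pi fun _ : ι => Q).real
      {e | ∃ y ∈ Icc lo hi, τ ≤ |∑ p, a p * (X p y (e p) - ∫ v, X p y v ∂Q)|} ≤
      ((hi - lo) * (4 * Λ / τ) + 1) * (2 * Real.exp (-(τ ^ 2 / (16 * ω * V)))) := by
  -- Between a point and the grid point below it, each summand and its mean move by at most `Λ * δ`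
  -- each. Half of `τ` is lost, and the pointwise inequality at level `τ / 2` gives the constant
  -- `16`.
  set δ := τ / (4 * Λ) with hδ
  have hδ0 : 0 < δ := by positivity
  set N := ⌊(hi - lo) / δ⌋₊ with hN
  have hset : {e : ι → ℝ | ∃ y ∈ Icc lo hi, τ ≤ |∑ p, a p * (X p y (e p) - ∫ v, X p y v ∂Q)|} ⊆
      ⋃ k ∈ Finset.range (N + 1), {e | τ / 2 ≤ |∑ p, a p * (X p (lo + k * δ) (e p) -
        ∫ v, X p (lo + k * δ) v ∂Q)|} := by
    rintro e ⟨y, hy, hdev⟩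
    set k := ⌊(y - lo) / δ⌋₊ with hk
    have hkN : k ≤ N := Nat.floor_le_floor (by gcongr; exact hy.2)
    simp only [mem_iUnion, Finset.mem_range]
    refine ⟨k, by omega, ?_⟩
    set z := lo + k * δ with hz
    have hyz : |y - z| ≤ δ := by
      have h1 : (k : ℝ) ≤ (y - lo) / δ := Nat.floor_le (div_nonneg (by linarith [hy.1]) hδ0.le)
      have h2 : (y - lo) / δ < k + 1 := Nat.lt_floor_add_one _
      rw [le_div_iff₀ hδ0] at h1
      rw [div_lt_iff₀ hδ0] at h2
      rw [abs_le]
      constructor <;> linarith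
    have hdiff : |∑ p, a p * (X p y (e p) - ∫ v, X p y v ∂Q) -
        ∑ p, a p * (X p z (e p) - ∫ v, X p z v ∂Q)| ≤ τ / 2 := by
      rw [← Finset.sum_sub_distrib]
      calc |∑ p, (a p * (X p y (e p) - ∫ v, X p y v ∂Q) - a p * (X p z (e p) - ∫ v, X p z v ∂Q))|
          ≤ ∑ p, |a p * (X p y (e p) - ∫ v, X p y v ∂Q) - a p * (X p z (e p) - ∫ v, X p z v ∂Q)| :=
            Finset.abs_sum_le_sum_abs _ _
        _ ≤ ∑ p, a p * (2 * (Λ * δ)) := by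
            refine Finset.sum_le_sum fun p _ => ?_
            rw [← mul_sub, abs_mul, abs_of_nonneg (ha p)]
            refine mul_le_mul_of_nonneg_left ?_ (ha p)
            have h1 : |X p y (e p) - X p z (e p)| ≤ Λ * δ :=
              (hLip p _ _ _).trans (mul_le_mul_of_nonneg_left hyz hΛ.le)
            have h2 : |∫ v, X p y v ∂Q - ∫ v, X p z v ∂Q| ≤ Λ * δ := by
              rw [← integral_sub (integrable_of_abs_le (hX p y) (hB p y))
                (integrable_of_abs_le (hX p z) (hB p z))]
              have := norm_integral_le_of_norm_le_const (μ := Q) (f := fun v => X p y v - X p z v)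
                (C := Λ * δ) (Eventually.of_forall fun v =>
                  (hLip p _ _ _).trans (mul_le_mul_of_nonneg_left hyz hΛ.le))
              simpa using this
            calc _ = |(X p y (e p) - X p z (e p)) - (∫ v, X p y v ∂Q - ∫ v, X p z v ∂Q)| := by
                  congr 1; ring
              _ ≤ _ := abs_sub _ _
              _ ≤ _ := by linarith
        _ = τ / 2 := by
            rw [← Finset.sum_mul, hsum, hδ]
            field_simp
            norm_num
    show τ / 2 ≤ _
    have h3 := abs_sub_abs_le_abs_sub (∑ p, a p * (X p y (e p) - ∫ v, X p y v ∂Q))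
      (∑ p, a p * (X p z (e p) - ∫ v, X p z v ∂Q))
    linarith
  have hpoint : ∀ k ∈ Finset.range (N + 1), (Measure.pi fun _ : ι => Q).real
      {e | τ / 2 ≤ |∑ p, a p * (X p (lo + k * δ) (e p) - ∫ v, X p (lo + k * δ) v ∂Q)|} ≤
      2 * Real.exp (-(τ ^ 2 / (16 * ω * V))) := by
    intro k _
    have hBτ : τ / 2 * B ≤ V := by
      by_cases hb : 0 ≤ B
      · nlinarith
      · nlinarith [not_le.1 hb]
    have := measureReal_le_abs_sum_le ha hsum hω hω0 hV0 (half_pos hτ) hBτ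
      (X := fun p => X p (lo + k * δ)) (fun p => hX p _) (fun p => hB p _) (fun p => hV p _)
    convert this using 4
    field_simp
    norm_num
  calc _ ≤ _ := measureReal_mono hset (measure_ne_top _ _)
    _ ≤ ∑ k ∈ Finset.range (N + 1), (Measure.pi fun _ : ι => Q).real
      {e | τ / 2 ≤ |∑ p, a p * (X p (lo + k * δ) (e p) - ∫ v, X p (lo + k * δ) v ∂Q)|} :=
        measureReal_biUnion_finset_le _ _
    _ ≤ ∑ k ∈ Finset.range (N + 1), 2 * Real.exp (-(τ ^ 2 / (16 * ω * V))) :=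
        Finset.sum_le_sum hpoint
    _ = (N + 1) * (2 * Real.exp (-(τ ^ 2 / (16 * ω * V)))) := by simp
    _ ≤ _ := by
        refine mul_le_mul_of_nonneg_right ?_ (by positivity)
        have h1 : (N : ℝ) ≤ (hi - lo) / δ := Nat.floor_le (div_nonneg (by linarith) hδ0.le)
        have h2 : (hi - lo) / δ = (hi - lo) * (4 * Λ / τ) := by
          rw [hδ]; field_simp
        linarith

end Deviation

end MSmoother

namespace MSmoother

/-! ### Geometry of edge curves -/

open scoped RealInnerProductSpace

section Curve

variable {T : ℝ} {c : ℝ → Plane} {corners : Finset ℝ}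

theorem periodic_deriv (hper : Function.Periodic c T) : Function.Periodic (deriv c) T := by
  intro t
  rw [← deriv_comp_add_const c T t]
  congr 1
  exact funext hper

theorem differentiableAt_of_periodic (hper : Function.Periodic c T) {t : ℝ}
    (h : DifferentiableAt ℝ c (t + T)) : DifferentiableAt ℝ c t := by
  have h1 : DifferentiableAt ℝ (fun s => c (s + T)) t :=
    h.comp (f := fun s => s + T) t (by fun_prop)
  rwa [funext hper] at h1

/-- An edge curve is regular in a punctured neighbourhood of each point. -/
theorem eventually_regular (hT : 0 < T) (hper : Function.Periodic c T)
    (hreg : ∀ t ∈ Ico 0 T, t ∉ corners → DifferentiableAt ℝ c t ∧ ‖deriv c t‖ = 1) {t₀ : ℝ}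
    (ht₀ : t₀ ∈ Ico 0 T) : ∀ᶠ t in 𝓝[≠] t₀, DifferentiableAt ℝ c t ∧ ‖deriv c t‖ = 1 := by
  classical
  -- Corners are listed only for one period; the shifted copies are needed to the left of `t₀ = 0`.
  set F : Finset ℝ := corners ∪ corners.image (fun t => t - T) with hF
  have h1 : ∀ t ∈ Ioo (-T) T, t ∉ F → DifferentiableAt ℝ c t ∧ ‖deriv c t‖ = 1 := by
    intro t ht htF
    rw [hF, Finset.mem_union, Finset.mem_image] at htF
    push Not at htF
    rcases le_or_gt 0 t with h0 | h0
    · exact hreg t ⟨h0, ht.2⟩ htF.1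
    · have h2 := hreg (t + T) ⟨by linarith [ht.1], by linarith⟩
        fun hc => htF.2 (t + T) hc (by ring)
      rw [periodic_deriv hper] at h2
      exact ⟨differentiableAt_of_periodic hper h2.1, h2.2⟩
  have h2 : Ioo (-T) T ∈ 𝓝[≠] t₀ :=
    mem_nhdsWithin_of_mem_nhds (Ioo_mem_nhds (by linarith [ht₀.1]) ht₀.2)
  have h3 : ((F : Set ℝ) \ {t₀})ᶜ ∈ 𝓝[≠] t₀ := by
    refine mem_nhdsWithin_of_mem_nhds (IsClosed.compl_mem_nhds ?_ (by simp))
    exact (F.finite_toSet.subset sdiff_subset).isClosed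
  filter_upwards [h2, h3, self_mem_nhdsWithin] with t ht1 ht2 ht3
  exact h1 t ht1 fun hF => ht2 ⟨hF, ht3⟩

/-- The one-sided unit tangents of an edge curve are nowhere opposite. -/
theorem exists_tangents (hT : 0 < T) (hper : Function.Periodic c T)
    (hreg : ∀ t ∈ Ico 0 T, t ∉ corners →
      DifferentiableAt ℝ c t ∧ ‖deriv c t‖ = 1 ∧ DifferentiableAt ℝ (deriv c) t)
    (hcor : ∀ t ∈ Ico 0 T, t ∈ corners → ∃ bl br : Plane,
      Tendsto (deriv c) (𝓝[<] t) (𝓝 bl) ∧ Tendsto (deriv c) (𝓝[>] t) (𝓝 br) ∧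
      InnerProductGeometry.angle (-bl) br ∈ Ioo 0 Real.pi) {t₀ : ℝ} (ht₀ : t₀ ∈ Ico 0 T) :
    ∃ bl br : Plane, Tendsto (deriv c) (𝓝[<] t₀) (𝓝 bl) ∧ Tendsto (deriv c) (𝓝[>] t₀) (𝓝 br) ∧
      ‖bl‖ = 1 ∧ ‖br‖ = 1 ∧ bl + br ≠ 0 := by
  by_cases hc : t₀ ∈ corners
  · obtain ⟨bl, br, hl, hr, hang⟩ := hcor t₀ ht₀ hc
    have hev := eventually_regular hT hper (fun t ht h => ⟨(hreg t ht h).1, (hreg t ht h).2.1⟩) ht₀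
    have hbl : ‖bl‖ = 1 := by
      have h1 : ∀ᶠ t in 𝓝[<] t₀, ‖deriv c t‖ = 1 :=
        (hev.filter_mono (nhdsWithin_mono _ fun t ht => ne_of_lt ht)).mono fun t h => h.2
      exact tendsto_nhds_unique hl.norm
        (tendsto_const_nhds.congr' (h1.mono fun t h => h.symm))
    have hbr : ‖br‖ = 1 := by
      have h1 : ∀ᶠ t in 𝓝[>] t₀, ‖deriv c t‖ = 1 :=
        (hev.filter_mono (nhdsWithin_mono _ fun t ht => ne_of_gt ht)).mono fun t h => h.2
      exact tendsto_nhds_unique hr.norm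
        (tendsto_const_nhds.congr' (h1.mono fun t h => h.symm))
    refine ⟨bl, br, hl, hr, hbl, hbr, fun h0 => ?_⟩
    -- Opposite one-sided tangents would mean that the two tangent rays coincide, which is the
    -- excluded cusp.
    have h1 : br = -bl := (neg_eq_of_add_eq_zero_right h0).symm
    rw [h1, InnerProductGeometry.angle_self] at hang
    · exact lt_irrefl _ hang.1
    · intro h2
      rw [neg_eq_zero] at h2
      simp [h2] at hbl
  · obtain ⟨_, h2, h3⟩ := hreg t₀ ht₀ hc
    have h4 := h3.continuousAt
    refine ⟨deriv c t₀, deriv c t₀, h4.tendsto.mono_left nhdsWithin_le_nhds,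
      h4.tendsto.mono_left nhdsWithin_le_nhds, h2, h2, fun h0 => ?_⟩
    rw [← two_smul ℝ, smul_eq_zero] at h0
    rcases h0 with h0 | h0
    · norm_num at h0
    · simp [h0] at h2

/-- Both bounds are mean value inequalities for scalar projections of the curve: on `v` for the
advance, and on the chord itself for its length. The ends of the interval may be corners, as only
continuity is needed there. -/
theorem inner_sub_bounds {a b ρ : ℝ} {v : Plane} (hc : Continuous c)
    (h : ∀ t ∈ Ioo a b, DifferentiableAt ℝ c t ∧ ‖deriv c t‖ = 1 ∧ ρ ≤ ⟪v, deriv c t⟫) {t t' : ℝ}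
    (ht : t ∈ Icc a b) (ht' : t' ∈ Icc a b) (htt : t ≤ t') :
    ρ * (t' - t) ≤ ⟪v, c t' - c t⟫ ∧ ‖c t' - c t‖ ≤ t' - t := by
  have hd : ∀ (e : Plane) (t : ℝ), t ∈ Ioo a b →
      HasDerivAt (fun t => ⟪e, c t⟫) ⟪e, deriv c t⟫ t := by
    intro e t ht
    simpa using (hasDerivAt_const t e).inner ℝ (h t ht).1.hasDerivAt
  have hcont : ∀ e : Plane, ContinuousOn (fun t => ⟪e, c t⟫) (Icc a b) := fun e => by fun_prop
  have hdiff : ∀ e : Plane, DifferentiableOn ℝ (fun t => ⟪e, c t⟫) (interior (Icc a b)) := by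
    intro e t ht
    rw [interior_Icc] at ht
    exact (hd e t ht).differentiableAt.differentiableWithinAt
  constructor
  · have := (convex_Icc a b).mul_sub_le_image_sub_of_le_deriv (hcont v) (hdiff v) (C := ρ)
      (fun t ht => by
        rw [interior_Icc] at ht
        rw [(hd v t ht).deriv]
        exact (h t ht).2.2) t ht t' ht' htt
    rwa [← inner_sub_right] at this
  · set e := c t' - c t with he
    have := (convex_Icc a b).image_sub_le_mul_sub_of_deriv_le (hcont e) (hdiff e) (C := ‖e‖)
      (fun t ht => by
        rw [interior_Icc] at ht
        rw [(hd e t ht).deriv]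
        have h1 := real_inner_le_norm e (deriv c t)
        rwa [(h t ht).2.1, mul_one] at h1) t ht t' ht' htt
    rw [← inner_sub_right, ← he, real_inner_self_eq_norm_sq] at this
    rcases (norm_nonneg e).eq_or_lt with h0 | h0
    · rw [← h0]; linarith
    · nlinarith

/-- Near each of its points, an edge curve advances in a fixed direction. -/
theorem exists_advance (hT : 0 < T) (hc : Continuous c) (hper : Function.Periodic c T)
    (hreg : ∀ t ∈ Ico 0 T, t ∉ corners →
      DifferentiableAt ℝ c t ∧ ‖deriv c t‖ = 1 ∧ DifferentiableAt ℝ (deriv c) t)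
    (hcor : ∀ t ∈ Ico 0 T, t ∈ corners → ∃ bl br : Plane,
      Tendsto (deriv c) (𝓝[<] t) (𝓝 bl) ∧ Tendsto (deriv c) (𝓝[>] t) (𝓝 br) ∧
      InnerProductGeometry.angle (-bl) br ∈ Ioo 0 Real.pi) {t₀ : ℝ} (ht₀ : t₀ ∈ Ico 0 T) :
    ∃ (b : Plane) (κ s : ℝ), b ≠ 0 ∧ 0 < κ ∧ 0 < s ∧
      ∀ t ∈ Icc (t₀ - s) (t₀ + s), ∀ t' ∈ Icc (t₀ - s) (t₀ + s),
        κ * ‖c t' - c t‖ ≤ |⟪b, c t' - c t⟫| := by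
  obtain ⟨bl, br, hl, hr, hbl, hbr, hne⟩ := exists_tangents hT hper hreg hcor ht₀
  have hev := eventually_regular hT hper (fun t ht h => ⟨(hreg t ht h).1, (hreg t ht h).2.1⟩) ht₀
  -- The bisector of the unit tangents has the same positive inner product with both, namely `‖b‖ ^
  -- 2 / 2`; half of it survives nearby on either side.
  set b := bl + br with hb
  set ρ := ‖b‖ ^ 2 / 4 with hρ
  have hb0 : 0 < ‖b‖ := norm_pos_iff.2 hne
  have hρ0 : 0 < ρ := by positivity
  have hsq : ‖b‖ ^ 2 = 2 + 2 * ⟪bl, br⟫ := by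
    rw [hb, norm_add_sq_real, hbl, hbr]; ring
  have hil : ⟪b, bl⟫ = 2 * ρ := by
    rw [hb, inner_add_left, real_inner_self_eq_norm_sq, hbl, real_inner_comm, hρ, hsq]; ring
  have hir : ⟪b, br⟫ = 2 * ρ := by
    rw [hb, inner_add_left, real_inner_self_eq_norm_sq, hbr, hρ, hsq]; ring
  have hevr : ∀ᶠ t in 𝓝[>] t₀, DifferentiableAt ℝ c t ∧ ‖deriv c t‖ = 1 ∧ ρ ≤ ⟪b, deriv c t⟫ := by
    have h1 : Tendsto (fun t => ⟪b, deriv c t⟫) (𝓝[>] t₀) (𝓝 ⟪b, br⟫) := tendsto_const_nhds.inner hr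
    rw [hir] at h1
    filter_upwards [hev.filter_mono (nhdsWithin_mono _ fun t ht => ne_of_gt ht),
      h1.eventually (lt_mem_nhds (show ρ < 2 * ρ by linarith))] with t h2 h3
    exact ⟨h2.1, h2.2, h3.le⟩
  have hevl : ∀ᶠ t in 𝓝[<] t₀, DifferentiableAt ℝ c t ∧ ‖deriv c t‖ = 1 ∧ ρ ≤ ⟪b, deriv c t⟫ := by
    have h1 : Tendsto (fun t => ⟪b, deriv c t⟫) (𝓝[<] t₀) (𝓝 ⟪b, bl⟫) := tendsto_const_nhds.inner hl
    rw [hil] at h1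
    filter_upwards [hev.filter_mono (nhdsWithin_mono _ fun t ht => ne_of_lt ht),
      h1.eventually (lt_mem_nhds (show ρ < 2 * ρ by linarith))] with t h2 h3
    exact ⟨h2.1, h2.2, h3.le⟩
  obtain ⟨u, hu, hur⟩ := mem_nhdsGT_iff_exists_Ioo_subset.1 hevr
  obtain ⟨l, hl', hll⟩ := mem_nhdsLT_iff_exists_Ioo_subset.1 hevl
  have hu' : t₀ < u := hu
  have hl'' : l < t₀ := hl'
  set s := min (u - t₀) (t₀ - l) with hs
  have hs0 : 0 < s := lt_min (by linarith) (by linarith)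
  have hsu : t₀ + s ≤ u := by linarith [min_le_left (u - t₀) (t₀ - l)]
  have hsl : l ≤ t₀ - s := by linarith [min_le_right (u - t₀) (t₀ - l)]
  have key : ∀ t ∈ Icc (t₀ - s) (t₀ + s), ∀ t' ∈ Icc (t₀ - s) (t₀ + s), t ≤ t' →
      ρ * (t' - t) ≤ ⟪b, c t' - c t⟫ ∧ ‖c t' - c t‖ ≤ t' - t := by
    have hR : ∀ t ∈ Icc t₀ (t₀ + s), ∀ t' ∈ Icc t₀ (t₀ + s), t ≤ t' →
        ρ * (t' - t) ≤ ⟪b, c t' - c t⟫ ∧ ‖c t' - c t‖ ≤ t' - t := fun t ht t' ht' htt =>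
      inner_sub_bounds hc (fun z hz => hur ⟨hz.1, hz.2.trans_le hsu⟩) ht ht' htt
    have hL : ∀ t ∈ Icc (t₀ - s) t₀, ∀ t' ∈ Icc (t₀ - s) t₀, t ≤ t' →
        ρ * (t' - t) ≤ ⟪b, c t' - c t⟫ ∧ ‖c t' - c t‖ ≤ t' - t := fun t ht t' ht' htt =>
      inner_sub_bounds hc (fun z hz => hll ⟨hsl.trans_lt hz.1, hz.2⟩) ht ht' htt
    intro t ht t' ht' htt
    rcases le_total t₀ t with h1 | h1
    · exact hR t ⟨h1, ht.2⟩ t' ⟨h1.trans htt, ht'.2⟩ htt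
    rcases le_total t' t₀ with h2 | h2
    · exact hL t ⟨ht.1, h1⟩ t' ⟨ht'.1, h2⟩ htt
    have h3 := hL t ⟨ht.1, h1⟩ t₀ ⟨by linarith, le_rfl⟩ h1
    have h4 := hR t₀ ⟨le_rfl, by linarith⟩ t' ⟨h2, ht'.2⟩ h2
    have h5 : c t' - c t = (c t' - c t₀) + (c t₀ - c t) := by abel
    rw [h5]
    refine ⟨?_, (norm_add_le _ _).trans (by linarith [h3.2, h4.2])⟩
    rw [inner_add_right]
    linarith [h3.1, h4.1]
  refine ⟨b, ρ, s, hne, hρ0, hs0, fun t ht t' ht' => ?_⟩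
  rcases le_total t t' with htt | htt
  · obtain ⟨h1, h2⟩ := key t ht t' ht' htt
    exact (mul_le_mul_of_nonneg_left h2 hρ0.le).trans (h1.trans (le_abs_self _))
  · obtain ⟨h1, h2⟩ := key t' ht' t ht htt
    rw [norm_sub_rev, ← neg_sub (c t) (c t'), inner_neg_right, abs_neg]
    exact (mul_le_mul_of_nonneg_left h2 hρ0.le).trans (h1.trans (le_abs_self _))

/-- Points of a simple closed curve near one of its points have nearby parameters. -/
theorem exists_parameter (hc : Continuous c) (hper : Function.Periodic c T) (hT : 0 < T)
    (hinj : InjOn c (Ico 0 T)) {t₀ : ℝ} (ht₀ : t₀ ∈ Ico 0 T) {s : ℝ} (hs : 0 < s) :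
    ∃ r > 0, ∀ z ∈ range c, ‖z - c t₀‖ < r → ∃ t ∈ Icc (t₀ - s) (t₀ + s), c t = z := by
  -- The rest of the period is a compact arc which, by injectivity, misses `c t₀` and hence stays at
  -- a positive distance.
  have hK : IsCompact (c '' Icc (t₀ + s) (t₀ + T - s)) := isCompact_Icc.image hc
  have hnot : c t₀ ∉ c '' Icc (t₀ + s) (t₀ + T - s) := by
    rintro ⟨t, ht, hct⟩
    rcases lt_or_ge t T with h1 | h1
    · have := hinj ⟨by linarith [ht₀.1, ht.1], h1⟩ ht₀ hct
      linarith [ht.1]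
    · have h2 : c (t - T) = c t₀ := by rw [← hct, ← hper (t - T), sub_add_cancel]
      have := hinj ⟨by linarith, by linarith [ht.2, ht₀.2]⟩ ht₀ h2
      linarith [ht.2]
  obtain ⟨r, hr, hball⟩ := Metric.isOpen_iff.1 hK.isClosed.isOpen_compl _ hnot
  refine ⟨r, hr, ?_⟩
  rintro z ⟨t, rfl⟩ hz
  obtain ⟨t', ht', hct⟩ := hper.exists_mem_Ico hT t (t₀ - s)
  rw [hct] at hz ⊢
  refine ⟨t', ⟨ht'.1, ?_⟩, rfl⟩
  by_contra hgt
  exact hball (by rwa [Metric.mem_ball, dist_eq_norm]) ⟨t', ⟨(not_le.1 hgt).le, by linarith [ht'.2]⟩, rfl⟩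

end Curve

/-- Near each of its points, the boundary is a graph over a fixed direction. -/
theorem exists_frontier_graph {D : Set Plane}
    (hbd : ∃ (k : ℕ) (γ : Fin k → Set Plane),
      (∀ i, IsEdgeCurve (γ i)) ∧ Pairwise (fun i j => Disjoint (γ i) (γ j)) ∧
        frontier D = ⋃ i, γ i) {x₀ : Plane} (hx₀ : x₀ ∈ frontier D) :
    ∃ (b : Plane) (κ r : ℝ), b ≠ 0 ∧ 0 < κ ∧ 0 < r ∧
      ∀ z ∈ frontier D, ‖z - x₀‖ < r → ∀ z' ∈ frontier D, ‖z' - x₀‖ < r →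
        κ * ‖z' - z‖ ≤ |⟪b, z' - z⟫| := by
  obtain ⟨k, γ, hγ, hdisj, hfr⟩ := hbd
  have hx := hx₀
  rw [hfr, mem_iUnion] at hx
  obtain ⟨i, hi⟩ := hx
  have hcomp : ∀ j, IsCompact (γ j) := by
    intro j
    obtain ⟨T, c, _, hT, hc, hper, _, hr, _⟩ := hγ j
    rw [hr, ← hper.image_Icc hT 0]
    exact isCompact_Icc.image hc
  obtain ⟨T, c, corners, hT, hc, hper, hinj, hr, hreg, _, hcor⟩ := hγ i
  rw [hr] at hi
  obtain ⟨t₁, rfl⟩ := hi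
  obtain ⟨t₀, ht₀, hct⟩ := hper.exists_mem_Ico hT t₁ 0
  rw [zero_add] at ht₀
  rw [hct] at hx₀ ⊢
  obtain ⟨b, κ, s, hb, hκ, hs, hadv⟩ := exists_advance hT hc hper hreg hcor ht₀
  obtain ⟨r, hr0, hpar⟩ := exists_parameter hc hper hT hinj ht₀ hs
  -- The other edge curves are disjoint from this one, so a small disc meets none of them.
  have hother : IsClosed (⋃ j ∈ {j | j ≠ i}, γ j) :=
    (toFinite {j | j ≠ i}).isClosed_biUnion fun j _ => (hcomp j).isClosed
  have hnot : c t₀ ∉ ⋃ j ∈ {j | j ≠ i}, γ j := by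
    simp only [mem_iUnion, not_exists]
    intro j hj hmem
    exact disjoint_left.1 (hdisj hj) hmem (by rw [hr]; exact mem_range_self t₀)
  obtain ⟨r', hr', hball⟩ := Metric.isOpen_iff.1 hother.isOpen_compl _ hnot
  have hloc : ∀ z ∈ frontier D, ‖z - c t₀‖ < min r r' → ∃ t ∈ Icc (t₀ - s) (t₀ + s), c t = z := by
    intro z hz hlt
    rw [hfr, mem_iUnion] at hz
    obtain ⟨j, hj⟩ := hz
    have hji : j = i := by
      by_contra hne
      refine hball (show z ∈ Metric.ball (c t₀) r' from ?_) (mem_biUnion hne hj)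
      rw [Metric.mem_ball, dist_eq_norm]
      exact hlt.trans_le (min_le_right _ _)
    subst hji
    rw [hr] at hj
    exact hpar z hj (hlt.trans_le (min_le_left _ _))
  refine ⟨b, κ, min r r', hb, hκ, lt_min hr0 hr', fun z hz hzr z' hz' hzr' => ?_⟩
  obtain ⟨t, ht, rfl⟩ := hloc z hz hzr
  obtain ⟨t', ht', rfl⟩ := hloc z' hz' hzr'
  exact hadv t ht t' ht'

theorem exists_unit_orthogonal {b : Plane} (hb : b ≠ 0) : ∃ n : Plane, ‖n‖ = 1 ∧ ⟪b, n⟫ = 0 := by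
  have hm : (!₂[-b 1, b 0] : Plane) ≠ 0 := by
    intro h
    apply hb
    ext i
    have h0 := congrArg (fun v : Plane => v 0) h
    have h1 := congrArg (fun v : Plane => v 1) h
    fin_cases i <;> simp_all
  refine ⟨‖(!₂[-b 1, b 0] : Plane)‖⁻¹ • !₂[-b 1, b 0], ?_, ?_⟩
  · rw [norm_smul, norm_inv, norm_norm, inv_mul_cancel₀ (norm_ne_zero_iff.2 hm)]
  · rw [inner_smul_right]
    simp only [PiLp.inner_apply, Fin.sum_univ_two]
    simp
    right
    ring

theorem inter_frontier_nonempty_of_isPreconnected {X : Type*} [TopologicalSpace X] {s t : Set X}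
    (hs : IsPreconnected s) (h1 : (s ∩ t).Nonempty) (h2 : (s ∩ tᶜ).Nonempty) :
    (s ∩ frontier t).Nonempty := by
  by_contra hne
  have hne' : ∀ x ∈ s, x ∉ frontier t := fun x hx hf => hne ⟨x, hx, hf⟩
  obtain ⟨p, hp, hpt⟩ := h1
  obtain ⟨q, hq, hqt⟩ := h2
  have hcover : s ⊆ interior t ∪ (closure t)ᶜ := by
    intro x hx
    by_cases hxi : x ∈ interior t
    · exact Or.inl hxi
    · exact Or.inr fun hc => hne' x hx ⟨hc, hxi⟩
  have hpi : p ∈ interior t := by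
    by_contra h
    exact hne' p hp ⟨subset_closure hpt, h⟩
  have hqi : q ∈ (closure t)ᶜ := fun h => hne' q hq ⟨h, fun hi => hqt (interior_subset hi)⟩
  obtain ⟨x, _, hx1, hx2⟩ := hs _ _ isOpen_interior isClosed_closure.isOpen_compl hcover
    ⟨p, hp, hpi⟩ ⟨q, hq, hqi⟩
  exact hx2 (subset_closure (interior_subset hx1))

/-! ### Cones on either side of the boundary -/

section Cones

variable {D : Set Plane} {x₀ b n : Plane} {κ r : ℝ}

/-- The part in a ball of the cone around the direction `n` in which `b` varies slowly. -/
def thinCone (x₀ b n : Plane) (κ r : ℝ) : Set Plane :=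
  {x | ⟪b, x - x₀⟫ < κ * ⟪n, x - x₀⟫ ∧ -⟪b, x - x₀⟫ < κ * ⟪n, x - x₀⟫ ∧ ‖x - x₀‖ < r}

theorem convex_thinCone : Convex ℝ (thinCone x₀ b n κ r) := by
  intro x hx y hy s t hs ht hst
  have h1 : s • x + t • y - x₀ = s • (x - x₀) + t • (y - x₀) := by
    rw [smul_sub, smul_sub, ← sub_eq_zero]
    have : x₀ = s • x₀ + t • x₀ := by rw [← add_smul, hst, one_smul]
    nth_rewrite 1 [this]
    abel
  have hcomb : ∀ {a c : ℝ}, a < 0 → c < 0 → s * a + t * c < 0 := by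
    intro a c ha hc
    rcases hs.eq_or_lt with h0 | h0
    · rw [← h0, zero_add] at hst
      rw [← h0, hst]; linarith
    · nlinarith [mul_nonneg ht (neg_nonneg.2 hc.le), mul_pos h0 (neg_pos.2 ha)]
  refine ⟨?_, ?_, ?_⟩
  · rw [h1]
    simp only [inner_add_right, inner_smul_right]
    have := hcomb (sub_neg.2 hx.1) (sub_neg.2 hy.1)
    linarith
  · rw [h1]
    simp only [inner_add_right, inner_smul_right]
    have := hcomb (sub_neg.2 hx.2.1) (sub_neg.2 hy.2.1)
    linarith
  · have h2 := convex_ball x₀ r (mem_ball_iff_norm.2 hx.2.2) (mem_ball_iff_norm.2 hy.2.2) hs ht hst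
    exact mem_ball_iff_norm.1 h2

/-- A boundary point in the cone would vary too slowly along `b` relative to its distance from `x₀`.
The cone is convex, so without boundary points it lies on one side. -/
theorem thinCone_subset_or (hκ : 0 < κ) (hn : ‖n‖ = 1) (hr : 0 < r) (hx₀ : x₀ ∈ frontier D)
    (hfr : ∀ z ∈ frontier D, ‖z - x₀‖ < r → ∀ z' ∈ frontier D, ‖z' - x₀‖ < r →
      κ * ‖z' - z‖ ≤ |⟪b, z' - z⟫|) :
    thinCone x₀ b n κ r ⊆ D ∨ thinCone x₀ b n κ r ⊆ Dᶜ := by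
  by_contra hcon
  push Not at hcon
  obtain ⟨h1, h2⟩ := hcon
  rw [not_subset] at h1 h2
  obtain ⟨p, hp, hpD⟩ := h1
  obtain ⟨q, hq, hqD⟩ := h2
  obtain ⟨z, hz, hzf⟩ := inter_frontier_nonempty_of_isPreconnected
    convex_thinCone.isPreconnected
    ⟨q, hq, not_not.1 hqD⟩ ⟨p, hp, hpD⟩
  have h3 := hfr x₀ hx₀ (by simpa using hr) z hzf hz.2.2
  have h4 : ⟪n, z - x₀⟫ ≤ ‖z - x₀‖ := by
    have := real_inner_le_norm n (z - x₀)
    rwa [hn, one_mul] at this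
  have h5 : |⟪b, z - x₀⟫| < κ * ⟪n, z - x₀⟫ := abs_lt.2 ⟨by linarith [hz.2.1], hz.1⟩
  nlinarith

/-- Moving from `q` by `r / 2` along `n` leaves the `b` component unchanged and leads into the cone,
that is, out of `D`. The segment must cross the boundary, not at `q`. -/
theorem exists_frontier_on_ray (hκ : 0 < κ) (hn : ‖n‖ = 1) (hbn : ⟪b, n⟫ = 0) {q : Plane}
    (hq : (‖b‖ + κ) * ‖q - x₀‖ < κ * (r / 2)) (hqr : ‖q - x₀‖ < r / 2)
    (hqD : q ∈ D) (hqf : q ∉ frontier D) (hcone : thinCone x₀ b n κ r ⊆ Dᶜ) :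
    ∃ t : ℝ, t > 0 ∧ q + t • n ∈ frontier D ∧ ‖q + t • n - x₀‖ < r := by
  have hr : 0 < r / 2 := (norm_nonneg _).trans_lt hqr
  have hbnd : ∀ t ∈ Icc 0 (r / 2), ‖q + t • n - x₀‖ < r := by
    intro t ht
    have h1 : q + t • n - x₀ = (q - x₀) + t • n := by abel
    rw [h1]
    have h2 : ‖t • n‖ = t := by rw [norm_smul, hn, mul_one, Real.norm_of_nonneg ht.1]
    linarith [norm_add_le (q - x₀) (t • n), ht.2]
  set S := (fun t : ℝ => q + t • n) '' Icc 0 (r / 2) with hS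
  have hpre : IsPreconnected S := isPreconnected_Icc.image _ (by fun_prop)
  have hend : q + (r / 2) • n ∈ thinCone x₀ b n κ r := by
    have h1 : q + (r / 2) • n - x₀ = (q - x₀) + (r / 2) • n := by abel
    have h2 : |⟪b, q - x₀⟫| ≤ ‖b‖ * ‖q - x₀‖ := abs_real_inner_le_norm _ _
    have h3 : |⟪n, q - x₀⟫| ≤ ‖q - x₀‖ := by
      have := abs_real_inner_le_norm n (q - x₀)
      rwa [hn, one_mul] at this
    have h4 : ⟪b, q + (r / 2) • n - x₀⟫ = ⟪b, q - x₀⟫ := by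
      rw [h1, inner_add_right, inner_smul_right, hbn, mul_zero, add_zero]
    have h5 : ⟪n, q + (r / 2) • n - x₀⟫ = ⟪n, q - x₀⟫ + r / 2 := by
      rw [h1, inner_add_right, inner_smul_right, real_inner_self_eq_norm_sq, hn]; ring
    have h6 := abs_le.1 h2
    have h7 := abs_le.1 h3
    refine ⟨?_, ?_, hbnd _ ⟨hr.le, le_rfl⟩⟩
    · rw [h4, h5]; nlinarith
    · rw [h4, h5]; nlinarith
  obtain ⟨z, ⟨t, ht, rfl⟩, hzf⟩ := inter_frontier_nonempty_of_isPreconnected hpre (t := D)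
    ⟨q, ⟨0, ⟨le_rfl, hr.le⟩, by simp⟩, hqD⟩ ⟨_, ⟨r / 2, ⟨hr.le, le_rfl⟩, rfl⟩, hcone hend⟩
  refine ⟨t, lt_of_le_of_ne ht.1 fun h0 => ?_, hzf, hbnd t ht⟩
  subst h0
  simp at hzf
  exact hqf hzf

/-- If both thin cones lie outside of `D`, the points of `D` near `x₀` are boundary points. -/
theorem mem_frontier_of_thinCones (hκ : 0 < κ) (hn : ‖n‖ = 1) (hbn : ⟪b, n⟫ = 0)
    (hfr : ∀ z ∈ frontier D, ‖z - x₀‖ < r → ∀ z' ∈ frontier D, ‖z' - x₀‖ < r →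
      κ * ‖z' - z‖ ≤ |⟪b, z' - z⟫|)
    (h1 : thinCone x₀ b n κ r ⊆ Dᶜ) (h2 : thinCone x₀ b (-n) κ r ⊆ Dᶜ) {q : Plane}
    (hq : (‖b‖ + κ) * ‖q - x₀‖ < κ * (r / 2)) (hqr : ‖q - x₀‖ < r / 2) (hqD : q ∈ D) :
    q ∈ frontier D := by
  by_contra hqf
  obtain ⟨t, ht, htf, htr⟩ := exists_frontier_on_ray hκ hn hbn hq hqr hqD hqf h1
  obtain ⟨s, hs, hsf, hsr⟩ := exists_frontier_on_ray (n := -n) hκ (by rwa [norm_neg])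
    (by rw [inner_neg_right, hbn, neg_zero]) hq hqr hqD hqf h2
  -- Two boundary points on opposite sides of `q` differ by a nonzero multiple of `n`, which is
  -- orthogonal to `b`; this contradicts the graph property.
  have h3 := hfr _ hsf hsr _ htf htr
  have h4 : q + t • n - (q + s • -n) = (t + s) • n := by
    rw [smul_neg, add_smul]; abel
  rw [h4, inner_smul_right, hbn, mul_zero, abs_zero, norm_smul, hn, mul_one, Real.norm_eq_abs,
    abs_of_pos (by linarith)] at h3
  nlinarith

/-- At the ball's centre, `ρ / 2` along the axis, the defining inequalities have slack `κ * ρ / 2`.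
A displacement `w` costs at most `(‖b‖ + κ) * ‖w‖`, which the radius keeps below half of that. -/
theorem ball_subset_thinCone (hκ : 0 < κ) (hn : ‖n‖ = 1) (hbn : ⟪b, n⟫ = 0) {ρ : ℝ}
    (hρ : 0 < ρ) (hρr : ρ < r) :
    Metric.ball (x₀ + (ρ / 2) • n) (κ / (4 * (‖b‖ + κ)) * ρ) ⊆
      thinCone x₀ b n κ r ∩ Metric.ball x₀ ρ := by
  intro x hx
  have hbκ : 0 < ‖b‖ + κ := by positivity
  set w := x - (x₀ + (ρ / 2) • n) with hw
  have hwn : ‖w‖ < κ / (4 * (‖b‖ + κ)) * ρ := mem_ball_iff_norm.1 hx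
  have hx0 : x - x₀ = (ρ / 2) • n + w := by rw [hw]; abel
  have h1 : (‖b‖ + κ) * ‖w‖ < κ * (ρ / 4) := by
    calc (‖b‖ + κ) * ‖w‖ < (‖b‖ + κ) * (κ / (4 * (‖b‖ + κ)) * ρ) := by gcongr
      _ = κ * (ρ / 4) := by field_simp
  have hwρ : ‖w‖ < ρ / 4 := by nlinarith [norm_nonneg b, norm_nonneg w, mul_nonneg (norm_nonneg b) (norm_nonneg w)]
  have h2 := abs_le.1 (abs_real_inner_le_norm b w)
  have h3 := abs_le.1 (abs_real_inner_le_norm n w)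
  rw [hn, one_mul] at h3
  have h4 : ⟪b, x - x₀⟫ = ⟪b, w⟫ := by
    rw [hx0, inner_add_right, inner_smul_right, hbn, mul_zero, zero_add]
  have h5 : ⟪n, x - x₀⟫ = ρ / 2 + ⟪n, w⟫ := by
    rw [hx0, inner_add_right, inner_smul_right, real_inner_self_eq_norm_sq, hn]; ring
  have h6 : ‖x - x₀‖ < ρ := by
    rw [hx0]
    have : ‖(ρ / 2) • n‖ = ρ / 2 := by
      rw [norm_smul, hn, mul_one, Real.norm_of_nonneg (by positivity)]
    linarith [norm_add_le ((ρ / 2) • n) w]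
  refine ⟨⟨?_, ?_, h6.trans hρr⟩, mem_ball_iff_norm.2 h6⟩
  · rw [h4, h5]; nlinarith
  · rw [h4, h5]; nlinarith

end Cones

/-- At each boundary point, both the region and its complement contain balls of comparable
size in small discs. -/
theorem exists_balls_on_both_sides {D : Set Plane} (hcl : IsClosed D)
    (hreg : D = closure (interior D))
    (hbd : ∃ (k : ℕ) (γ : Fin k → Set Plane),
      (∀ i, IsEdgeCurve (γ i)) ∧ Pairwise (fun i j => Disjoint (γ i) (γ j)) ∧
        frontier D = ⋃ i, γ i) {x₀ : Plane} (hx₀ : x₀ ∈ frontier D) :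
    ∃ c > 0, ∃ r > 0, ∀ ρ, 0 < ρ → ρ < r →
      (∃ z, Metric.ball z (c * ρ) ⊆ D ∩ Metric.ball x₀ ρ) ∧
      (∃ z, Metric.ball z (c * ρ) ⊆ Dᶜ ∩ Metric.ball x₀ ρ) := by
  obtain ⟨b, κ, r, hb, hκ, hr, hfr⟩ := exists_frontier_graph hbd hx₀
  obtain ⟨n, hn, hbn⟩ := exists_unit_orthogonal hb
  have hn' : ‖-n‖ = 1 := by rwa [norm_neg]
  have hbn' : ⟪b, -n⟫ = 0 := by rw [inner_neg_right, hbn, neg_zero]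
  have hbκ : 0 < ‖b‖ + κ := by positivity
  have hfrc : ∀ z ∈ frontier Dᶜ, ‖z - x₀‖ < r → ∀ z' ∈ frontier Dᶜ, ‖z' - x₀‖ < r →
      κ * ‖z' - z‖ ≤ |⟪b, z' - z⟫| := by rwa [frontier_compl]
  set η := min (r / 2) (κ * (r / 2) / (‖b‖ + κ)) with hη
  have hη0 : 0 < η := by positivity
  have hnear : ∀ q, ‖q - x₀‖ < η → (‖b‖ + κ) * ‖q - x₀‖ < κ * (r / 2) ∧ ‖q - x₀‖ < r / 2 := by
    intro q hq
    refine ⟨?_, hq.trans_le (min_le_left _ _)⟩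
    have := hq.trans_le (min_le_right _ _)
    rwa [lt_div_iff₀ hbκ, mul_comm] at this
  -- Both cones outside would make all points of `D` near `x₀` boundary points, although `D` is the
  -- closure of its interior.
  have hnot1 : ¬ (thinCone x₀ b n κ r ⊆ Dᶜ ∧ thinCone x₀ b (-n) κ r ⊆ Dᶜ) := by
    rintro ⟨h1, h2⟩
    have hx : x₀ ∈ closure (interior D) := by
      rw [← hreg]
      exact hcl.frontier_subset hx₀
    obtain ⟨q, hq, hqx⟩ := Metric.mem_closure_iff.1 hx η hη0
    rw [dist_comm, dist_eq_norm] at hqx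
    obtain ⟨h3, h4⟩ := hnear q hqx
    exact (mem_frontier_of_thinCones hκ hn hbn hfr h1 h2 h3 h4 (interior_subset hq)).2 hq
  -- The same for the complement: its points near `x₀` would be boundary points and hence belong to
  -- the closed set `D`.
  have hnot2 : ¬ (thinCone x₀ b n κ r ⊆ D ∧ thinCone x₀ b (-n) κ r ⊆ D) := by
    rintro ⟨h1, h2⟩
    have hx : x₀ ∈ closure Dᶜ := by
      rw [← frontier_compl] at hx₀
      exact hx₀.1
    obtain ⟨q, hq, hqx⟩ := Metric.mem_closure_iff.1 hx η hη0
    rw [dist_comm, dist_eq_norm] at hqx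
    obtain ⟨h3, h4⟩ := hnear q hqx
    have := mem_frontier_of_thinCones (D := Dᶜ) hκ hn hbn hfrc (by rwa [compl_compl])
      (by rwa [compl_compl]) h3 h4 hq
    rw [frontier_compl] at this
    exact hq (hcl.frontier_subset this)
  refine ⟨κ / (4 * (‖b‖ + κ)), by positivity, r, hr, fun ρ hρ hρr => ?_⟩
  have hball1 := ball_subset_thinCone (x₀ := x₀) hκ hn hbn hρ hρr
  have hball2 := ball_subset_thinCone (x₀ := x₀) hκ hn' hbn' hρ hρr
  rcases thinCone_subset_or hκ hn hr hx₀ hfr with h1 | h1 <;>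
    rcases thinCone_subset_or hκ hn' hr hx₀ hfr with h2 | h2
  · exact absurd ⟨h1, h2⟩ hnot2
  · exact ⟨⟨_, hball1.trans (inter_subset_inter_left _ h1)⟩,
      ⟨_, hball2.trans (inter_subset_inter_left _ h2)⟩⟩
  · exact ⟨⟨_, hball2.trans (inter_subset_inter_left _ h2)⟩,
      ⟨_, hball1.trans (inter_subset_inter_left _ h1)⟩⟩
  · exact absurd ⟨h1, h2⟩ hnot1

end MSmoother

namespace MSmoother

/-! ### Counting design points and weights -/

theorem norm_le_abs_add_abs (v : Plane) : ‖v‖ ≤ |v 0| + |v 1| := by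
  rw [EuclideanSpace.norm_eq, Fin.sum_univ_two, Real.sqrt_le_left (by positivity)]
  simp only [Real.norm_eq_abs]
  nlinarith [abs_nonneg (v 0), abs_nonneg (v 1)]

theorem designPoint_zero {n : ℕ} (p : Pixel n) : designPoint n p 0 = ((p.1 : ℝ) + 1 / 2) / n := by
  simp [designPoint]

theorem designPoint_one {n : ℕ} (p : Pixel n) : designPoint n p 1 = ((p.2 : ℝ) + 1 / 2) / n := by
  simp [designPoint]

/-- An interval in `[0, 1]` contains many of the equidistant design coordinates. -/
theorem le_card_coordinates {n : ℕ} (hn : 0 < n) {u v : ℝ} (hu : 0 ≤ u) (hv : v ≤ 1) :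
    n * (v - u) - 2 ≤
      ((Finset.univ.filter fun i : Fin n => u < ((i : ℝ) + 1 / 2) / n ∧ ((i : ℝ) + 1 / 2) / n < v).card : ℝ) := by
  have hn' : (0 : ℝ) < n := by exact_mod_cast hn
  by_cases hlarge : n * (v - u) - 2 ≤ 0
  · exact hlarge.trans (Nat.cast_nonneg _)
  push Not at hlarge
  -- The admissible indices include the `k` consecutive ones from `s` on. Rounding of the length and
  -- of the starting index costs at most two.
  set k := ⌊(n : ℝ) * (v - u)⌋₊ - 1 with hk
  set s := ⌈(n : ℝ) * u⌉₊ with hs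
  have hfl : (2 : ℕ) ≤ ⌊(n : ℝ) * (v - u)⌋₊ := Nat.le_floor (by push_cast; linarith)
  have hkr : (k : ℝ) = ⌊(n : ℝ) * (v - u)⌋₊ - 1 := by
    rw [hk, Nat.cast_sub (by omega)]; simp
  have hk1 : (k : ℝ) + 1 ≤ n * (v - u) := by
    rw [hkr]; linarith [Nat.floor_le (show (0 : ℝ) ≤ n * (v - u) by linarith)]
  have hk2 : n * (v - u) - 2 ≤ k := by
    rw [hkr]; linarith [Nat.lt_floor_add_one ((n : ℝ) * (v - u))]
  have hs1 : (n : ℝ) * u ≤ s := Nat.le_ceil _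
  have hs2 : (s : ℝ) < n * u + 1 := Nat.ceil_lt_add_one (by positivity)
  have hb : ∀ j : Fin k, s + (j : ℕ) < n := by
    intro j
    have hj : ((j : ℕ) : ℝ) + 1 ≤ k := by exact_mod_cast j.2
    have : ((s + (j : ℕ) : ℕ) : ℝ) < n := by
      push_cast
      nlinarith
    exact_mod_cast this
  have hcard : k ≤ (Finset.univ.filter fun i : Fin n =>
      u < ((i : ℝ) + 1 / 2) / n ∧ ((i : ℝ) + 1 / 2) / n < v).card := by
    have := Finset.card_le_card_of_injOn (s := (Finset.univ : Finset (Fin k)))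
      (t := Finset.univ.filter fun i : Fin n =>
        u < ((i : ℝ) + 1 / 2) / n ∧ ((i : ℝ) + 1 / 2) / n < v)
      (fun j => ⟨s + (j : ℕ), hb j⟩) (by
        intro j _
        have hj : ((j : ℕ) : ℝ) + 1 ≤ k := by exact_mod_cast j.2
        simp only [Finset.coe_filter, Finset.mem_univ, true_and, mem_ofPred_eq]
        rw [lt_div_iff₀ hn', div_lt_iff₀ hn']
        push_cast
        constructor <;> nlinarith [(Nat.cast_nonneg (j : ℕ) : (0 : ℝ) ≤ ((j : ℕ) : ℝ))]) (by
        intro j _ j' _ hjj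
        simp only [Fin.mk.injEq] at hjj
        exact Fin.ext (by omega))
    simpa using this
  calc (n : ℝ) * (v - u) - 2 ≤ k := hk2
    _ ≤ _ := by exact_mod_cast hcard

/-- A short interval contains few of the equidistant design coordinates. -/
theorem card_coordinates_le {n : ℕ} (hn : 0 < n) (x : ℝ) {h : ℝ} (hh : 0 < h) :
    ((Finset.univ.filter fun i : Fin n => |x - ((i : ℝ) + 1 / 2) / n| < h).card : ℝ) ≤
      2 * (n * h) + 1 := by
  have hn' : (0 : ℝ) < n := by exact_mod_cast hn
  set a := n * (x - h) - 1 / 2 with ha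
  set b := n * (x + h) - 1 / 2 with hb
  have hab : b - a = 2 * (n * h) := by rw [ha, hb]; ring
  have hcard : (Finset.univ.filter fun i : Fin n => |x - ((i : ℝ) + 1 / 2) / n| < h).card ≤
      (Finset.Icc ⌈a⌉ ⌊b⌋).card := by
    refine Finset.card_le_card_of_injOn (fun i => ((i : ℕ) : ℤ)) ?_ ?_
    · intro i hi
      simp only [Finset.coe_filter, Finset.mem_univ, true_and, mem_ofPred_eq] at hi
      rw [abs_lt] at hi
      have h1 : x - h < ((i : ℝ) + 1 / 2) / n := by linarith
      have h2 : ((i : ℝ) + 1 / 2) / n < x + h := by linarith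
      rw [lt_div_iff₀ hn'] at h1
      rw [div_lt_iff₀ hn'] at h2
      simp only [Finset.coe_Icc, mem_Icc, Int.ceil_le, Int.le_floor, Int.cast_natCast]
      constructor <;> simp only [ha, hb] <;> nlinarith
    · intro i _ j _ hij
      exact Fin.ext (Nat.cast_injective (R := ℤ) hij)
  rw [Int.card_Icc] at hcard
  have h1 : ((⌊b⌋ + 1 - ⌈a⌉).toNat : ℝ) ≤ 2 * (n * h) + 1 := by
    rcases le_total 0 (⌊b⌋ + 1 - ⌈a⌉) with h0 | h0
    · have : ((⌊b⌋ + 1 - ⌈a⌉).toNat : ℝ) = ((⌊b⌋ + 1 - ⌈a⌉ : ℤ) : ℝ) := by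
        have := Int.toNat_of_nonneg h0
        exact_mod_cast congrArg (fun z : ℤ => (z : ℝ)) this
      rw [this]
      push_cast
      linarith [Int.floor_le b, Int.le_ceil a]
    · rw [Int.toNat_of_nonpos h0]
      push_cast
      positivity
  exact (by exact_mod_cast hcard : ((Finset.univ.filter fun i : Fin n =>
    |x - ((i : ℝ) + 1 / 2) / n| < h).card : ℝ) ≤ ((⌊b⌋ + 1 - ⌈a⌉).toNat : ℝ)).trans h1

open Classical in
/-- A ball in the unit square contains many design points. -/
theorem le_card_designPoint_mem_ball {n : ℕ} (hn : 0 < n) {z : Plane} {r : ℝ} (hr : 0 < r)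
    (hball : Metric.ball z r ⊆ unitSquare) (hnr : 4 ≤ n * r) :
    (n * r / 2) ^ 2 ≤
      ((Finset.univ.filter fun p : Pixel n => designPoint n p ∈ Metric.ball z r).card : ℝ) := by
  have hcoord : ∀ k, 0 ≤ z k - r / 2 ∧ z k + r / 2 ≤ 1 := by
    intro k
    have h1 : z + EuclideanSpace.single k (-(r / 2)) ∈ unitSquare := by
      refine hball (mem_ball_iff_norm.2 ?_)
      rw [add_sub_cancel_left, PiLp.norm_single, norm_neg, Real.norm_of_nonneg (by positivity)]
      linarith
    have h2 : z + EuclideanSpace.single k (r / 2) ∈ unitSquare := by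
      refine hball (mem_ball_iff_norm.2 ?_)
      rw [add_sub_cancel_left, PiLp.norm_single, Real.norm_of_nonneg (by positivity)]
      linarith
    have h3 := (h1 k).1
    have h4 := (h2 k).2
    simp at h3 h4
    constructor <;> linarith
  -- The square of side `r` around `z` lies in the ball by the sum norm. Each coordinate offers at
  -- least `n * r - 2` indices, which is at least `n * r / 2` since `4 ≤ n * r`.
  set A : Fin 2 → Finset (Fin n) := fun k => Finset.univ.filter fun i : Fin n =>
    z k - r / 2 < ((i : ℝ) + 1 / 2) / n ∧ ((i : ℝ) + 1 / 2) / n < z k + r / 2 with hA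
  have hcard : ∀ k, n * r / 2 ≤ ((A k).card : ℝ) := by
    intro k
    have := le_card_coordinates hn (hcoord k).1 (hcoord k).2
    rw [show z k + r / 2 - (z k - r / 2) = r by ring] at this
    linarith
  have hsub : A 0 ×ˢ A 1 ⊆ Finset.univ.filter fun p : Pixel n => designPoint n p ∈ Metric.ball z r := by
    intro p hp
    simp only [hA, Finset.mem_product, Finset.mem_filter, Finset.mem_univ, true_and] at hp ⊢
    rw [mem_ball_iff_norm]
    refine (norm_le_abs_add_abs _).trans_lt ?_
    simp only [PiLp.sub_apply, designPoint_zero, designPoint_one]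
    have h1 : |((p.1 : ℝ) + 1 / 2) / n - z 0| < r / 2 := abs_lt.2 ⟨by linarith [hp.1.1], by linarith [hp.1.2]⟩
    have h2 : |((p.2 : ℝ) + 1 / 2) / n - z 1| < r / 2 := abs_lt.2 ⟨by linarith [hp.2.1], by linarith [hp.2.2]⟩
    linarith
  have h1 : ((A 0 ×ˢ A 1).card : ℝ) ≤ _ := Nat.cast_le.2 (Finset.card_le_card hsub)
  refine le_trans ?_ h1
  rw [Finset.card_product, Nat.cast_mul, sq]
  exact mul_le_mul (hcard 0) (hcard 1) (by positivity) (Nat.cast_nonneg _)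

theorem norm_sq_sub_designPoint {n : ℕ} (x : Plane) (p : Pixel n) :
    ‖x - designPoint n p‖ ^ 2 =
      (x 0 - ((p.1 : ℝ) + 1 / 2) / n) ^ 2 + (x 1 - ((p.2 : ℝ) + 1 / 2) / n) ^ 2 := by
  rw [EuclideanSpace.norm_sq_eq, Fin.sum_univ_two]
  simp only [PiLp.sub_apply, designPoint_zero, designPoint_one, Real.norm_eq_abs, sq_abs]

/-- The centre of the window exists. -/
theorem exists_isCentre {n : ℕ} (hn : 0 < n) (x : Plane) : ∃ p, IsCentre n x p := by
  have : Nonempty (Fin n) := ⟨⟨0, hn⟩⟩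
  -- The squared distance is a sum of one term per coordinate, so minimization and tie-breaking can
  -- be done coordinatewise.
  have h1 : ∀ φ : Fin n → ℝ, ∃ i, (∀ j, φ i ≤ φ j) ∧ ∀ j, φ j = φ i → i ≤ j := by
    intro φ
    obtain ⟨i₀, hi₀⟩ := Finite.exists_min φ
    set S := Finset.univ.filter fun i => φ i = φ i₀ with hS
    have hne : S.Nonempty := ⟨i₀, by simp [hS]⟩
    have hmem : φ (S.min' hne) = φ i₀ := (Finset.mem_filter.1 (S.min'_mem hne)).2
    refine ⟨S.min' hne, fun j => hmem.trans_le (hi₀ j), fun j hj => S.min'_le j ?_⟩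
    exact Finset.mem_filter.2 ⟨Finset.mem_univ _, hj.trans hmem⟩
  obtain ⟨i, hi, hi'⟩ := h1 fun i => (x 0 - ((i : ℝ) + 1 / 2) / n) ^ 2
  obtain ⟨j, hj, hj'⟩ := h1 fun i => (x 1 - ((i : ℝ) + 1 / 2) / n) ^ 2
  refine ⟨(i, j), fun q => ?_, fun q hq => ?_⟩
  · rw [← sq_le_sq₀ (norm_nonneg _) (norm_nonneg _), norm_sq_sub_designPoint,
      norm_sq_sub_designPoint]
    exact add_le_add (hi q.1) (hj q.2)
  · have h2 : ‖x - designPoint n q‖ ^ 2 = ‖x - designPoint n (i, j)‖ ^ 2 := by rw [hq]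
    rw [norm_sq_sub_designPoint, norm_sq_sub_designPoint] at h2
    have h3 := hi q.1
    have h4 := hj q.2
    simp only at h2 h3 h4
    exact ⟨hi' q.1 (by simp only; linarith), hj' q.2 (by simp only; linarith)⟩

/-- The starting value is the observation at the centre. -/
theorem exists_startValue_eq {n : ℕ} (hn : 0 < n) (x : Plane) :
    ∃ p, IsCentre n x p ∧ ∀ Y, startValue n x Y = Y p := by
  have hex := exists_isCentre hn x
  refine ⟨hex.choose, hex.choose_spec, fun Y => ?_⟩
  rw [startValue, dif_pos hex]

/-! ### Bounds for the total weight of the window -/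

namespace IsWindowKernel

variable {K : Plane → ℝ}

theorem norm_lt_two (hK : IsWindowKernel K) {u : Plane} (hu : K u ≠ 0) : ‖u‖ < 2 := by
  have h1 : ∀ k, |u k| < 1 := by
    intro k
    by_contra hk
    exact hu (hK.support u ⟨k, not_lt.1 hk⟩)
  linarith [norm_le_abs_add_abs u, h1 0, h1 1]

theorem exists_le (hK : IsWindowKernel K) : ∃ C > 0, ∀ u, K u ≤ C := by
  obtain ⟨C, hC⟩ := hK.lipschitz
  have h0 := hK.pos_zero
  refine ⟨K 0 + C * 2, by positivity, fun u => ?_⟩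
  by_cases hu : K u = 0
  · rw [hu]; positivity
  · have h1 := hC.dist_le_mul u 0
    rw [Real.dist_eq, dist_zero_right] at h1
    have h2 := (le_abs_self _).trans h1
    have h3 : (C : ℝ) * ‖u‖ ≤ C * 2 := mul_le_mul_of_nonneg_left (hK.norm_lt_two hu).le C.2
    linarith

theorem exists_half_le (hK : IsWindowKernel K) : ∃ ρ > 0, ∀ u, ‖u‖ < ρ → K 0 / 2 ≤ K u := by
  obtain ⟨C, hC⟩ := hK.lipschitz
  have h0 := hK.pos_zero
  obtain ⟨ρ, hρ, h⟩ := (Metric.continuousAt_iff (a := (0 : Plane))).1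
    hC.continuous.continuousAt (K 0 / 2) (by positivity)
  refine ⟨ρ, hρ, fun u hu => ?_⟩
  have h1 := h (by rwa [dist_zero_right])
  rw [Real.dist_eq, abs_lt] at h1
  linarith

theorem weight_nonneg (hK : IsWindowKernel K) (n : ℕ) (h : ℝ) (x : Plane) (p : Pixel n) :
    0 ≤ weight K n h x p := hK.nonneg _

theorem norm_lt_of_weight_ne_zero (hK : IsWindowKernel K) {n : ℕ} {h : ℝ} (hh : 0 < h) {x : Plane}
    {p : Pixel n} (hp : weight K n h x p ≠ 0) : ‖x - designPoint n p‖ < 2 * h := by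
  have h1 := hK.norm_lt_two hp
  rw [norm_smul, norm_inv, Real.norm_of_nonneg hh.le] at h1
  rwa [inv_mul_lt_iff₀ hh, mul_comm] at h1

/-- Per coordinate at most `2 * (n * h) + 1` indices fall into the window, which is at most `3 * (n
* h)` when `1 ≤ n * h`. -/
theorem sum_weight_le (hK : IsWindowKernel K) {C : ℝ} (hC : 0 < C) (hKC : ∀ u, K u ≤ C) {n : ℕ}
    (hn : 0 < n) {h : ℝ} (hh : 0 < h) (hnh : 1 ≤ n * h) (x : Plane) :
    ∑ p, weight K n h x p ≤ C * 9 * (n * h) ^ 2 := by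
  set A : Fin 2 → Finset (Fin n) := fun k => Finset.univ.filter fun i : Fin n =>
    |x k - ((i : ℝ) + 1 / 2) / n| < h with hA
  have hcard : ∀ k, ((A k).card : ℝ) ≤ 3 * (n * h) := fun k =>
    (card_coordinates_le hn (x k) hh).trans (by linarith)
  have hzero : ∀ p ∉ A 0 ×ˢ A 1, weight K n h x p = 0 := by
    intro p hp
    by_contra hne
    apply hp
    have h1 : ∀ k, |x k - designPoint n p k| < h := by
      intro k
      by_contra hk
      refine hne (hK.support _ ⟨k, ?_⟩)
      rw [PiLp.smul_apply, PiLp.sub_apply, smul_eq_mul, abs_mul, abs_inv, abs_of_pos hh,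
        le_inv_mul_iff₀ hh, mul_one]
      exact not_lt.1 hk
    have h2 := h1 0
    have h3 := h1 1
    rw [designPoint_zero] at h2
    rw [designPoint_one] at h3
    simp only [hA, Finset.mem_product, Finset.mem_filter, Finset.mem_univ, true_and]
    exact ⟨h2, h3⟩
  calc ∑ p, weight K n h x p = ∑ p ∈ A 0 ×ˢ A 1, weight K n h x p :=
        (Finset.sum_subset (Finset.subset_univ _) fun p _ hp => hzero p hp).symm
    _ ≤ ∑ p ∈ A 0 ×ˢ A 1, C := Finset.sum_le_sum fun p _ => hKC _
    _ = C * (((A 0).card : ℝ) * (A 1).card) := by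
        rw [Finset.sum_const, Finset.card_product, nsmul_eq_mul]
        push_cast
        ring
    _ ≤ C * ((3 * (n * h)) * (3 * (n * h))) := by
        gcongr
        · exact hcard 0
        · exact hcard 1
    _ = C * 9 * (n * h) ^ 2 := by ring

-- Only the design points in a ball near the window's centre are counted, where the kernel is at
-- least half its value at `0`. The set `S` allows the count to be restricted to one side of the
-- boundary.
open Classical in
theorem le_sum_weight (hK : IsWindowKernel K) {ρ : ℝ}
    (hKρ : ∀ u, ‖u‖ < ρ → K 0 / 2 ≤ K u) {n : ℕ} (hn : 0 < n) {h : ℝ} (hh : 0 < h) {x z : Plane}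
    {r : ℝ} (hr : 0 < r) (hball : Metric.ball z r ⊆ Metric.ball x (ρ * h))
    (hsq : Metric.ball z r ⊆ unitSquare) (hnr : 4 ≤ n * r) {S : Finset (Pixel n)}
    (hS : ∀ p, designPoint n p ∈ Metric.ball z r → p ∈ S) :
    K 0 / 2 * (n * r / 2) ^ 2 ≤ ∑ p ∈ S, weight K n h x p := by
  have h0 := hK.pos_zero
  set B := Finset.univ.filter fun p : Pixel n => designPoint n p ∈ Metric.ball z r with hB
  have h1 := le_card_designPoint_mem_ball hn hr hsq hnr
  calc K 0 / 2 * (n * r / 2) ^ 2 ≤ K 0 / 2 * (B.card : ℝ) := by gcongr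
    _ = ∑ p ∈ B, K 0 / 2 := by rw [Finset.sum_const, nsmul_eq_mul, mul_comm]
    _ ≤ ∑ p ∈ B, weight K n h x p := by
        refine Finset.sum_le_sum fun p hp => hKρ _ ?_
        rw [hB, Finset.mem_filter] at hp
        have h2 := mem_ball_iff_norm.1 (hball hp.2)
        rw [norm_smul, norm_inv, Real.norm_of_nonneg hh.le, inv_mul_lt_iff₀ hh, mul_comm,
          norm_sub_rev]
        exact h2
    _ ≤ ∑ p ∈ S, weight K n h x p :=
        Finset.sum_le_sum_of_subset_of_nonneg
          (fun p hp => hS p (Finset.mem_filter.1 hp).2) fun p _ _ => hK.weight_nonneg _ _ _ _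

end IsWindowKernel

/-! ### The local structure of the data -/

/-- The data in the window around `x` consist of pixels with values near `m₀`, to which the centre
belongs and which have at least the share `α` of the total weight, and pixels with values near
`m₁`. No pixel has more than the share `ω` of the total weight. -/
structure LocalModel (K m : Plane → ℝ) (n : ℕ) (h : ℝ) (x : Plane) (p₀ : Pixel n)
    (ω α τ m₀ m₁ : ℝ) : Prop where
  size_pos : 0 < n
  start : ∀ Y, startValue n x Y = Y p₀
  sum_pos : 0 < ∑ p, weight K n h x p
  weight_le : ∀ p, weight K n h x p ≤ ω * ∑ p, weight K n h x p
  centre : |m (designPoint n p₀) - m₀| ≤ τ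
  cover : ∀ p, weight K n h x p ≠ 0 →
    |m (designPoint n p) - m₀| ≤ τ ∨ |m (designPoint n p) - m₁| ≤ τ
  share : α * ∑ p, weight K n h x p ≤
    ∑ p with |m (designPoint n p) - m₀| ≤ τ, weight K n h x p

theorem isOpen_openUnitSquare : IsOpen openUnitSquare := by
  have : openUnitSquare = ⋂ k : Fin 2, (fun x : Plane => x k) ⁻¹' Ioo 0 1 := by
    ext x
    simp [openUnitSquare]
  rw [this]
  exact isOpen_iInter_of_finite fun k => isOpen_Ioo.preimage (by fun_prop)

theorem openUnitSquare_subset : openUnitSquare ⊆ unitSquare :=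
  fun _ hx k => ⟨(hx k).1.le, (hx k).2.le⟩

/-- In small discs, each side of the boundary contains balls of comparable size. -/
theorem exists_balls_on_same_side {D : Set Plane} (hcl : IsClosed D)
    (hreg : D = closure (interior D))
    (hbd : ∃ (k : ℕ) (γ : Fin k → Set Plane),
      (∀ i, IsEdgeCurve (γ i)) ∧ Pairwise (fun i j => Disjoint (γ i) (γ j)) ∧
        frontier D = ⋃ i, γ i) (x₀ : Plane) :
    ∃ c > 0, ∃ r > 0, (∀ ρ, 0 < ρ → ρ < r → ∀ q ∈ Metric.ball x₀ r,
      ∃ z, Metric.ball z (c * ρ) ⊆ {y | y ∈ D ↔ q ∈ D} ∩ Metric.ball x₀ ρ) ∧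
      (x₀ ∉ frontier D → ∀ y ∈ Metric.ball x₀ r, ∀ q ∈ Metric.ball x₀ r, (y ∈ D ↔ q ∈ D)) := by
  by_cases hx : x₀ ∈ frontier D
  · obtain ⟨c, hc, r, hr, h⟩ := exists_balls_on_both_sides hcl hreg hbd hx
    refine ⟨c, hc, r, hr, fun ρ hρ hρr q _ => ?_, fun h' => absurd hx h'⟩
    obtain ⟨⟨z, hz⟩, ⟨z', hz'⟩⟩ := h ρ hρ hρr
    by_cases hq : q ∈ D
    · exact ⟨z, fun y hy => ⟨iff_of_true (hz hy).1 hq, (hz hy).2⟩⟩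
    · exact ⟨z', fun y hy => ⟨iff_of_false (hz' hy).1 hq, (hz' hy).2⟩⟩
  · have : ∃ r > 0, ∀ y ∈ Metric.ball x₀ r, ∀ q ∈ Metric.ball x₀ r, (y ∈ D ↔ q ∈ D) := by
      by_cases hD : x₀ ∈ D
      · have hi : x₀ ∈ interior D := by
          by_contra hni
          exact hx ⟨subset_closure hD, hni⟩
        obtain ⟨r, hr, hball⟩ := Metric.isOpen_iff.1 isOpen_interior _ hi
        exact ⟨r, hr, fun y hy q hq =>
          iff_of_true (interior_subset (hball hy)) (interior_subset (hball hq))⟩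
      · obtain ⟨r, hr, hball⟩ := Metric.isOpen_iff.1 hcl.isOpen_compl _ hD
        exact ⟨r, hr, fun y hy q hq => iff_of_false (hball hy) (hball hq)⟩
    obtain ⟨r, hr, h⟩ := this
    refine ⟨1, one_pos, r, hr, fun ρ _ hρr q hq => ⟨x₀, fun y hy => ?_⟩, fun _ => h⟩
    rw [one_mul] at hy
    exact ⟨h y (Metric.ball_subset_ball hρr.le hy) q hq, hy⟩

/-- The total weight and the weight on the centre's side are both of order `(n * h n) ^ 2`, which
gives the fixed share `α` and the maximal share `C / (n * h n) ^ 2` of a single pixel. The levels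
follow from continuity of `μ` and depend on `n` only through the side on which the centre falls. Off
the boundary there is one level. -/
theorem exists_localModel {K μ : Plane → ℝ} {d : ℝ} {D : Set Plane} {h : ℕ → ℝ}
    (himg : IsImage μ d D) (hK : IsWindowKernel K) (hpos : ∀ n, 0 < h n)
    (hh : Tendsto h atTop (𝓝 0)) (hnh : Tendsto (fun n : ℕ => n * h n) atTop atTop) {x₀ : Plane}
    (hx₀ : x₀ ∈ openUnitSquare) :
    ∃ α > 0, ∃ C > 0, ∀ τ > 0, ∀ᶠ n : ℕ in atTop, ∃ (p₀ : Pixel n) (m₀ m₁ : ℝ),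
      ((m₀ = μ x₀ ∧ m₁ = μ x₀ + d) ∨ (m₀ = μ x₀ + d ∧ m₁ = μ x₀)) ∧
      LocalModel K (regression μ d D) n (h n) x₀ p₀ (C / (n * h n) ^ 2) α τ m₀ m₁ ∧
      (x₀ ∉ frontier D → ∀ p, weight K n (h n) x₀ p ≠ 0 →
        |regression μ d D (designPoint n p) - m₀| ≤ τ) := by
  obtain ⟨rS, hrS, hsq⟩ := Metric.isOpen_iff.1 isOpen_openUnitSquare _ hx₀
  obtain ⟨C, hC, hKC⟩ := hK.exists_le
  obtain ⟨ρ, hρ, hKρ⟩ := hK.exists_half_le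
  obtain ⟨c, hc, r, hr, hside, hsame⟩ :=
    exists_balls_on_same_side himg.isClosed himg.region himg.boundary x₀
  have hK0 := hK.pos_zero
  set c₁ := K 0 / 2 * (c * ρ / 2) ^ 2 with hc₁
  have hc₁0 : 0 < c₁ := by positivity
  -- Both constants are fixed before `τ`; later `τ` is chosen small relative to `α`.
  refine ⟨c₁ / (C * 9), by positivity, C / c₁, by positivity, fun τ hτ => ?_⟩
  have hμ : ContinuousAt μ x₀ := himg.continuousOn.continuousAt
    (Filter.mem_of_superset (isOpen_openUnitSquare.mem_nhds hx₀) openUnitSquare_subset)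
  obtain ⟨δ, hδ, hμδ⟩ := Metric.continuousAt_iff.1 hμ τ hτ
  set η := min (min r δ) rS with hη
  have hη0 : 0 < η := by positivity
  have hev1 : ∀ᶠ n in atTop, 2 * h n < η ∧ ρ * h n < η := by
    have h1 : Tendsto (fun n => 2 * h n) atTop (𝓝 0) := by simpa using hh.const_mul 2
    have h2 : Tendsto (fun n => ρ * h n) atTop (𝓝 0) := by simpa using hh.const_mul ρ
    exact (h1.eventually (gt_mem_nhds hη0)).and (h2.eventually (gt_mem_nhds hη0))
  have hev2 : ∀ᶠ n : ℕ in atTop, 4 ≤ n * η :=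
    (tendsto_natCast_atTop_atTop.atTop_mul_const hη0).eventually_ge_atTop 4
  filter_upwards [hev1, hev2, hnh.eventually_ge_atTop 1, hnh.eventually_ge_atTop (4 / (c * ρ)),
    eventually_gt_atTop 0] with n h1 h2 h3 h4 hn
  obtain ⟨p₀, hp₀, hstart⟩ := exists_startValue_eq hn x₀
  have hcent : ‖designPoint n p₀ - x₀‖ < η := by
    classical
    have h5 := le_card_designPoint_mem_ball hn hη0 (((Metric.ball_subset_ball
      (min_le_right _ _)).trans hsq).trans openUnitSquare_subset) h2
    have h6 : (0 : ℝ) < (Finset.univ.filter fun p : Pixel n =>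
        designPoint n p ∈ Metric.ball x₀ η).card := by
      refine lt_of_lt_of_le ?_ h5
      have : 0 < n * η / 2 := by linarith
      positivity
    obtain ⟨q, hq⟩ := Finset.card_pos.1 (Nat.cast_pos.1 h6)
    rw [Finset.mem_filter, mem_ball_iff_norm, norm_sub_rev] at hq
    rw [norm_sub_rev]
    exact (hp₀.1 q).trans_lt hq.2
  have hηr : η ≤ r := (min_le_left _ _).trans (min_le_left _ _)
  have hηδ : η ≤ δ := (min_le_left _ _).trans (min_le_right _ _)
  have hμη : ∀ y, ‖y - x₀‖ < η → |μ y - μ x₀| < τ := by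
    intro y hy
    have := hμδ (show dist y x₀ < δ by rw [dist_eq_norm]; exact hy.trans_le hηδ)
    rwa [Real.dist_eq] at this
  have hwη : ∀ p, weight K n (h n) x₀ p ≠ 0 → ‖designPoint n p - x₀‖ < η := by
    intro p hp
    rw [norm_sub_rev]
    exact (hK.norm_lt_of_weight_ne_zero (hpos n) hp).trans h1.1
  obtain ⟨m₀, m₁, hm, hsame₀, hother⟩ : ∃ m₀ m₁ : ℝ,
      ((m₀ = μ x₀ ∧ m₁ = μ x₀ + d) ∨ (m₀ = μ x₀ + d ∧ m₁ = μ x₀)) ∧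
      (∀ y, ‖y - x₀‖ < η → (y ∈ D ↔ designPoint n p₀ ∈ D) →
        |regression μ d D y - m₀| ≤ τ) ∧
      (∀ y, ‖y - x₀‖ < η → ¬ (y ∈ D ↔ designPoint n p₀ ∈ D) →
        |regression μ d D y - m₁| ≤ τ) := by
    by_cases hD : designPoint n p₀ ∈ D
    · refine ⟨μ x₀ + d, μ x₀, Or.inr ⟨rfl, rfl⟩, fun y hy hyD => ?_, fun y hy hyD => ?_⟩
      · have hy' : y ∈ D := hyD.2 hD
        rw [regression, indicator_of_mem hy', add_sub_add_right_eq_sub]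
        exact (hμη y hy).le
      · have hy' : y ∉ D := fun h' => hyD (iff_of_true h' hD)
        rw [regression, indicator_of_notMem hy', add_zero]
        exact (hμη y hy).le
    · refine ⟨μ x₀, μ x₀ + d, Or.inl ⟨rfl, rfl⟩, fun y hy hyD => ?_, fun y hy hyD => ?_⟩
      · have hy' : y ∉ D := fun h' => hD (hyD.1 h')
        rw [regression, indicator_of_notMem hy', add_zero]
        exact (hμη y hy).le
      · have hy' : y ∈ D := by
          by_contra h'
          exact hyD (iff_of_false h' hD)
        rw [regression, indicator_of_mem hy', add_sub_add_right_eq_sub]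
        exact (hμη y hy).le
  have hρh : 0 < ρ * h n := mul_pos hρ (hpos n)
  -- A ball on the side of the centre pixel, of radius proportional to the bandwidth, inside the
  -- disc where the kernel is bounded below.
  obtain ⟨z, hz⟩ := hside (ρ * h n) hρh (h1.2.trans_le hηr) (designPoint n p₀)
    (mem_ball_iff_norm.2 (hcent.trans_le hηr))
  have hlow : c₁ * (n * h n) ^ 2 ≤
      ∑ p with |regression μ d D (designPoint n p) - m₀| ≤ τ, weight K n (h n) x₀ p := by
    have h5 := hK.le_sum_weight hKρ hn (hpos n) (x := x₀) (z := z) (r := c * (ρ * h n))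
      (by positivity) (hz.trans inter_subset_right)
      ((hz.trans inter_subset_right).trans (((Metric.ball_subset_ball
        (h1.2.le.trans (min_le_right _ _))).trans hsq).trans openUnitSquare_subset))
      (by
        rw [div_le_iff₀ (by positivity)] at h4
        calc (4 : ℝ) ≤ n * h n * (c * ρ) := h4
          _ = n * (c * (ρ * h n)) := by ring)
      (S := {p | |regression μ d D (designPoint n p) - m₀| ≤ τ}) (by
        intro p hp
        rw [Finset.mem_filter]
        exact ⟨Finset.mem_univ _, hsame₀ _ ((mem_ball_iff_norm.1 (hz hp).2).trans h1.2) (hz hp).1⟩)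
    refine le_trans (le_of_eq ?_) h5
    rw [hc₁]; ring
  have hnh0 : 0 < (n : ℝ) * h n := by linarith
  have hsub : ∑ p with |regression μ d D (designPoint n p) - m₀| ≤ τ, weight K n (h n) x₀ p ≤
      ∑ p, weight K n (h n) x₀ p :=
    Finset.sum_le_sum_of_subset_of_nonneg (Finset.filter_subset _ _)
      fun p _ _ => hK.weight_nonneg _ _ _ _
  have hup := hK.sum_weight_le hC hKC hn (hpos n) h3 x₀
  refine ⟨p₀, m₀, m₁, hm, ⟨hn, hstart, ?_, fun p => ?_, hsame₀ _ hcent Iff.rfl, fun p hp => ?_, ?_⟩,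
    fun hfr p hp => ?_⟩
  · exact lt_of_lt_of_le (by positivity) (hlow.trans hsub)
  · calc weight K n (h n) x₀ p ≤ C := hKC _
      _ = C / c₁ / (n * h n) ^ 2 * (c₁ * (n * h n) ^ 2) := by
          have := (hpos n).ne'
          field_simp
      _ ≤ _ := by gcongr; exact hlow.trans hsub
  · by_cases hD : designPoint n p ∈ D ↔ designPoint n p₀ ∈ D
    · exact Or.inl (hsame₀ _ (hwη p hp) hD)
    · exact Or.inr (hother _ (hwη p hp) hD)
  · calc c₁ / (C * 9) * ∑ p, weight K n (h n) x₀ p ≤ c₁ / (C * 9) * (C * 9 * (n * h n) ^ 2) := by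
          gcongr
      _ = c₁ * (n * h n) ^ 2 := by field_simp
      _ ≤ _ := hlow
  · exact hsame₀ _ (hwη p hp) (hsame hfr _ (mem_ball_iff_norm.2 ((hwη p hp).trans_le hηr)) _
      (mem_ball_iff_norm.2 (hcent.trans_le hηr)))

end MSmoother

namespace MSmoother

/-! ### Means and deviations of the normalized score -/

/-- The mean of the score of an observation with error distribution `Q`. -/
noncomputable def scoreMean (L : ℝ → ℝ) (g : ℝ) (Q : Measure ℝ) (t : ℝ) : ℝ :=
  ∫ u, deriv L ((t - u) / g) ∂Q

theorem abs_scoreMean_sub_le {L : ℝ → ℝ} {C B : ℝ} (hcont : Continuous (deriv L))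
    (hB : ∀ v, |deriv L v| ≤ B) (hC : ∀ v w, |deriv L v - deriv L w| ≤ C * |v - w|) {g : ℝ}
    (hg : 0 < g) (Q : Measure ℝ) [IsProbabilityMeasure Q] (s t : ℝ) :
    |scoreMean L g Q s - scoreMean L g Q t| ≤ C / g * |s - t| := by
  have hm : ∀ s : ℝ, Measurable fun u => deriv L ((s - u) / g) := fun s =>
    (hcont.comp (by fun_prop)).measurable
  rw [scoreMean, scoreMean, ← integral_sub (integrable_of_abs_le (hm s) fun u => hB _)
    (integrable_of_abs_le (hm t) fun u => hB _)]
  have := norm_integral_le_of_norm_le_const (μ := Q)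
    (f := fun u => deriv L ((s - u) / g) - deriv L ((t - u) / g)) (C := C / g * |s - t|)
    (Eventually.of_forall fun u => by
      refine (hC _ _).trans (le_of_eq ?_)
      rw [← sub_div, sub_sub_sub_cancel_right, abs_div, abs_of_pos hg]
      ring)
  simpa using this

namespace LocalModel

variable {K m : Plane → ℝ} {n : ℕ} {h : ℝ} {x : Plane} {p₀ : Pixel n} {ω α τ m₀ m₁ : ℝ}

theorem sum_normalized (M : LocalModel K m n h x p₀ ω α τ m₀ m₁) :
    ∑ p, weight K n h x p / ∑ q, weight K n h x q = 1 := by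
  rw [← Finset.sum_div, div_self M.sum_pos.ne']

theorem normalized_nonneg (M : LocalModel K m n h x p₀ ω α τ m₀ m₁) (hK : IsWindowKernel K)
    (p : Pixel n) : 0 ≤ weight K n h x p / ∑ q, weight K n h x q :=
  div_nonneg (hK.weight_nonneg _ _ _ _) M.sum_pos.le

/-- An upper bound for weighted means that are dominated by the pixels with values near `m₀`. -/
theorem weighted_sum_le (M : LocalModel K m n h x p₀ ω α τ m₀ m₁) (hK : IsWindowKernel K)
    {φ : ℝ → ℝ} {Λ : ℝ} (hΛ : 0 ≤ Λ) (hφ : ∀ s t, |φ s - φ t| ≤ Λ * |s - t|) {y t η β : ℝ}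
    (hy : |y - m₀ - t| ≤ τ) (hη : 0 ≤ η) (hβ : 0 ≤ β) (ht : φ t ≤ -η)
    (ht' : (∀ p, weight K n h x p ≠ 0 → |m (designPoint n p) - m₀| ≤ τ) ∨
      φ (t + m₀ - m₁) ≤ β) :
    ∑ p, weight K n h x p / (∑ q, weight K n h x q) * φ (y - m (designPoint n p)) ≤
      -(α * η) + β + 2 * Λ * τ := by
  set W := ∑ q, weight K n h x q with hW
  set S := Finset.univ.filter fun p : Pixel n => |m (designPoint n p) - m₀| ≤ τ with hS
  have hW0 : 0 < W := M.sum_pos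
  have ha : ∀ p, 0 ≤ weight K n h x p / W := M.normalized_nonneg hK
  have hsum : ∑ p, weight K n h x p / W = 1 := M.sum_normalized
  have hshare : α ≤ ∑ p ∈ S, weight K n h x p / W := by
    rw [← Finset.sum_div, le_div_iff₀ hW0]
    exact M.share
  -- The argument is off by at most `2 * τ`: one `τ` from `y`, one from the level of the pixel.
  -- Granting `β` to every pixel is harmless since `0 ≤ β`.
  have hterm : ∀ p, weight K n h x p / W * φ (y - m (designPoint n p)) ≤
      weight K n h x p / W * (2 * Λ * τ + β) + if p ∈ S then weight K n h x p / W * (-η) else 0 := by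
    intro p
    by_cases hpS : p ∈ S
    · rw [if_pos hpS, ← mul_add]
      refine mul_le_mul_of_nonneg_left ?_ (ha p)
      have h1 : |m (designPoint n p) - m₀| ≤ τ := (Finset.mem_filter.1 hpS).2
      have h2 : |y - m (designPoint n p) - t| ≤ 2 * τ := by
        rw [abs_le] at hy h1 ⊢
        constructor <;> linarith
      have h3 := (hφ (y - m (designPoint n p)) t).trans (mul_le_mul_of_nonneg_left h2 hΛ)
      linarith [(abs_le.1 h3).2]
    · rw [if_neg hpS, add_zero]
      by_cases hw : weight K n h x p = 0
      · simp [hw]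
      refine mul_le_mul_of_nonneg_left ?_ (ha p)
      have h0 : ¬ |m (designPoint n p) - m₀| ≤ τ := fun h' =>
        hpS (Finset.mem_filter.2 ⟨Finset.mem_univ _, h'⟩)
      have h4 : φ (t + m₀ - m₁) ≤ β := ht'.resolve_left fun hall => h0 (hall p hw)
      have h1 : |m (designPoint n p) - m₁| ≤ τ := (M.cover p hw).resolve_left h0
      have h2 : |y - m (designPoint n p) - (t + m₀ - m₁)| ≤ 2 * τ := by
        rw [abs_le] at hy h1 ⊢
        constructor <;> linarith
      have h3 := (hφ (y - m (designPoint n p)) (t + m₀ - m₁)).trans (mul_le_mul_of_nonneg_left h2 hΛ)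
      linarith [(abs_le.1 h3).2]
  calc _ ≤ ∑ p, (weight K n h x p / W * (2 * Λ * τ + β) +
          if p ∈ S then weight K n h x p / W * (-η) else 0) := Finset.sum_le_sum fun p _ => hterm p
    _ = (2 * Λ * τ + β) + (∑ p ∈ S, weight K n h x p / W) * (-η) := by
        rw [Finset.sum_add_distrib, ← Finset.sum_mul, hsum, one_mul, Finset.sum_ite_mem,
          Finset.univ_inter, Finset.sum_mul]
    _ ≤ _ := by nlinarith

theorem le_weighted_sum (M : LocalModel K m n h x p₀ ω α τ m₀ m₁) (hK : IsWindowKernel K)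
    {φ : ℝ → ℝ} {Λ : ℝ} (hΛ : 0 ≤ Λ) (hφ : ∀ s t, |φ s - φ t| ≤ Λ * |s - t|) {y t η β : ℝ}
    (hy : |y - m₀ - t| ≤ τ) (hη : 0 ≤ η) (hβ : 0 ≤ β) (ht : η ≤ φ t)
    (ht' : (∀ p, weight K n h x p ≠ 0 → |m (designPoint n p) - m₀| ≤ τ) ∨
      -β ≤ φ (t + m₀ - m₁)) :
    α * η - β - 2 * Λ * τ ≤
      ∑ p, weight K n h x p / (∑ q, weight K n h x q) * φ (y - m (designPoint n p)) := by
  have := M.weighted_sum_le hK (φ := fun s => -φ s) hΛ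
    (fun s t => by rw [neg_sub_neg, abs_sub_comm]; exact hφ s t) hy hη hβ (neg_le_neg ht)
    (ht'.imp_right fun h' => by linarith)
  simp only [mul_neg, Finset.sum_neg_distrib] at this
  linarith

/-- Uniform deviations of the normalized score from its mean. -/
theorem measureReal_deviation_le (M : LocalModel K m n h x p₀ ω α τ m₀ m₁)
    (hK : IsWindowKernel K) (hω : 0 < ω) {L : ℝ → ℝ} {C B V σ g : ℝ}
    (hcont : Continuous (deriv L)) (hC0 : 0 < C) (hB : ∀ v, |deriv L v| ≤ B)
    (hC : ∀ v w, |deriv L v - deriv L w| ≤ C * |v - w|) (hg : 0 < g) (hV0 : 0 < V) (hσ : 0 < σ)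
    (hσB : σ * B ≤ V) (Q : Measure ℝ) [IsProbabilityMeasure Q]
    (hV : ∀ y, ∫ u, deriv L ((y - u) / g) ^ 2 ∂Q ≤ V) {lo hi : ℝ} (hlh : lo ≤ hi) :
    (Measure.pi fun _ : Pixel n => Q).real {e | ∃ y ∈ Icc lo hi, σ ≤
      |scoreSum K L n h g x (fun p => m (designPoint n p) + e p) y / (∑ q, weight K n h x q) -
        ∑ p, weight K n h x p / (∑ q, weight K n h x q) *
          scoreMean L g Q (y - m (designPoint n p))|} ≤
      ((hi - lo) * (4 * (C / g) / σ) + 1) * (2 * Real.exp (-(σ ^ 2 / (16 * ω * V)))) := by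
  have key := measureReal_exists_le_abs_sum_le (Q := Q)
    (a := fun p => weight K n h x p / ∑ q, weight K n h x q) (ω := ω) (V := V) (B := B) (τ := σ)
    (M.normalized_nonneg hK) M.sum_normalized
    (fun p => by rw [div_le_iff₀ M.sum_pos]; exact M.weight_le p) hω hV0 hσ hσB
    (X := fun p y u => deriv L ((y - m (designPoint n p) - u) / g))
    (fun p y => (hcont.comp (by fun_prop)).measurable) (fun p y u => hB _) (fun p y => hV _)
    (Λ := C / g) (by positivity)
    (fun p u y y' => by
      refine (hC _ _).trans (le_of_eq ?_)
      rw [← sub_div, sub_sub_sub_cancel_right, sub_sub_sub_cancel_right, abs_div, abs_of_pos hg]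
      ring) lo hi hlh
  convert key using 8 with e y
  rw [scoreSum, Finset.sum_div, ← Finset.sum_sub_distrib]
  congr 1
  refine Finset.sum_congr rfl fun p _ => ?_
  rw [scoreMean, sub_sub]
  ring

theorem scoreSum_pos_iff (M : LocalModel K m n h x p₀ ω α τ m₀ m₁) {L : ℝ → ℝ} {g : ℝ}
    {Y : Pixel n → ℝ} {y : ℝ} :
    0 < scoreSum K L n h g x Y y ↔ 0 < scoreSum K L n h g x Y y / ∑ q, weight K n h x q :=
  (div_pos_iff_of_pos_right M.sum_pos).symm

theorem scoreSum_neg_iff (M : LocalModel K m n h x p₀ ω α τ m₀ m₁) {L : ℝ → ℝ} {g : ℝ}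
    {Y : Pixel n → ℝ} {y : ℝ} :
    scoreSum K L n h g x Y y < 0 ↔ scoreSum K L n h g x Y y / ∑ q, weight K n h x q < 0 := by
  rw [div_lt_iff₀ M.sum_pos, zero_mul]

end LocalModel

/-! ### Laws of estimators -/

section Law

variable {m : Plane → ℝ} {n : ℕ} {mhat : (Pixel n → ℝ) → ℝ} {Q : Measure ℝ}

theorem measurable_shift (hm : Measurable mhat) :
    Measurable fun e : Pixel n → ℝ => mhat fun p => m (designPoint n p) + e p :=
  hm.comp (measurable_pi_lambda _ fun p => (measurable_pi_apply p).const_add _)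

theorem estimatorLaw_real (hm : Measurable mhat) {s : Set ℝ} (hs : MeasurableSet s) :
    (estimatorLaw m mhat Q).real s =
      (Measure.pi fun _ : Pixel n => Q).real {e | (mhat fun p => m (designPoint n p) + e p) ∈ s} :=
  map_measureReal_apply (measurable_shift hm) hs

variable [IsProbabilityMeasure Q]

theorem isProbabilityMeasure_estimatorLaw (hm : Measurable mhat) :
    IsProbabilityMeasure (estimatorLaw m mhat Q) :=
  Measure.isProbabilityMeasure_map (measurable_shift hm).aemeasurable

theorem pi_real_eval (p : Pixel n) {s : Set ℝ} (hs : MeasurableSet s) :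
    (Measure.pi fun _ : Pixel n => Q).real {e | e p ∈ s} = Q.real s :=
  (measurePreserving_eval (fun _ : Pixel n => Q) p).measureReal_preimage hs.nullMeasurableSet

end Law

/-! ### The mean score of a unimodal density -/

namespace IsUnimodalScore

variable {L : ℝ → ℝ}

theorem deriv_eq_zero (hL : IsUnimodalScore L) {v : ℝ} (hv : v ∉ Ioo (-1 : ℝ) 1) : deriv L v = 0 := by
  -- A zero of the nonnegative `L` is a minimum; this includes the endpoints `-1` and `1`.
  have h1 : IsLocalMin L v := Eventually.of_forall fun w => by
    rw [hL.support v hv]; exact hL.nonneg w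
  exact h1.deriv_eq_zero

theorem deriv_neg_arg (hL : IsUnimodalScore L) (v : ℝ) : deriv L (-v) = -deriv L v := by
  have h1 := deriv_comp_neg L v
  rw [funext hL.symm] at h1
  linarith

theorem deriv_neg_of_pos (hL : IsUnimodalScore L) {v : ℝ} (h0 : 0 < v) (h1 : v < 1) :
    deriv L v < 0 := by
  have := hL.deriv_pos (-v) ⟨by linarith, by linarith⟩
  rw [hL.deriv_neg_arg] at this
  linarith

theorem contDiff_deriv (hL : IsUnimodalScore L) : ContDiff ℝ 1 (deriv L) := by
  obtain ⟨C, hC⟩ := hL.lipschitz_deriv_deriv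
  exact contDiff_one_iff_deriv.2 ⟨hL.differentiable_deriv, hC.continuous⟩

theorem hasCompactSupport_deriv (hL : IsUnimodalScore L) : HasCompactSupport (deriv L) :=
  HasCompactSupport.intro (isCompact_Icc (a := (-1 : ℝ)) (b := 1)) fun _ hv =>
    hL.deriv_eq_zero fun h => hv ⟨h.1.le, h.2.le⟩

end IsUnimodalScore

section UnimodalDensity

variable {g : ℝ} {f : ℝ → ℝ} {I : Set ℝ}

/-- The point `t - w` is closer to the mode than `t + w`. If it is negative, symmetry on `[-g, g]`
moves it to `w - t`, which is below `t + w`. The case `w = t` is left out because the value at the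
mode is not controlled by the monotonicity assumptions. -/
theorem IsUnimodalOn.add_le_sub (hu : IsUnimodalOn g f I) (hI : I.OrdConnected)
    (hf : ∀ y, 0 ≤ f y) (hfI : ∀ y, y ∉ I → f y = 0) {t w : ℝ} (htI : t ∈ I) (ht : 0 < t)
    (hw : 0 < w) (hwg : w < g) (hwt : w ≠ t) :
    f (t + w) ≤ f (t - w) ∧ (w < t → f (t + w) < f (t - w)) := by
  have hlt : w < t → f (t + w) < f (t - w) := by
    intro h1
    have h2 : t - w ∈ I := hI.out hu.zero_mem htI ⟨by linarith, by linarith⟩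
    have h3 : f t < f (t - w) := hu.strictAnti ⟨by simpa using h1, h2⟩ ⟨ht, htI⟩ (by linarith)
    by_cases h4 : t + w ∈ I
    · have := hu.strictAnti ⟨ht, htI⟩ ⟨by simp; linarith, h4⟩ (show t < t + w by linarith)
      linarith
    · rw [hfI _ h4]
      linarith [hf t]
  refine ⟨?_, hlt⟩
  rcases lt_or_gt_of_ne hwt with h1 | h1
  · exact (hlt h1).le
  · have h2 := hu.symm (w - t) ⟨by linarith, by linarith⟩
    rw [neg_sub] at h2
    rw [h2]
    by_cases h4 : t + w ∈ I
    · have h5 : w - t ∈ I := hI.out hu.zero_mem h4 ⟨by linarith, by linarith⟩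
      exact (hu.strictAnti ⟨by simpa using h1, h5⟩ ⟨by simp; linarith, h4⟩ (by linarith)).le
    · rw [hfI _ h4]
      exact hf _

/-- Since `deriv L` is odd, combining the contributions of `w` and `-w` gives `deriv L (w / g) * (f
(t - w) - f (t + w))`. This is nonpositive for almost all positive `w`, and strictly negative for
small ones. -/
theorem IsUnimodalOn.integral_deriv_mul_neg (hu : IsUnimodalOn g f I) (hI : I.OrdConnected)
    (hf : ∀ y, 0 ≤ f y) (hfI : ∀ y, y ∉ I → f y = 0) (hint : Integrable f) (hg : 0 < g)
    {L : ℝ → ℝ} (hL : IsUnimodalScore L) {t : ℝ} (htI : t ∈ I) (ht : 0 < t) :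
    ∫ u, deriv L ((t - u) / g) * f u < 0 := by
  obtain ⟨B, hB⟩ := hL.hasCompactSupport_deriv.exists_bound_of_continuous
    hL.contDiff_deriv.continuous
  have hLm : Continuous fun w => deriv L (w / g) := hL.contDiff_deriv.continuous.comp (by fun_prop)
  set J : ℝ → ℝ := fun w => deriv L (w / g) * f (t - w) with hJ
  have hJi : Integrable J :=
    (hint.comp_sub_left t).bdd_mul hLm.aestronglyMeasurable (Eventually.of_forall fun w => hB _)
  have hJn : Integrable fun w => J (-w) := hJi.comp_neg
  have h1 : ∫ u, deriv L ((t - u) / g) * f u = ∫ w, J w := by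
    rw [← integral_sub_left_eq_self J volume t]
    simp only [hJ, sub_sub_cancel]
  have h2 : ∫ w, J (-w) = ∫ w, J w := integral_neg_eq_self J volume
  set Z : ℝ → ℝ := fun w => -(J w + J (-w)) with hZ
  have hZeq : ∀ w, Z w = -deriv L (w / g) * (f (t - w) - f (t + w)) := by
    intro w
    simp only [hZ, hJ, neg_div, hL.deriv_neg_arg, sub_neg_eq_add]
    ring
  have hZeven : ∀ w, Z (-w) = Z w := fun w => by simp only [hZ, neg_neg, add_comm]
  have hZi : Integrable Z := (hJi.add hJn).neg
  have hpos : ∀ w, 0 < w → w ≠ t → 0 ≤ Z w := by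
    intro w hw hwt
    rw [hZeq]
    rcases lt_or_ge w g with hwg | hwg
    · have h3 := hL.deriv_neg_of_pos (v := w / g) (by positivity) ((div_lt_one hg).2 hwg)
      have h4 := (hu.add_le_sub hI hf hfI htI ht hw hwg hwt).1
      exact mul_nonneg (by linarith) (by linarith)
    · rw [hL.deriv_eq_zero fun h3 => absurd ((div_lt_one hg).1 h3.2) (not_lt.2 hwg)]
      simp
  have hae : 0 ≤ᵐ[volume] Z := by
    have h3 : ∀ᵐ w : ℝ, w ≠ t := by simp [ae_iff]
    have h4 : ∀ᵐ w : ℝ, w ≠ -t := by simp [ae_iff]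
    filter_upwards [h3, h4] with w h3 h4
    rcases lt_trichotomy w 0 with h5 | h5 | h5
    · have := hpos (-w) (by linarith) fun h => h4 (by linarith)
      rwa [hZeven] at this
    · rw [h5, hZeq]; simp
    · exact hpos w h5 h3
  have hlt : 0 < ∫ w, Z w := by
    rw [integral_pos_iff_support_of_nonneg_ae hae hZi]
    -- For `w < t` the comparison of densities is strict, and for `w < g` the score does not vanish.
    have hsub : Ioo 0 (min t g) ⊆ Function.support Z := by
      intro w hw
      have hwt := hw.2.trans_le (min_le_left _ _)
      have hwg := hw.2.trans_le (min_le_right _ _)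
      have h3 := hL.deriv_neg_of_pos (v := w / g) (div_pos hw.1 hg) ((div_lt_one hg).2 hwg)
      have h4 := (hu.add_le_sub hI hf hfI htI ht hw.1 hwg hwt.ne).2 hwt
      rw [Function.mem_support, hZeq]
      exact (mul_pos (by linarith) (by linarith)).ne'
    refine lt_of_lt_of_le ?_ (measure_mono hsub)
    rw [Real.volume_Ioo, ENNReal.ofReal_pos]
    simpa using And.intro ht hg
  have h5 : ∫ w, Z w = -(2 * ∫ w, J w) := by
    rw [hZ, integral_neg, integral_add hJi hJn, h2]
    ring
  rw [h1]
  linarith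

theorem IsUnimodalOn.reflect (hu : IsUnimodalOn g f I) :
    IsUnimodalOn g (fun y => f (-y)) (Neg.neg ⁻¹' I) where
  zero_mem := by simpa using hu.zero_mem
  symm y hy := (hu.symm (-y) ⟨by linarith [hy.2], by linarith [hy.1]⟩)
  strictAnti y hy z hz hyz := hu.strictMono (a := -z) (b := -y)
    ⟨by simpa using hz.1, hz.2⟩ ⟨by simpa using hy.1, hy.2⟩ (by linarith)
  strictMono y hy z hz hyz := hu.strictAnti (a := -z) (b := -y)
    ⟨by simpa using hz.1, hz.2⟩ ⟨by simpa using hy.1, hy.2⟩ (by linarith)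

theorem ordConnected_neg_preimage (hI : I.OrdConnected) : (Neg.neg ⁻¹' I : Set ℝ).OrdConnected :=
  ⟨fun x hx y hy z hz => hI.out hy hx ⟨by simpa using hz.2, by simpa using hz.1⟩⟩

theorem IsUnimodalOn.integral_deriv_mul_pos (hu : IsUnimodalOn g f I) (hI : I.OrdConnected)
    (hf : ∀ y, 0 ≤ f y) (hfI : ∀ y, y ∉ I → f y = 0) (hint : Integrable f) (hg : 0 < g)
    {L : ℝ → ℝ} (hL : IsUnimodalScore L) {t : ℝ} (htI : t ∈ I) (ht : t < 0) :
    0 < ∫ u, deriv L ((t - u) / g) * f u := by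
  have h1 := hu.reflect.integral_deriv_mul_neg (ordConnected_neg_preimage hI) (fun y => hf _)
    (fun y hy => hfI _ hy) hint.comp_neg hg hL (t := -t) (by simpa using htI) (by linarith)
  have h2 : ∀ u, deriv L ((-t - u) / g) * f (-u) =
      (fun v => -(deriv L ((t - v) / g) * f v)) (-u) := by
    intro u
    simp only
    rw [show (-t - u) / g = -((t - -u) / g) by ring, hL.deriv_neg_arg]
    ring
  simp_rw [h2] at h1
  rw [integral_neg_eq_self (fun v => -(deriv L ((t - v) / g) * f v)) volume, integral_neg] at h1
  linarith

/-- The interval of a unimodal density contains negative numbers. -/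
theorem IsUnimodalOn.exists_neg_mem (hu : IsUnimodalOn g f I) (hI : I.OrdConnected)
    (hf : ∀ y, 0 ≤ f y) (hfI : ∀ y, y ∉ I → f y = 0) (hg : 0 < g) (hone : ∫ y, f y = 1) :
    ∃ a ∈ I, a < 0 := by
  by_contra hno
  push Not at hno
  have h1 : ∀ y, y < 0 → f y = 0 := fun y hy => hfI y fun hyI => absurd hy (not_lt.2 (hno y hyI))
  have h2 : ∀ y, 0 < y → f y = 0 := by
    intro y hy
    by_contra hne
    have hyI : y ∈ I := by
      by_contra h
      exact hne (hfI y h)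
    -- This `z` lies below both `y` and `g`: symmetry carries the zero at `-z` to `z`, whereas
    -- strict decrease requires `f z` to exceed `f y`.
    set z := min y g / 2 with hz
    have hm : 0 < min y g := lt_min hy hg
    have hz0 : 0 < z := by positivity
    have hzy : z < y := by linarith [min_le_left y g]
    have hzg : z < g := by linarith [min_le_right y g]
    have h3 := hu.strictAnti ⟨hz0, hI.out hu.zero_mem hyI ⟨hz0.le, hzy.le⟩⟩ ⟨hy, hyI⟩ hzy
    have h4 := hu.symm z ⟨by linarith, hzg.le⟩
    rw [h1 (-z) (by linarith)] at h4
    linarith [hf y]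
  have h3 : f =ᵐ[volume] fun _ => 0 := by
    have : ∀ᵐ y : ℝ, y ≠ 0 := by simp [ae_iff]
    filter_upwards [this] with y hy
    rcases lt_or_gt_of_ne hy with h | h
    · exact h1 y h
    · exact h2 y h
  rw [integral_congr_ae h3] at hone
  simp at hone

/-- A compact interval within `I`, around the mode, has almost full probability. -/
theorem IsUnimodalOn.exists_compact_interval {P : Measure ℝ} [IsProbabilityMeasure P]
    (hu : IsUnimodalOn g f I) (hd : HasDensityOn P f I) (hg : 0 < g) {κ : ℝ} (hκ : 0 < κ) :
    ∃ A > 0, ∃ B > 0, -A ∈ I ∧ B ∈ I ∧ P.real (Icc (-A) B)ᶜ ≤ κ := by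
  obtain ⟨a, haI, ha⟩ := hu.exists_neg_mem hd.interval hd.nonneg hd.support hg hd.integral_eq_one
  obtain ⟨b', hbI, hb'⟩ := hu.reflect.exists_neg_mem (ordConnected_neg_preimage hd.interval)
    (fun y => hd.nonneg _) (fun y hy => hd.support _ hy) hg
    (by rw [integral_neg_eq_self f volume]; exact hd.integral_eq_one)
  have hIm : MeasurableSet I := hd.interval.measurableSet
  have hPI : P.real Iᶜ = 0 := by
    rw [hd.measureReal_eq hIm.compl]
    exact setIntegral_eq_zero_of_forall_eq_zero fun y hy => hd.support y hy
  obtain ⟨C, hCI, hC, hlt⟩ := hIm.exists_isCompact_lt_add (μ := P) (measure_ne_top _ _)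
    (ENNReal.ofReal_pos.2 hκ).ne'
  have hPC : P.real Cᶜ ≤ κ := by
    have h1 : P.real I = 1 := by
      have := probReal_compl_eq_one_sub (μ := P) hIm
      linarith
    have h2 : P.real I ≤ P.real C + κ := by
      have h3 := ENNReal.toReal_mono (ENNReal.add_ne_top.2 ⟨measure_ne_top _ _, ENNReal.ofReal_ne_top⟩) hlt.le
      rw [ENNReal.toReal_add (measure_ne_top _ _) ENNReal.ofReal_ne_top, ENNReal.toReal_ofReal hκ.le] at h3
      exact h3
    rw [probReal_compl_eq_one_sub hC.measurableSet]
    linarith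
  -- The compact set from inner regularity is enlarged by a negative and a positive point of `I`, so
  -- that its extreme points lie in `I` on both sides of `0`.
  set C' := insert a (insert (-b') C) with hC'
  have hC'c : IsCompact C' := (hC.insert _).insert _
  have hC'I : C' ⊆ I := insert_subset haI (insert_subset hbI hCI)
  obtain ⟨l, hl⟩ := hC'c.exists_isLeast ⟨a, mem_insert _ _⟩
  obtain ⟨u, hu'⟩ := hC'c.exists_isGreatest ⟨a, mem_insert _ _⟩
  refine ⟨-l, by linarith [hl.2 (mem_insert a _)], u,
    by linarith [hu'.2 (mem_insert_of_mem a (mem_insert (-b') C))], by rw [neg_neg]; exact hC'I hl.1, hC'I hu'.1, ?_⟩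
  rw [neg_neg]
  refine (measureReal_mono (compl_subset_compl.2 fun y hy => ?_)).trans hPC
  have hy' : y ∈ C' := mem_insert_of_mem _ (mem_insert_of_mem _ hy)
  exact ⟨hl.2 hy', hu'.2 hy'⟩

end UnimodalDensity

end MSmoother

namespace MSmoother

/-! ### Robustness for a fixed scale parameter -/

theorem tendsto_mul_atTop_of_rate {h : ℕ → ℝ} (hpos : ∀ n, 0 < h n)
    (hrate : Tendsto (fun n : ℕ => (n : ℝ)⁻¹ * (h n)⁻¹) atTop (𝓝 0)) :
    Tendsto (fun n : ℕ => n * h n) atTop atTop := by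
  have h1 : Tendsto (fun n : ℕ => (n : ℝ)⁻¹ * (h n)⁻¹) atTop (𝓝[>] 0) := by
    refine tendsto_nhdsWithin_iff.2 ⟨hrate, ?_⟩
    filter_upwards [eventually_gt_atTop 0] with n hn
    have : (0 : ℝ) < n := by exact_mod_cast hn
    have := hpos n
    show (0 : ℝ) < _
    positivity
  refine (tendsto_inv_nhdsGT_zero.comp h1).congr fun n => ?_
  simp [mul_comm]

/-- If the score sum has the right signs, the M-smoother is close to `m₀`. -/
theorem LocalModel.mSmoother_mem_Icc {K m : Plane → ℝ} {n : ℕ} {h : ℝ} {x : Plane} {p₀ : Pixel n}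
    {ω α τ m₀ m₁ : ℝ} (M : LocalModel K m n h x p₀ ω α τ m₀ m₁) (hh : 0 < h) {L : ℝ → ℝ}
    (hL : Differentiable ℝ L) {g : ℝ} (hg : 0 < g) {A B δ : ℝ} (hδ : 0 < δ) (hτδ : τ ≤ δ)
    (hτ : 0 ≤ τ) (hA : δ ≤ A) (hB : δ ≤ B) {e : Pixel n → ℝ}
    (hneg : ∀ y ∈ Icc (m₀ + δ) (m₀ + B + τ),
      scoreSum K L n h g x (fun p => m (designPoint n p) + e p) y < 0)
    (hpos : ∀ y ∈ Icc (m₀ - A - τ) (m₀ - δ),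
      0 < scoreSum K L n h g x (fun p => m (designPoint n p) + e p) y)
    (he : e p₀ ∈ Ioc (-A) B) (he' : e p₀ ∉ Ioc (-(2 * δ)) (2 * δ)) :
    mSmoother K L n h g x (fun p => m (designPoint n p) + e p) ∈ Icc (m₀ - δ) (m₀ + δ) := by
  have hs := M.start fun p => m (designPoint n p) + e p
  have hc := abs_le.1 M.centre
  -- The level at the centre pixel is within `τ ≤ δ` of `m₀`. An error beyond `2 * δ` thus puts the
  -- start at distance at least `δ` from `m₀`, where the direction of the search is known.
  rcases le_or_gt (e p₀) (2 * δ) with h1 | h1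
  · have h2 : e p₀ ≤ -(2 * δ) := by
      by_contra hcon
      exact he' ⟨not_le.1 hcon, h1⟩
    refine mSmoother_mem_Icc_of_left hL (by linarith) (by rw [hs]; linarith) (fun y hy => ?_) ?_
    · rw [hs] at hy
      rw [deriv_densityEstimate_pos_iff hL M.size_pos hh hg]
      exact hpos y ⟨by linarith [hy.1, he.1], hy.2⟩
    · rw [deriv_densityEstimate_neg_iff hL M.size_pos hh hg]
      exact hneg _ ⟨le_rfl, by linarith⟩
  · refine mSmoother_mem_Icc_of_right hL (by linarith) (by rw [hs]; linarith) (fun y hy => ?_) ?_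
    · rw [hs] at hy
      rw [deriv_densityEstimate_neg_iff hL M.size_pos hh hg]
      exact hneg y ⟨hy.1, by linarith [hy.2, he.2]⟩
    · rw [deriv_densityEstimate_pos_iff hL M.size_pos hh hg]
      exact hpos _ ⟨by linarith, le_rfl⟩

theorem measureReal_Ioc_eq (P : Measure ℝ) [IsProbabilityMeasure P] {a b : ℝ} (hab : a ≤ b) :
    P.real (Ioc a b) = P.real (Iic b) - P.real (Iic a) := by
  rw [← measureReal_sdiff (Iic_subset_Iic.2 hab) measurableSet_Iic]
  congr 1
  ext z
  simp [and_comm]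

/-- Half-open intervals are differences of sets `Iic`, so only distribution functions are compared
and atoms of `Q` do no harm. The left tail and the middle cost `3 * κ` each, the right tail `2 * κ`.
-/
theorem measureReal_bad_le {P Q : Measure ℝ} [IsProbabilityMeasure P] [IsProbabilityMeasure Q]
    {κ A B δ : ℝ} (hδ : 0 ≤ δ) (hPQ : ∀ y, |Q.real (Iic y) - P.real (Iic y)| ≤ κ)
    (hcomp : P.real (Icc (-A) B)ᶜ ≤ κ) (hatom : P.real (Icc (-A) (-A)) ≤ κ)
    (hδP : P.real (Icc (-(2 * δ)) (2 * δ)) ≤ κ) :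
    Q.real (Ioc (-A) B \ Ioc (-(2 * δ)) (2 * δ))ᶜ ≤ 8 * κ := by
  have hsub : (Ioc (-A) B \ Ioc (-(2 * δ)) (2 * δ))ᶜ ⊆
      (Iic (-A) ∪ (Iic B)ᶜ) ∪ Ioc (-(2 * δ)) (2 * δ) := by
    intro y hy
    by_cases h1 : y ∈ Ioc (-(2 * δ)) (2 * δ)
    · exact Or.inr h1
    · left
      by_contra h2
      simp only [mem_union, mem_Iic, mem_compl_iff, not_or, not_le] at h2
      exact hy ⟨⟨h2.1, by simpa using h2.2⟩, h1⟩
  have h1 : Q.real (Iic (-A)) ≤ 3 * κ := by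
    have h2 : P.real (Iic (-A)) ≤ P.real (Icc (-A) B)ᶜ + P.real (Icc (-A) (-A)) := by
      refine (measureReal_mono ?_).trans (measureReal_union_le _ _)
      intro y hy
      rcases (show y ≤ -A from hy).lt_or_eq with h | h
      · exact Or.inl fun h' => absurd h'.1 (not_le.2 h)
      · exact Or.inr ⟨h.ge, h.le⟩
    linarith [(abs_le.1 (hPQ (-A))).2]
  have h2 : Q.real (Iic B)ᶜ ≤ 2 * κ := by
    have h3 : P.real (Iic B)ᶜ ≤ P.real (Icc (-A) B)ᶜ :=
      measureReal_mono (compl_subset_compl.2 fun y hy => hy.2)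
    rw [probReal_compl_eq_one_sub measurableSet_Iic] at h3 ⊢
    linarith [(abs_le.1 (hPQ B)).1]
  have h3 : Q.real (Ioc (-(2 * δ)) (2 * δ)) ≤ 3 * κ := by
    have h4 : P.real (Ioc (-(2 * δ)) (2 * δ)) ≤ κ :=
      (measureReal_mono Ioc_subset_Icc_self).trans hδP
    rw [measureReal_Ioc_eq _ (by linarith)] at h4 ⊢
    linarith [(abs_le.1 (hPQ (2 * δ))).2, (abs_le.1 (hPQ (-(2 * δ)))).1]
  calc _ ≤ _ := measureReal_mono hsub
    _ ≤ _ := measureReal_union_le _ _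
    _ ≤ Q.real (Iic (-A)) + Q.real (Iic B)ᶜ + Q.real (Ioc (-(2 * δ)) (2 * δ)) := by
        gcongr
        exact measureReal_union_le _ _
    _ ≤ _ := by linarith

theorem tendsto_exp_bound {h : ℕ → ℝ} (hnh : Tendsto (fun n : ℕ => n * h n) atTop atTop)
    {C V σ : ℝ} (hC : 0 < C) (hV : 0 < V) (hσ : 0 < σ) (c : ℝ) :
    Tendsto (fun n : ℕ => c * (2 * Real.exp (-(σ ^ 2 / (16 * (C / (n * h n) ^ 2) * V)))))
      atTop (𝓝 0) := by
  have h1 : Tendsto (fun n : ℕ => σ ^ 2 / (16 * C * V) * (n * h n) ^ 2) atTop atTop :=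
    ((tendsto_pow_atTop two_ne_zero).comp hnh).const_mul_atTop (by positivity)
  have h2 := ((Real.tendsto_exp_neg_atTop_nhds_zero.comp h1).const_mul 2).const_mul c
  simp only [mul_zero] at h2
  refine h2.congr' ?_
  filter_upwards [hnh.eventually_gt_atTop 0] with n hn
  simp only [Function.comp]
  congr 4
  generalize (n : ℝ) * h n = z at hn
  field_simp

/-- The M-smoother with a fixed scale parameter is robust, if the contributions of different sides
of the boundary do not interfere. -/
theorem robustForLargeSamples_of_unimodal {K : Plane → ℝ} {L : ℝ → ℝ} {μ : Plane → ℝ} {d : ℝ}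
    {D : Set Plane} {h : ℕ → ℝ} {g : ℝ} (hfs : FixedScale K L μ d D h g) {P : Measure ℝ}
    [IsProbabilityMeasure P] {f : ℝ → ℝ} {I : Set ℝ} (hd : HasDensityOn P f I)
    (hu : IsUnimodalOn g f I) {x₀ : Plane} (hx₀ : x₀ ∈ openUnitSquare)
    (hsep : x₀ ∈ frontier D → ∀ t ∈ I, scoreMean L g P (t + d) = 0 ∧ scoreMean L g P (t - d) = 0) :
    RobustForLargeSamples (regression μ d D) (fun n => mSmoother K L n (h n) g x₀) P := by
  intro εs hεs
  have hL := hfs.score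
  have hg := hfs.g_pos
  have hK := hfs.kernel
  have hcont : Continuous (deriv L) := hL.contDiff_deriv.continuous
  have hmeas : ∀ n, Measurable (mSmoother K L n (h n) g x₀) := fun n =>
    measurable_mSmoother K hL.differentiable hcont n (h n) g x₀
  have hnh := tendsto_mul_atTop_of_rate hfs.h_pos hfs.rate_h
  obtain ⟨B₀, hB₀0, hB₀⟩ : ∃ B₀ > 0, ∀ v, |deriv L v| ≤ B₀ := by
    obtain ⟨B, hB⟩ := hL.hasCompactSupport_deriv.exists_bound_of_continuous hcont
    exact ⟨max B 1, by positivity, fun v => (hB v).trans (le_max_left _ _)⟩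
  obtain ⟨C₀, hC₀0, hC₀⟩ : ∃ C₀ > 0, ∀ v w, |deriv L v - deriv L w| ≤ C₀ * |v - w| := by
    obtain ⟨C, hC⟩ := hL.lipschitz_deriv
    refine ⟨C + 1, by positivity, fun v w => ?_⟩
    have := hC.dist_le_mul v w
    rw [Real.dist_eq, Real.dist_eq] at this
    linarith [abs_nonneg (v - w)]
  have hlip : ∀ (Q : Measure ℝ) [IsProbabilityMeasure Q] (s t : ℝ),
      |scoreMean L g Q s - scoreMean L g Q t| ≤ C₀ / g * |s - t| := fun Q _ s t =>
    abs_scoreMean_sub_le hcont hB₀ hC₀ hg Q s t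
  set Λ := C₀ / g with hΛ
  have hΛ0 : 0 < Λ := by positivity
  obtain ⟨α, hα, Cω, hCω, hmodel⟩ :=
    exists_localModel hfs.image hK hfs.h_pos hfs.h_tendsto hnh hx₀
  -- The bad events have total probability at most `9 * κ`: one share for the deviations and eight
  -- for the error at the centre.
  set κ := εs / 16 with hκ
  have hκ0 : 0 < κ := by positivity
  obtain ⟨A, hA, B, hB, hAI, hBI, hcomp⟩ := hu.exists_compact_interval hd hg hκ0
  obtain ⟨δ₁, hδ₁, hshort⟩ := hd.exists_measureReal_Icc_le hκ0
  -- `δ₁ / 4` makes errors in `[-2δ, 2δ]` improbable, and `εs / 2` turns concentration within `δ`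
  -- into Lévy distance `εs`.
  set δ := min (min A B) (min (δ₁ / 4) (εs / 2)) with hδ
  have hδ0 : 0 < δ := by positivity
  have hδA : δ ≤ A := (min_le_left _ _).trans (min_le_left _ _)
  have hδB : δ ≤ B := (min_le_left _ _).trans (min_le_right _ _)
  have hδ1 : δ ≤ δ₁ / 4 := (min_le_right _ _).trans (min_le_left _ _)
  have hδε : δ ≤ εs / 2 := (min_le_right _ _).trans (min_le_right _ _)
  have hPcont : Continuous (scoreMean L g P) := by
    have : LipschitzWith (Real.toNNReal Λ) (scoreMean L g P) :=
      LipschitzWith.of_dist_le_mul fun s t => by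
        rw [Real.dist_eq, Real.dist_eq, Real.coe_toNNReal _ hΛ0.le]
        exact hlip P s t
    exact this.continuous
  have hI0 : ∀ t ∈ Icc (-A) B, t ∈ I := fun t ht => hd.interval.out hAI hBI ht
  have hsgn1 : ∀ t ∈ Icc δ B, scoreMean L g P t < 0 := by
    intro t ht
    rw [scoreMean, hd.integral_eq]
    exact hu.integral_deriv_mul_neg hd.interval hd.nonneg hd.support hd.integrable hg hL
      (hI0 t ⟨by linarith [ht.1], ht.2⟩) (hδ0.trans_le ht.1)
  have hsgn2 : ∀ t ∈ Icc (-A) (-δ), 0 < scoreMean L g P t := by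
    intro t ht
    rw [scoreMean, hd.integral_eq]
    exact hu.integral_deriv_mul_pos hd.interval hd.nonneg hd.support hd.integrable hg hL
      (hI0 t ⟨ht.1, by linarith [ht.2]⟩) (by linarith [ht.2])
  obtain ⟨η, hη, hη1, hη2⟩ : ∃ η > 0, (∀ t ∈ Icc δ B, scoreMean L g P t ≤ -η) ∧
      ∀ t ∈ Icc (-A) (-δ), η ≤ scoreMean L g P t := by
    obtain ⟨t₁, ht₁, hmax⟩ := isCompact_Icc.exists_isMaxOn (nonempty_Icc.2 hδB)
      hPcont.continuousOn (s := Icc δ B)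
    obtain ⟨t₂, ht₂, hmin⟩ := isCompact_Icc.exists_isMinOn (nonempty_Icc.2 (neg_le_neg hδA))
      hPcont.continuousOn (s := Icc (-A) (-δ))
    refine ⟨min (-scoreMean L g P t₁) (scoreMean L g P t₂),
      lt_min (by linarith [hsgn1 t₁ ht₁]) (hsgn2 t₂ ht₂), fun t ht => ?_, fun t ht => ?_⟩
    · have h1 : scoreMean L g P t ≤ scoreMean L g P t₁ := hmax ht
      linarith [min_le_left (-scoreMean L g P t₁) (scoreMean L g P t₂)]
    · have h1 : scoreMean L g P t₂ ≤ scoreMean L g P t := hmin ht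
      linarith [min_le_right (-scoreMean L g P t₁) (scoreMean L g P t₂)]
  -- The main term has size `α * η`. Against it stand `α * η / 8` for the variation of the levels,
  -- `α * η / 8` for the replacement of `Q` by `P` and `α * η / 4` for random deviations.
  set τ := min (min δ 1) (α * η / (16 * Λ)) with hτ
  have hτ0 : 0 < τ := by positivity
  have hτδ : τ ≤ δ := (min_le_left _ _).trans (min_le_left _ _)
  have hτ1 : τ ≤ 1 := (min_le_left _ _).trans (min_le_right _ _)
  have hΛτ : 2 * Λ * τ ≤ α * η / 8 := by
    calc 2 * Λ * τ ≤ 2 * Λ * (α * η / (16 * Λ)) := by gcongr; exact min_le_right _ _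
      _ = α * η / 8 := by field_simp; norm_num
  set J := ∫ v, |deriv (deriv L) v| with hJ
  have hJ0 : 0 ≤ J := integral_nonneg fun v => abs_nonneg _
  set κ' := min κ (α * η / (8 * (J + 1))) with hκ'
  have hκ'0 : 0 < κ' := by positivity
  have hκ'J : κ' * J ≤ α * η / 8 := by
    calc κ' * J ≤ α * η / (8 * (J + 1)) * (J + 1) := by
          gcongr
          · exact min_le_right _ _
          · linarith
      _ = α * η / 8 := by field_simp
  set σ := α * η / 4 with hσ
  have hσ0 : 0 < σ := by positivity
  set V := B₀ ^ 2 + σ * B₀ with hV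
  have hV0 : 0 < V := by positivity
  obtain ⟨ε, hε, hLevy⟩ := hd.exists_abs_measureReal_Iic_sub_le hκ'0
  have hexp := (tendsto_exp_bound hnh hCω hV0 hσ0 ((A + B + 2) * (4 * Λ / σ) + 1)).eventually
    (gt_mem_nhds hκ0)
  obtain ⟨N, hN⟩ := eventually_atTop.1 ((hmodel τ hτ0).and (hexp.and (hnh.eventually_gt_atTop 0)))
  refine ⟨ε, hε, N, fun Q hQ hPQ n hn => ?_⟩
  -- The level `m₀` depends on `n` but not on the error distribution, so both laws concentrate
  -- around the same point.
  obtain ⟨⟨p₀, m₀, m₁, hm, M, hnofr⟩, hexpn, hnhn⟩ := hN n hn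
  have key : ∀ Q' : Measure ℝ, IsProbabilityMeasure Q' →
      (∀ y, |Q'.real (Iic y) - P.real (Iic y)| ≤ κ') →
      (estimatorLaw (regression μ d D) (mSmoother K L n (h n) g x₀) Q').real
        (Icc (m₀ - δ) (m₀ + δ))ᶜ ≤ 9 * κ := by
    intro Q' hQ' hQP
    set E := {e : Pixel n → ℝ | ∃ y ∈ Icc (m₀ - A - 1) (m₀ + B + 1), σ ≤
      |scoreSum K L n (h n) g x₀ (fun p => regression μ d D (designPoint n p) + e p) y /
          (∑ q, weight K n (h n) x₀ q) -
        ∑ p, weight K n (h n) x₀ p / (∑ q, weight K n (h n) x₀ q) *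
          scoreMean L g Q' (y - regression μ d D (designPoint n p))|} with hE
    have hEle : (Measure.pi fun _ : Pixel n => Q').real E ≤ κ := by
      have h1 := M.measureReal_deviation_le hK (ω := Cω / (n * h n) ^ 2) (by positivity) hcont hC₀0
        hB₀ hC₀ hg hV0 hσ0 (by rw [hV]; nlinarith [sq_nonneg B₀]) Q' (fun y => by
          have h2 : ∫ u, deriv L ((y - u) / g) ^ 2 ∂Q' ≤ ∫ _u, B₀ ^ 2 ∂Q' := by
            refine integral_mono_of_nonneg (Eventually.of_forall fun u => sq_nonneg _)
              (integrable_const _) (Eventually.of_forall fun u => ?_)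
            simp only
            rw [← sq_abs]
            exact pow_le_pow_left₀ (abs_nonneg _) (hB₀ _) 2
          simp only [integral_const, probReal_univ, one_smul] at h2
          rw [hV]
          nlinarith [mul_pos hσ0 hB₀0])
        (lo := m₀ - A - 1) (hi := m₀ + B + 1) (by linarith)
      refine h1.trans (le_of_eq_of_le ?_ hexpn.le)
      rw [show m₀ + B + 1 - (m₀ - A - 1) = A + B + 2 by ring]
    have hmean : ∀ y, |∑ p, weight K n (h n) x₀ p / (∑ q, weight K n (h n) x₀ q) *
          scoreMean L g Q' (y - regression μ d D (designPoint n p)) -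
        ∑ p, weight K n (h n) x₀ p / (∑ q, weight K n (h n) x₀ q) *
          scoreMean L g P (y - regression μ d D (designPoint n p))| ≤ α * η / 8 := by
      intro y
      rw [← Finset.sum_sub_distrib]
      calc _ ≤ ∑ p, |weight K n (h n) x₀ p / (∑ q, weight K n (h n) x₀ q) *
          scoreMean L g Q' (y - regression μ d D (designPoint n p)) -
            weight K n (h n) x₀ p / (∑ q, weight K n (h n) x₀ q) *
          scoreMean L g P (y - regression μ d D (designPoint n p))| := Finset.abs_sum_le_sum_abs _ _
        _ ≤ ∑ p, weight K n (h n) x₀ p / (∑ q, weight K n (h n) x₀ q) * (α * η / 8) := by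
            refine Finset.sum_le_sum fun p _ => ?_
            rw [← mul_sub, abs_mul, abs_of_nonneg (M.normalized_nonneg hK p)]
            refine mul_le_mul_of_nonneg_left ?_ (M.normalized_nonneg hK p)
            exact (abs_integral_sub_integral_le hL.contDiff_deriv hL.hasCompactSupport_deriv
              hQP hg _).trans hκ'J
        _ = α * η / 8 := by rw [← Finset.sum_mul, M.sum_normalized, one_mul]
    have hother : ∀ t ∈ Icc (-A) B,
        (∀ p, weight K n (h n) x₀ p ≠ 0 → |regression μ d D (designPoint n p) - m₀| ≤ τ) ∨
          scoreMean L g P (t + m₀ - m₁) = 0 := by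
      intro t ht
      by_cases hfr : x₀ ∈ frontier D
      · right
        obtain ⟨h1, h2⟩ := hsep hfr t (hI0 t ht)
        rcases hm with ⟨rfl, rfl⟩ | ⟨rfl, rfl⟩
        · rwa [show t + μ x₀ - (μ x₀ + d) = t - d by ring]
        · rwa [show t + (μ x₀ + d) - μ x₀ = t + d by ring]
      · exact Or.inl (hnofr hfr)
    rw [estimatorLaw_real (hmeas n) measurableSet_Icc.compl]
    have hsub : {e : Pixel n → ℝ | (mSmoother K L n (h n) g x₀ fun p =>
        regression μ d D (designPoint n p) + e p) ∈ (Icc (m₀ - δ) (m₀ + δ))ᶜ} ⊆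
        E ∪ {e | e p₀ ∈ (Ioc (-A) B \ Ioc (-(2 * δ)) (2 * δ))ᶜ} := by
      intro e he
      by_contra hcon
      simp only [mem_union, not_or, mem_ofPred_eq, mem_compl_iff, not_not] at hcon
      obtain ⟨heE, heg⟩ := hcon
      have hdev : ∀ y ∈ Icc (m₀ - A - 1) (m₀ + B + 1),
          |scoreSum K L n (h n) g x₀ (fun p => regression μ d D (designPoint n p) + e p) y /
            (∑ q, weight K n (h n) x₀ q) -
          ∑ p, weight K n (h n) x₀ p / (∑ q, weight K n (h n) x₀ q) *
            scoreMean L g Q' (y - regression μ d D (designPoint n p))| < σ := by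
        intro y hy
        by_contra hge
        exact heE ⟨y, hy, not_lt.1 hge⟩
      refine he (M.mSmoother_mem_Icc (hfs.h_pos n) hL.differentiable hg hδ0 hτδ hτ0.le hδA hδB
        (fun y hy => ?_) (fun y hy => ?_) heg.1 heg.2)
      · rw [M.scoreSum_neg_iff]
        -- The sign of the mean score is known only inside `I`, while `y - m₀` can exceed `B` by up
        -- to `τ`; hence the truncation.
        have htI : min (y - m₀) B ∈ Icc δ B := ⟨le_min (by linarith [hy.1]) hδB, min_le_right _ _⟩
        have hyt : |y - m₀ - min (y - m₀) B| ≤ τ := by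
          rcases le_total (y - m₀) B with h1 | h1
          · rw [min_eq_left h1, sub_self, abs_zero]; exact hτ0.le
          · rw [min_eq_right h1, abs_of_nonneg (by linarith)]; linarith [hy.2]
        have h1 := M.weighted_sum_le hK hΛ0.le (hlip P) hyt hη.le le_rfl (hη1 _ htI)
          ((hother _ ⟨by linarith [htI.1], htI.2⟩).imp_right le_of_eq)
        have h2 := abs_lt.1 (hdev y ⟨by linarith [hy.1], by linarith [hy.2]⟩)
        have h3 := abs_le.1 (hmean y)
        have hαη : 0 < α * η := by positivity
        linarith [h2.2, h3.2]
      · rw [M.scoreSum_pos_iff]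
        have htI : max (y - m₀) (-A) ∈ Icc (-A) (-δ) :=
          ⟨le_max_right _ _, max_le (by linarith [hy.2]) (by linarith)⟩
        have hyt : |y - m₀ - max (y - m₀) (-A)| ≤ τ := by
          rcases le_total (-A) (y - m₀) with h1 | h1
          · rw [max_eq_left h1, sub_self, abs_zero]; exact hτ0.le
          · rw [max_eq_right h1, abs_of_nonpos (by linarith)]; linarith [hy.1]
        have h1 := M.le_weighted_sum hK hΛ0.le (hlip P) hyt hη.le le_rfl (hη2 _ htI)
          ((hother _ ⟨htI.1, by linarith [htI.2]⟩).imp_right fun h' => by rw [h', neg_zero])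
        have h2 := abs_lt.1 (hdev y ⟨by linarith [hy.1], by linarith [hy.2]⟩)
        have h3 := abs_le.1 (hmean y)
        have hαη : 0 < α * η := by positivity
        linarith [h2.1, h3.1]
    have hbad : (Measure.pi fun _ : Pixel n => Q').real
        {e | e p₀ ∈ (Ioc (-A) B \ Ioc (-(2 * δ)) (2 * δ))ᶜ} ≤ 8 * κ := by
      rw [pi_real_eval p₀ (measurableSet_Ioc.diff measurableSet_Ioc).compl]
      exact measureReal_bad_le hδ0.le (fun y => (hQP y).trans (min_le_left _ _)) hcomp
        (hshort _ _ (by linarith)) (hshort _ _ (by linarith))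
    calc _ ≤ _ := measureReal_mono hsub
      _ ≤ _ := measureReal_union_le _ _
      _ ≤ 9 * κ := by linarith
  have hP1 := isProbabilityMeasure_estimatorLaw (m := regression μ d D) (Q := P) (hmeas n)
  have hQ1 := isProbabilityMeasure_estimatorLaw (m := regression μ d D) (Q := Q) (hmeas n)
  exact levyDist_le_of_concentrated hεs.le (by linarith) (κ := 9 * κ) (by linarith)
    (key P inferInstance fun y => by rw [sub_self, abs_zero]; exact hκ'0.le)
    (key Q hQ (hLevy Q hQ hPQ))

theorem robustForLargeSamples_of_notMem_frontier {K : Plane → ℝ} {L : ℝ → ℝ} {μ : Plane → ℝ}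
    {d : ℝ} {D : Set Plane} {h : ℕ → ℝ} {g : ℝ} (hfs : FixedScale K L μ d D h g) {P : Measure ℝ}
    [IsProbabilityMeasure P] (hP : UnimodalError g P) {x₀ : Plane} (hx₀ : x₀ ∈ openUnitSquare)
    (hfr : x₀ ∉ frontier D) :
    RobustForLargeSamples (regression μ d D) (fun n => mSmoother K L n (h n) g x₀) P := by
  obtain ⟨f, I, hd, hu⟩ := hP
  exact robustForLargeSamples_of_unimodal hfs hd hu hx₀ fun h' => absurd h' hfr

/-- Observations from the other side are shifted by `d`. At a point `t + d` or `t - d` with `t` in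
`(-a, a)`, the distance to every possible error exceeds `g`, so the score vanishes. -/
theorem robustForLargeSamples_of_narrow {K : Plane → ℝ} {L : ℝ → ℝ} {μ : Plane → ℝ}
    {d : ℝ} {D : Set Plane} {h : ℕ → ℝ} {g : ℝ} (hfs : FixedScale K L μ d D h g) {P : Measure ℝ}
    [IsProbabilityMeasure P] (hP : NarrowUnimodalError g d P) {x₀ : Plane}
    (hx₀ : x₀ ∈ openUnitSquare) :
    RobustForLargeSamples (regression μ d D) (fun n => mSmoother K L n (h n) g x₀) P := by
  obtain ⟨f, I, a, hd, hu, hfa, had⟩ := hP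
  have hg := hfs.g_pos
  have ha : 0 < a := by
    by_contra ha
    have h0 : f = fun _ => 0 := funext fun y => hfa y fun hy => ha (by linarith [hy.1, hy.2])
    have := hd.integral_eq_one
    rw [h0] at this
    simp at this
  -- The separation is required at every point of the support interval, which is therefore cut down
  -- to `(-a, a)`.
  have hd' : HasDensityOn P f (I ∩ Ioo (-a) a) :=
    ⟨hd.measurable, hd.nonneg, hd.eq_withDensity, hd.interval.inter ordConnected_Ioo, fun y hy => by
      by_cases hyI : y ∈ I
      · exact hfa y fun h' => hy ⟨hyI, h'⟩
      · exact hd.support y hyI⟩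
  have hu' : IsUnimodalOn g f (I ∩ Ioo (-a) a) :=
    ⟨⟨hu.zero_mem, by linarith, ha⟩, hu.symm,
      hu.strictAnti.mono (inter_subset_inter_right _ inter_subset_left),
      hu.strictMono.mono (inter_subset_inter_right _ inter_subset_left)⟩
  refine robustForLargeSamples_of_unimodal hfs hd' hu' hx₀ fun _ t ht => ?_
  have hzero : ∀ s : ℝ, d - a ≤ |s| → scoreMean L g P s = 0 := by
    intro s hs
    rw [scoreMean, hd.integral_eq]
    refine integral_eq_zero_of_ae (Eventually.of_forall fun u => ?_)
    by_cases hu : u ∈ Ioo (-a) a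
    · have h1 : deriv L ((s - u) / g) = 0 := by
        refine hfs.score.deriv_eq_zero fun h2 => ?_
        have h3 := h2.1
        have h4 := h2.2
        rw [lt_div_iff₀ hg] at h3
        rw [div_lt_iff₀ hg] at h4
        have h5 : |s| < a + g := abs_lt.2 ⟨by linarith [hu.1], by linarith [hu.2]⟩
        linarith
      simp [h1]
    · simp [hfa u hu]
  have h1 := ht.2.1
  have h2 := ht.2.2
  exact ⟨hzero _ ((by linarith : d - a ≤ t + d).trans (le_abs_self _)),
    hzero _ ((by linarith : d - a ≤ -(t - d)).trans (neg_le_abs _))⟩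

end MSmoother

namespace MSmoother

/-! ### The score for vanishing scale parameters -/

/-- An integrable Lipschitz function is bounded. -/
theorem exists_bound_of_lipschitz_of_integrable {ψ : ℝ → ℝ} (hi : Integrable ψ) {C : ℝ≥0}
    (hC : LipschitzWith C ψ) : ∃ B > 0, ∀ v, |ψ v| ≤ B := by
  refine ⟨(∫ w, |ψ w|) + C + 1, ?_, fun v => ?_⟩
  · have : 0 ≤ ∫ w, |ψ w| := integral_nonneg fun _ => abs_nonneg _
    positivity
  -- Averaging this over an interval of length one bounds the value at `v` by the integral of `|ψ|`
  -- plus the Lipschitz constant.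
  have h1 : ∀ w ∈ Icc v (v + 1), |ψ v| ≤ |ψ w| + C := by
    intro w hw
    have h2 := hC.dist_le_mul v w
    rw [Real.dist_eq, Real.dist_eq] at h2
    have h3 : |v - w| ≤ 1 := abs_le.2 ⟨by linarith [hw.2], by linarith [hw.1]⟩
    have h4 : (C : ℝ) * |v - w| ≤ C := mul_le_of_le_one_right C.2 h3
    linarith [abs_sub_abs_le_abs_sub (ψ v) (ψ w)]
  have h2 : ∫ _w in Icc v (v + 1), |ψ v| ≤ ∫ w in Icc v (v + 1), (|ψ w| + C) := by
    refine setIntegral_mono_on ?_ ?_ measurableSet_Icc h1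
    · exact integrableOn_const (by simp)
    · exact hi.abs.integrableOn.add (integrableOn_const (by simp))
  rw [integral_add hi.abs.integrableOn (integrableOn_const (by simp))] at h2
  simp only [setIntegral_const, Real.volume_real_Icc, add_sub_cancel_left] at h2
  simp only [zero_le_one, sup_of_le_left, one_smul] at h2
  have h3 : ∫ w in Icc v (v + 1), |ψ w| ≤ ∫ w, |ψ w| :=
    setIntegral_le_integral hi.abs (Eventually.of_forall fun _ => abs_nonneg _)
  linarith

namespace IsScore

variable {L : ℝ → ℝ}

theorem continuous_deriv (hL : IsScore L) : Continuous (deriv L) := by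
  obtain ⟨C, hC⟩ := hL.lipschitz_deriv
  exact hC.continuous

theorem integrable (hL : IsScore L) : Integrable L := by
  by_contra h
  have := hL.integral_eq
  rw [integral_undef h] at this
  exact zero_ne_one this

theorem integrable_deriv (hL : IsScore L) : Integrable (deriv L) := by
  have h1 : IntegrableOn (deriv L) (Icc (-1) 1) := hL.continuous_deriv.continuousOn.integrableOn_Icc
  -- Outside `[-1, 1]` the factor `|v|` is at least one, so the weighted integrability suffices.
  have h2 : IntegrableOn (deriv L) (Icc (-1) 1)ᶜ := by
    refine Integrable.mono' hL.integrable_deriv_mul_abs.norm.integrableOn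
      hL.continuous_deriv.aestronglyMeasurable ?_
    filter_upwards [ae_restrict_mem measurableSet_Icc.compl] with v hv
    rw [norm_mul]
    refine le_mul_of_one_le_right (norm_nonneg _) ?_
    rw [Real.norm_eq_abs, abs_abs]
    by_contra hlt
    exact hv (abs_le.1 (not_le.1 hlt).le)
  rw [← integrableOn_univ, ← union_compl_self (Icc (-1 : ℝ) 1)]
  exact h1.union h2

theorem exists_bound_deriv (hL : IsScore L) : ∃ B > 0, ∀ v, |deriv L v| ≤ B := by
  obtain ⟨C, hC⟩ := hL.lipschitz_deriv
  exact exists_bound_of_lipschitz_of_integrable hL.integrable_deriv hC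

theorem integrable_deriv_sq (hL : IsScore L) : Integrable fun v => deriv L v ^ 2 := by
  obtain ⟨B, _, hB⟩ := hL.exists_bound_deriv
  simp_rw [sq]
  exact hL.integrable_deriv.bdd_mul hL.continuous_deriv.aestronglyMeasurable
    (Eventually.of_forall hB)

end IsScore

/-- `Q` has a bounded differentiable density `q` with Lipschitz continuous bounded derivative. -/
structure HasSmoothDensity (Q : Measure ℝ) (q : ℝ → ℝ) : Prop where
  density : ∃ I, HasDensityOn Q q I
  differentiable : Differentiable ℝ q
  bounded : ∃ B, ∀ y, q y ≤ B
  bounded_deriv : ∃ B, ∀ y, |deriv q y| ≤ B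
  lipschitz_deriv : ∃ C : ℝ≥0, LipschitzWith C (deriv q)

namespace HasSmoothDensity

variable {Q : Measure ℝ} {q : ℝ → ℝ} {L : ℝ → ℝ}

theorem exists_lipschitz (hq : HasSmoothDensity Q q) :
    ∃ C > 0, ∀ s t, |deriv q s - deriv q t| ≤ C * |s - t| := by
  obtain ⟨C, hC⟩ := hq.lipschitz_deriv
  refine ⟨C + 1, by positivity, fun s t => ?_⟩
  have := hC.dist_le_mul s t
  rw [Real.dist_eq, Real.dist_eq] at this
  linarith [abs_nonneg (s - t)]

theorem continuous_deriv (hq : HasSmoothDensity Q q) : Continuous (deriv q) := by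
  obtain ⟨C, hC⟩ := hq.lipschitz_deriv
  exact hC.continuous

/-- Integration by parts moves the derivative from the score to the density. -/
theorem scoreMean_eq (hq : HasSmoothDensity Q q) (hL : IsScore L) {g : ℝ} (hg : 0 < g) (t : ℝ) :
    scoreMean L g Q t = g ^ 2 * ∫ v, deriv q (t - g * v) * L v := by
  obtain ⟨I, hd⟩ := hq.density
  obtain ⟨B, hB⟩ := hq.bounded
  obtain ⟨B', hB'⟩ := hq.bounded_deriv
  have hqc := hq.differentiable.continuous
  have hqc' := hq.continuous_deriv
  have hu : ∀ v, HasDerivAt (fun v => q (t - g * v)) (-(g * deriv q (t - g * v))) v := by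
    intro v
    have h1 : HasDerivAt (fun v => t - g * v) (-g) v := by
      simpa using ((hasDerivAt_id v).const_mul g).const_sub t
    have h2 := (hq.differentiable (t - g * v)).hasDerivAt.comp v h1
    exact h2.congr_deriv (by ring)
  have hb : ∀ v, ‖q (t - g * v)‖ ≤ B := fun v => by
    rw [Real.norm_of_nonneg (hd.nonneg _)]; exact hB _
  have hm : AEStronglyMeasurable (fun v => q (t - g * v)) volume :=
    (hqc.comp (by fun_prop)).aestronglyMeasurable
  have hm' : AEStronglyMeasurable (fun v => -(g * deriv q (t - g * v))) volume :=
    ((hqc'.comp (by fun_prop : Continuous fun v => t - g * v)).const_mul g).neg.aestronglyMeasurable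
  have hb' : ∀ v, ‖-(g * deriv q (t - g * v))‖ ≤ g * B' := fun v => by
    rw [norm_neg, norm_mul, Real.norm_of_nonneg hg.le]
    exact mul_le_mul_of_nonneg_left (hB' _) hg.le
  have hparts := integral_mul_deriv_eq_deriv_mul_of_integrable (u := fun v => q (t - g * v))
    (u' := fun v => -(g * deriv q (t - g * v))) (v := L) (v' := deriv L) (fun v _ => hu v)
    (fun v _ => (hL.differentiable v).hasDerivAt)
    (hL.integrable_deriv.bdd_mul hm (Eventually.of_forall hb))
    (hL.integrable.bdd_mul hm' (Eventually.of_forall hb'))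
    (hL.integrable.bdd_mul hm (Eventually.of_forall hb))
  rw [scoreMean, hd.integral_eq]
  set G : ℝ → ℝ := fun v => q (t - g * v) * deriv L v with hG
  -- The substitution `u = t - g * v` gives one factor `g`, the integration by parts another.
  have h1 : ∀ u, deriv L ((t - u) / g) * q u = (fun w => G (w / g)) (t - u) := by
    intro u
    simp only [hG]
    rw [mul_div_cancel₀ _ hg.ne', sub_sub_cancel, mul_comm]
  simp_rw [h1]
  rw [integral_sub_left_eq_self (fun w => G (w / g)) volume t, Measure.integral_comp_div G,
    abs_of_pos hg, smul_eq_mul, hparts, ← integral_neg]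
  simp only [neg_mul, neg_neg, mul_assoc]
  rw [integral_const_mul]
  ring

/-- After integration by parts the scaled mean score averages `deriv q` with the probability weight
`L`; the Lipschitz bound and the first absolute moment of `L` give an error of order `g`. -/
theorem abs_scoreMean_div_sub_le (hq : HasSmoothDensity Q q) (hL : IsScore L) {C : ℝ}
    (hC : ∀ s t, |deriv q s - deriv q t| ≤ C * |s - t|) {g : ℝ} (hg : 0 < g) (t : ℝ) :
    |scoreMean L g Q t / g ^ 2 - deriv q t| ≤ C * (∫ v, L v * |v|) * g := by
  obtain ⟨B', hB'⟩ := hq.bounded_deriv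
  have hqc' := hq.continuous_deriv
  have hint : Integrable fun v => deriv q (t - g * v) * L v :=
    hL.integrable.bdd_mul (hqc'.comp (by fun_prop)).aestronglyMeasurable
      (Eventually.of_forall fun v => hB' _)
  have h1 : deriv q t = ∫ v, deriv q t * L v := by
    rw [integral_const_mul, hL.integral_eq, mul_one]
  rw [hq.scoreMean_eq hL hg, mul_div_cancel_left₀ _ (by positivity)]
  have h0 : (∫ v, deriv q (t - g * v) * L v) - deriv q t =
      ∫ v, (deriv q (t - g * v) * L v - deriv q t * L v) := by
    rw [integral_sub hint (hL.integrable.const_mul _), ← h1]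
  rw [h0]
  have h2 : C * (∫ v, L v * |v|) * g = ∫ v, C * g * (L v * |v|) := by
    rw [integral_const_mul]; ring
  rw [h2, ← Real.norm_eq_abs]
  refine norm_integral_le_of_norm_le (hL.integrable_mul_abs.const_mul _)
    (Eventually.of_forall fun v => ?_)
  rw [← sub_mul, norm_mul, Real.norm_eq_abs, Real.norm_of_nonneg (hL.nonneg v)]
  have h3 := hC (t - g * v) t
  rw [show t - g * v - t = -(g * v) by ring, abs_neg, abs_mul, abs_of_pos hg] at h3
  calc |deriv q (t - g * v) - deriv q t| * L v ≤ C * (g * |v|) * L v :=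
        mul_le_mul_of_nonneg_right h3 (hL.nonneg v)
    _ = _ := by ring

/-- The density is bounded, so rescaling gives a second moment of order `g`. This gain over the
trivial bound is what lets Bernstein's inequality resolve deviations of order `g ^ 2`. -/
theorem exists_second_moment_le (hq : HasSmoothDensity Q q) (hL : IsScore L) :
    ∃ V > 0, ∀ g > 0, ∀ y, ∫ u, deriv L ((y - u) / g) ^ 2 ∂Q ≤ V * g := by
  obtain ⟨I, hd⟩ := hq.density
  obtain ⟨B, hB⟩ := hq.bounded
  set S := ∫ v, deriv L v ^ 2 with hS
  have hS0 : 0 ≤ S := integral_nonneg fun v => sq_nonneg _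
  have hB0 : 0 ≤ B := (hd.nonneg 0).trans (hB 0)
  refine ⟨B * S + 1, by positivity, fun g hg y => ?_⟩
  rw [hd.integral_eq]
  have h1 : Integrable fun u => deriv L ((y - u) / g) ^ 2 := by
    have := (hL.integrable_deriv_sq.comp_div hg.ne').comp_sub_left y
    exact this
  have h2 : ∫ u, deriv L ((y - u) / g) ^ 2 = g * S := by
    rw [integral_sub_left_eq_self (fun w => deriv L (w / g) ^ 2) volume y,
      Measure.integral_comp_div (fun v => deriv L v ^ 2), abs_of_pos hg, smul_eq_mul]
  calc ∫ u, deriv L ((y - u) / g) ^ 2 * q u ≤ ∫ u, deriv L ((y - u) / g) ^ 2 * B := by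
        refine integral_mono_of_nonneg
          (Eventually.of_forall fun u => mul_nonneg (sq_nonneg _) (hd.nonneg u)) (h1.mul_const B)
          (Eventually.of_forall fun u => mul_le_mul_of_nonneg_left (hB u) (sq_nonneg _))
    _ = B * S * g := by rw [integral_mul_const, h2]; ring
    _ ≤ (B * S + 1) * g := by nlinarith

end HasSmoothDensity

/-- Squaring the rate condition gives `(g n)⁻¹ ≤ g n ^ 3 * (n * h n) ^ 2`, so the exponential of
`-c₂ * (g n)⁻¹` beats the cubic number of grid points. -/
theorem tendsto_mul_exp_bound {h g : ℕ → ℝ} (hg : ∀ n, 0 < g n) (hg0 : Tendsto g atTop (𝓝 0))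
    (hrate : ∀ᶠ n : ℕ in atTop, 1 ≤ n * h n * g n ^ 2) {c₁ c₂ : ℝ} (hc₁ : 0 ≤ c₁) (hc₂ : 0 < c₂) :
    Tendsto (fun n : ℕ => (c₁ * (g n)⁻¹ ^ 3 + 1) *
      (2 * Real.exp (-(c₂ * (g n ^ 3 * (n * h n) ^ 2))))) atTop (𝓝 0) := by
  have h1 : Tendsto (fun n => c₂ * (g n)⁻¹) atTop atTop :=
    (tendsto_inv_nhdsGT_zero.comp (tendsto_nhdsWithin_iff.2
      ⟨hg0, Eventually.of_forall hg⟩)).const_mul_atTop hc₂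
  have h2 := (Real.tendsto_pow_mul_exp_neg_atTop_nhds_zero 3).comp h1
  have h3 := Real.tendsto_exp_neg_atTop_nhds_zero.comp h1
  have h4 : Tendsto (fun n => c₁ / c₂ ^ 3 * 2 * ((c₂ * (g n)⁻¹) ^ 3 * Real.exp (-(c₂ * (g n)⁻¹))) +
      2 * Real.exp (-(c₂ * (g n)⁻¹))) atTop (𝓝 0) := by
    simpa [Function.comp_def] using (h2.const_mul (c₁ / c₂ ^ 3 * 2)).add (h3.const_mul 2)
  refine squeeze_zero' (Eventually.of_forall fun n => ?_) ?_ h4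
  · have := hg n
    positivity
  · filter_upwards [hrate] with n hn
    have hgn := hg n
    have h5 : (g n)⁻¹ ≤ g n ^ 3 * (n * h n) ^ 2 := by
      rw [inv_le_iff_one_le_mul₀ hgn]
      calc (1 : ℝ) ≤ (n * h n * g n ^ 2) ^ 2 := one_le_pow₀ hn
        _ = _ := by ring
    have h6 : Real.exp (-(c₂ * (g n ^ 3 * (n * h n) ^ 2))) ≤ Real.exp (-(c₂ * (g n)⁻¹)) := by
      rw [Real.exp_le_exp, neg_le_neg_iff]
      exact mul_le_mul_of_nonneg_left h5 hc₂.le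
    calc (c₁ * (g n)⁻¹ ^ 3 + 1) * (2 * Real.exp (-(c₂ * (g n ^ 3 * (n * h n) ^ 2))))
        ≤ (c₁ * (g n)⁻¹ ^ 3 + 1) * (2 * Real.exp (-(c₂ * (g n)⁻¹))) := by gcongr
      _ = _ := by
          have : c₁ / c₂ ^ 3 * 2 * ((c₂ * (g n)⁻¹) ^ 3 * Real.exp (-(c₂ * (g n)⁻¹))) =
              c₁ * (g n)⁻¹ ^ 3 * 2 * Real.exp (-(c₂ * (g n)⁻¹)) := by
            rw [mul_pow]
            field_simp
          rw [this]
          ring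

namespace VanishingScale

variable {K : Plane → ℝ} {L : ℝ → ℝ} {μ : Plane → ℝ} {d : ℝ} {D : Set Plane} {h g : ℕ → ℝ}

theorem tendsto_mul (hv : VanishingScale K L μ d D h g) :
    Tendsto (fun n : ℕ => n * h n) atTop atTop := by
  refine tendsto_mul_atTop_of_rate hv.h_pos ?_
  -- Multiplying the rate by one factor `h n` turns it into the weaker rate of the fixed scale case.
  have h1 := hv.rate_h.mul hv.h_tendsto
  rw [zero_mul] at h1
  refine h1.congr fun n => ?_
  have := (hv.h_pos n).ne'
  rw [sq, mul_inv, mul_assoc, mul_assoc, inv_mul_cancel₀ this, mul_one]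

theorem eventually_one_le (hv : VanishingScale K L μ d D h g) :
    ∀ᶠ n : ℕ in atTop, 1 ≤ n * h n * g n ^ 2 := by
  filter_upwards [hv.rate_g.eventually (gt_mem_nhds one_pos), eventually_gt_atTop 0] with n h1 hn
  have hn' : (0 : ℝ) < n := by exact_mod_cast hn
  have h2 := hv.h_pos n
  have h3 := hv.g_pos n
  rw [← mul_inv, ← mul_inv, inv_lt_one₀ (by positivity)] at h1
  exact h1.le

/-- With high probability, the normalized score is uniformly close to a mixture of shifted
derivatives of the error density. -/
theorem eventually_deviation_le (hv : VanishingScale K L μ d D h g) {Q : Measure ℝ}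
    [IsProbabilityMeasure Q] {q : ℝ → ℝ} (hq : HasSmoothDensity Q q) (x₀ : Plane)
    {Cω σ κ R : ℝ} (hCω : 0 < Cω) (hσ : 0 < σ) (hκ : 0 < κ) (hR : 0 ≤ R) :
    ∀ᶠ n : ℕ in atTop, ∀ (m : Plane → ℝ) (p₀ : Pixel n) (α τ m₀ m₁ : ℝ),
      LocalModel K m n (h n) x₀ p₀ (Cω / (n * h n) ^ 2) α τ m₀ m₁ → ∀ lo hi, lo ≤ hi → hi - lo ≤ R →
      (Measure.pi fun _ : Pixel n => Q).real {e | ∃ y ∈ Icc lo hi, σ ≤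
        |scoreSum K L n (h n) (g n) x₀ (fun p => m (designPoint n p) + e p) y /
            (∑ p, weight K n (h n) x₀ p) / g n ^ 2 -
          ∑ p, weight K n (h n) x₀ p / (∑ p, weight K n (h n) x₀ p) *
            deriv q (y - m (designPoint n p))|} ≤ κ := by
  have hL := hv.score
  obtain ⟨B, hB0, hB⟩ := hL.exists_bound_deriv
  obtain ⟨C₀, hC₀0, hC₀⟩ : ∃ C₀ > 0, ∀ v w, |deriv L v - deriv L w| ≤ C₀ * |v - w| := by
    obtain ⟨C, hC⟩ := hL.lipschitz_deriv
    refine ⟨C + 1, by positivity, fun v w => ?_⟩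
    have := hC.dist_le_mul v w
    rw [Real.dist_eq, Real.dist_eq] at this
    linarith [abs_nonneg (v - w)]
  obtain ⟨Cq, hCq0, hCq⟩ := hq.exists_lipschitz
  obtain ⟨V, hV0, hV⟩ := hq.exists_second_moment_le hL
  set S := ∫ v, L v * |v| with hS
  have hS0 : 0 ≤ S := integral_nonneg fun v => mul_nonneg (hL.nonneg v) (abs_nonneg v)
  have hbound := tendsto_mul_exp_bound hv.g_pos hv.g_tendsto hv.eventually_one_le
    (c₁ := R * (8 * C₀ / σ)) (c₂ := σ ^ 2 / (64 * Cω * V)) (by positivity) (by positivity)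
  have hev1 : ∀ᶠ n in atTop, Cq * S * g n < σ / 2 := by
    have h1 : Tendsto (fun n => Cq * S * g n) atTop (𝓝 0) := by
      simpa using hv.g_tendsto.const_mul (Cq * S)
    exact h1.eventually (gt_mem_nhds (by positivity))
  have hev2 : ∀ᶠ n in atTop, σ / 2 * B * g n < V := by
    have h1 : Tendsto (fun n => σ / 2 * B * g n) atTop (𝓝 0) := by
      simpa using hv.g_tendsto.const_mul (σ / 2 * B)
    exact h1.eventually (gt_mem_nhds hV0)
  filter_upwards [hbound.eventually (gt_mem_nhds hκ), hev1, hev2,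
    hv.tendsto_mul.eventually_gt_atTop 0] with n hn1 hn2 hn3 hnh m p₀ α τ m₀ m₁ M lo hi hlh hR'
  have hg := hv.g_pos n
  -- Half of `σ` is reserved for the bias of the mean score; the deviation is measured on the
  -- unscaled score, at level `σ / 2 * g n ^ 2`.
  have hdev := M.measureReal_deviation_le hv.kernel (by positivity) hL.continuous_deriv hC₀0 hB hC₀
    hg (V := V * g n) (by positivity) (σ := σ / 2 * g n ^ 2) (by positivity)
    (by nlinarith) Q (fun y => hV (g n) hg y) hlh
  refine (measureReal_mono ?_).trans (hdev.trans (le_trans ?_ hn1.le))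
  · rintro e ⟨y, hy, hge⟩
    refine ⟨y, hy, ?_⟩
    set A := scoreSum K L n (h n) (g n) x₀ (fun p => m (designPoint n p) + e p) y /
      (∑ p, weight K n (h n) x₀ p) with hA
    set T := ∑ p, weight K n (h n) x₀ p / (∑ p, weight K n (h n) x₀ p) *
      scoreMean L (g n) Q (y - m (designPoint n p)) with hT
    have hmean : |T / g n ^ 2 - ∑ p, weight K n (h n) x₀ p / (∑ p, weight K n (h n) x₀ p) *
        deriv q (y - m (designPoint n p))| ≤ Cq * S * g n := by
      rw [hT, Finset.sum_div, ← Finset.sum_sub_distrib]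
      calc _ ≤ ∑ p, |weight K n (h n) x₀ p / (∑ p, weight K n (h n) x₀ p) *
              scoreMean L (g n) Q (y - m (designPoint n p)) / g n ^ 2 -
            weight K n (h n) x₀ p / (∑ p, weight K n (h n) x₀ p) *
              deriv q (y - m (designPoint n p))| := Finset.abs_sum_le_sum_abs _ _
        _ ≤ ∑ p, weight K n (h n) x₀ p / (∑ p, weight K n (h n) x₀ p) * (Cq * S * g n) := by
            refine Finset.sum_le_sum fun p _ => ?_
            rw [mul_div_assoc, ← mul_sub, abs_mul, abs_of_nonneg (M.normalized_nonneg hv.kernel p)]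
            exact mul_le_mul_of_nonneg_left (hq.abs_scoreMean_div_sub_le hL hCq hg _)
              (M.normalized_nonneg hv.kernel p)
        _ = Cq * S * g n := by rw [← Finset.sum_mul, M.sum_normalized, one_mul]
    have h1 : σ / 2 ≤ |A / g n ^ 2 - T / g n ^ 2| := by
      have h2 := abs_sub_le (A / g n ^ 2) (T / g n ^ 2)
        (∑ p, weight K n (h n) x₀ p / (∑ p, weight K n (h n) x₀ p) *
          deriv q (y - m (designPoint n p)))
      linarith
    rw [← sub_div, abs_div, abs_of_pos (by positivity : 0 < g n ^ 2), le_div_iff₀ (by positivity)] at h1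
    exact h1
  · have h1 : (hi - lo) * (4 * (C₀ / g n) / (σ / 2 * g n ^ 2)) + 1 ≤
        R * (8 * C₀ / σ) * (g n)⁻¹ ^ 3 + 1 := by
      have h2 : (hi - lo) * (4 * (C₀ / g n) / (σ / 2 * g n ^ 2)) =
          (hi - lo) * (8 * C₀ / σ * (g n)⁻¹ ^ 3) := by
        field_simp
        ring
      have h3 : 0 ≤ 8 * C₀ / σ * (g n)⁻¹ ^ 3 := by positivity
      rw [h2, mul_assoc]
      linarith [mul_le_mul_of_nonneg_right hR' h3]
    have h4 : (σ / 2 * g n ^ 2) ^ 2 / (16 * (Cω / (n * h n) ^ 2) * (V * g n)) =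
        σ ^ 2 / (64 * Cω * V) * (g n ^ 3 * (n * h n) ^ 2) := by
      generalize (n : ℝ) * h n = z at hnh
      field_simp
      ring
    rw [h4]
    gcongr

end VanishingScale

end MSmoother

namespace MSmoother

/-! ### The shape of a strongly unimodal density -/

theorem exists_gt_lt_of_integrable {f : ℝ → ℝ} (hi : Integrable f) {b : ℝ}
    (hb : 0 < b) (a : ℝ) : ∃ z > a, f z < b := by
  by_contra! hcon
  have h1 : IntegrableOn (fun _ => b) (Ioi a) := by
    refine Integrable.mono' hi.integrableOn aestronglyMeasurable_const ?_
    filter_upwards [ae_restrict_mem measurableSet_Ioi] with z hz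
    rw [Real.norm_of_nonneg hb.le]
    exact hcon z hz
  rw [integrableOn_const_iff] at h1
  simp [hb.ne'] at h1

/-- If `f` increased somewhere on the positive half-line, integrability would force it down again
later. The interior maximum between would be a forbidden critical point with positive density. -/
theorem deriv_nonpos_of_integrable {f : ℝ → ℝ} (hf : ∀ y, 0 ≤ f y) (hd : Differentiable ℝ f)
    (hi : Integrable f) (hcrit : ∀ y > 0, 0 < f y → deriv f y ≠ 0) {y : ℝ} (hy : 0 < y) :
    deriv f y ≤ 0 := by
  by_contra! hpos
  obtain ⟨y', hyy', hlt⟩ : ∃ y' > y, f y < f y' := by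
    have h1 := (hasDerivAt_iff_tendsto_slope.1 (hd y).hasDerivAt).eventually (lt_mem_nhds hpos)
    have h2 : ∀ᶠ z in 𝓝[>] y, 0 < slope f y z := h1.filter_mono
      (nhdsWithin_mono y fun z hz => (ne_of_gt hz : z ≠ y))
    obtain ⟨z, hz, hyz⟩ := (h2.and self_mem_nhdsWithin).exists
    refine ⟨z, hyz, ?_⟩
    have hyz' : y < z := hyz
    rw [slope_def_field, div_pos_iff_of_pos_right (sub_pos.2 hyz')] at hz
    linarith
  obtain ⟨z, hz, hfz⟩ := exists_gt_lt_of_integrable hi ((hf y).trans_lt hlt) y'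
  obtain ⟨w, hw, hmax⟩ := isCompact_Icc.exists_isMaxOn (nonempty_Icc.2 (hyy'.le.trans hz.le))
    hd.continuous.continuousOn
  have hw' : f y' ≤ f w := hmax ⟨hyy'.le, hz.le⟩
  have hwy : y < w := lt_of_le_of_ne hw.1 (by rintro rfl; linarith)
  have hwz : w < z := lt_of_le_of_ne hw.2 (by rintro rfl; linarith)
  exact hcrit w (hy.trans hwy) ((hf y).trans_lt (hlt.trans_le hw'))
    (hmax.isLocalMax (Icc_mem_nhds hwy hwz)).deriv_eq_zero

/-- `f` is a differentiable probability density with Lipschitz continuous derivative, which has no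
critical point other than `0` where it is positive. -/
structure IsSmoothUnimodal (f : ℝ → ℝ) : Prop where
  nonneg : ∀ y, 0 ≤ f y
  differentiable : Differentiable ℝ f
  integrable : Integrable f
  integral_eq : ∫ y, f y = 1
  deriv_ne : ∀ y, y ≠ 0 → 0 < f y → deriv f y ≠ 0
  lipschitz_deriv : ∃ C : ℝ≥0, LipschitzWith C (deriv f)

namespace IsSmoothUnimodal

variable {f : ℝ → ℝ}

theorem reflect (hf : IsSmoothUnimodal f) : IsSmoothUnimodal fun y => f (-y) where
  nonneg y := hf.nonneg _
  differentiable := hf.differentiable.comp differentiable_neg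
  integrable := hf.integrable.comp_neg
  integral_eq := by rw [integral_neg_eq_self f]; exact hf.integral_eq
  deriv_ne y hy hfy := by
    rw [deriv_comp_neg]
    exact neg_ne_zero.2 (hf.deriv_ne _ (neg_ne_zero.2 hy) hfy)
  lipschitz_deriv := by
    obtain ⟨C, hC⟩ := hf.lipschitz_deriv
    refine ⟨C, LipschitzWith.of_dist_le_mul fun x y => ?_⟩
    simp only [deriv_comp_neg, dist_neg_neg]
    simpa using hC.dist_le_mul (-x) (-y)

theorem deriv_nonpos (hf : IsSmoothUnimodal f) {y : ℝ} (hy : 0 < y) : deriv f y ≤ 0 :=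
  deriv_nonpos_of_integrable hf.nonneg hf.differentiable hf.integrable
    (fun z hz => hf.deriv_ne z hz.ne') hy

theorem deriv_nonneg (hf : IsSmoothUnimodal f) {y : ℝ} (hy : y < 0) : 0 ≤ deriv f y := by
  have := hf.reflect.deriv_nonpos (neg_pos.2 hy)
  rw [deriv_comp_neg, neg_neg] at this
  linarith

theorem le_zero_of_nonneg (hf : IsSmoothUnimodal f) {y : ℝ} (hy : 0 ≤ y) : f y ≤ f 0 := by
  refine antitoneOn_of_deriv_nonpos (convex_Ici 0) hf.differentiable.continuous.continuousOn
    hf.differentiable.differentiableOn ?_ self_mem_Ici hy hy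
  intro z hz
  rw [interior_Ici] at hz
  exact hf.deriv_nonpos hz

theorem le_zero (hf : IsSmoothUnimodal f) (y : ℝ) : f y ≤ f 0 := by
  rcases le_total 0 y with hy | hy
  · exact hf.le_zero_of_nonneg hy
  · simpa using hf.reflect.le_zero_of_nonneg (neg_nonneg.2 hy)

theorem zero_pos (hf : IsSmoothUnimodal f) : 0 < f 0 := by
  refine lt_of_le_of_ne (hf.nonneg 0) fun h => ?_
  have h1 : ∀ y, f y = 0 := fun y => le_antisymm (h ▸ hf.le_zero y) (hf.nonneg y)
  have := hf.integral_eq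
  simp [h1] at this

/-- By the mean value theorem the derivative equals a difference of two values in `[0, f 0]`
somewhere in each interval of length one; the Lipschitz property does the rest. -/
theorem exists_bound_deriv (hf : IsSmoothUnimodal f) : ∃ B, ∀ y, |deriv f y| ≤ B := by
  obtain ⟨C, hC⟩ := hf.lipschitz_deriv
  refine ⟨f 0 + C, fun y => ?_⟩
  obtain ⟨z, hz, hfz⟩ := exists_deriv_eq_slope f (lt_add_one y)
    hf.differentiable.continuous.continuousOn hf.differentiable.differentiableOn
  have h1 := hC.dist_le_mul y z
  rw [Real.dist_eq, Real.dist_eq, abs_sub_comm y, abs_of_pos (sub_pos.2 hz.1), hfz] at h1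
  have h2 : (C : ℝ) * (z - y) ≤ C := mul_le_of_le_one_right C.2 (by linarith [hz.2])
  rw [add_sub_cancel_left, div_one] at h1
  rw [abs_le] at h1 ⊢
  constructor <;> linarith [hf.nonneg y, hf.nonneg (y + 1), hf.le_zero y, hf.le_zero (y + 1)]

theorem exists_deriv_neg (hf : IsSmoothUnimodal f) : ∃ y > 0, deriv f y < 0 ∧ 0 < f y := by
  obtain ⟨y, hy, hneg⟩ : ∃ y > 0, deriv f y < 0 := by
    by_contra! hcon
    obtain ⟨z, hz, hfz⟩ := exists_gt_lt_of_integrable hf.integrable hf.zero_pos 0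
    have h1 : MonotoneOn f (Ici 0) :=
      monotoneOn_of_deriv_nonneg (convex_Ici 0) hf.differentiable.continuous.continuousOn
        hf.differentiable.differentiableOn fun w hw => by
          rw [interior_Ici] at hw
          exact hcon w hw
    exact absurd (h1 self_mem_Ici hz.le hz.le) (not_le.2 hfz)
  refine ⟨y, hy, hneg, lt_of_le_of_ne (hf.nonneg y) fun h => hneg.ne ?_⟩
  have : IsLocalMin f y := Eventually.of_forall fun z => h ▸ hf.nonneg z
  exact this.deriv_eq_zero

theorem exists_deriv_pos (hf : IsSmoothUnimodal f) : ∃ y < 0, 0 < deriv f y ∧ 0 < f y := by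
  obtain ⟨y, hy, h1, h2⟩ := hf.reflect.exists_deriv_neg
  rw [deriv_comp_neg] at h1
  exact ⟨-y, neg_neg_iff_pos.2 hy, by linarith, h2⟩

end IsSmoothUnimodal

theorem SmoothUnimodalError.exists_density {P : Measure ℝ} [IsProbabilityMeasure P]
    (hP : SmoothUnimodalError P) : ∃ f, HasSmoothDensity P f ∧ IsSmoothUnimodal f := by
  obtain ⟨f, I, hd, hdiff, hlip, hne⟩ := hP
  have hu : IsSmoothUnimodal f :=
    { nonneg := hd.nonneg
      differentiable := hdiff
      integrable := hd.integrable
      integral_eq := hd.integral_eq_one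
      deriv_ne := fun y hy hfy => hne y ⟨by
        by_contra hyI
        exact hfy.ne' (hd.support y hyI), hy⟩
      lipschitz_deriv := hlip }
  exact ⟨f, ⟨⟨I, hd⟩, hdiff, ⟨f 0, hu.le_zero⟩, hu.exists_bound_deriv, hlip⟩, hu⟩

/-- The point `b` to be avoided stands for the default value `0` of the smoother, and `2 * r < d`
keeps the perturbed region disjoint from its shift by the jump. -/
theorem exists_interval_subset {U : Set ℝ} (hU : IsOpen U) (hne : U.Nonempty) (b : ℝ) {d : ℝ}
    (hd : 0 < d) : ∃ c r, 0 < r ∧ 2 * r < d ∧ b ∉ Ioo (c - r) (c + r) ∧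
      ∀ t, |t - c| ≤ r → t ∈ U := by
  obtain ⟨c, hcU, hcb⟩ := (dense_compl_singleton b).inter_open_nonempty U hU hne
  obtain ⟨ε, hε, hsub⟩ := Metric.isOpen_iff.1 (hU.inter isOpen_compl_singleton) c ⟨hcU, hcb⟩
  refine ⟨c, min (ε / 2) (d / 4), by positivity, ?_, fun hb => ?_, fun t ht => ?_⟩
  · linarith [min_le_right (ε / 2) (d / 4)]
  · have h1 : b ∈ Metric.ball c ε := by
      rw [Metric.mem_ball, Real.dist_eq, abs_lt]
      constructor <;> linarith [min_le_left (ε / 2) (d / 4), hb.1, hb.2]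
    exact (hsub h1).2 rfl
  · refine (hsub ?_).1
    rw [Metric.mem_ball, Real.dist_eq]
    linarith [min_le_left (ε / 2) (d / 4)]

/-! ### A density with small oscillations of steep slope -/

theorem measurableSet_sin_le (c r s : ℝ) :
    MeasurableSet {t : ℝ | |t - c| ≤ r / 2 ∧ Real.sin (t / s) ≤ -(1 / 4)} := by
  have h1 : IsClosed {t : ℝ | |t - c| ≤ r / 2} := isClosed_le (by fun_prop) continuous_const
  have h2 : IsClosed {t : ℝ | Real.sin (t / s) ≤ -(1 / 4)} :=
    isClosed_le (by fun_prop) continuous_const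
  exact (h1.inter h2).measurableSet

theorem le_volume_sin_le (c : ℝ) {r s : ℝ} (hr : 0 < r) (hs : 0 < s) :
    2 / 3 * (r / 4 - 2 * s) ≤
      volume.real {t | |t - c| ≤ r / 2 ∧ Real.sin (t / s) ≤ -(1 / 4)} := by
  set S : Set ℝ := {t | |t - c| ≤ r / 2 ∧ Real.sin (t / s) ≤ -(1 / 4)} with hS
  have hSsub : S ⊆ Icc (c - r / 2) (c + r / 2) := fun t ht => by
    have := abs_le.1 ht.1
    constructor <;> linarith [this.1, this.2]
  have hSm : MeasurableSet S := measurableSet_sin_le c r s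
  -- As a polynomial in the sine, `u` is `(x - 1) * (x + 1 / 4)`: nonpositive unless the sine is at
  -- most `-1 / 4`, and never above `3 / 2`. Its mean over a period is `1 / 4`, with boundary terms
  -- of at most `2 * s`.
  set u : ℝ → ℝ := fun t => Real.sin (t / s) ^ 2 - 3 / 4 * Real.sin (t / s) - 1 / 4 with hu
  have huc : Continuous u := by fun_prop
  have hder : ∀ t, HasDerivAt (fun t => t / 4 - s / 4 * Real.sin (2 * (t / s)) +
      3 / 4 * s * Real.cos (t / s)) (u t) t := by
    intro t
    have h1 : HasDerivAt (fun t => t / s) (1 / s) t := (hasDerivAt_id t).div_const s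
    have h2 := (((hasDerivAt_id t).div_const 4).sub
      (((h1.const_mul 2).sin).const_mul (s / 4))).add (h1.cos.const_mul (3 / 4 * s))
    refine h2.congr_deriv ?_
    rw [hu, Real.cos_two_mul, Real.cos_sq']
    field_simp
    ring
  have hint := intervalIntegral.integral_eq_sub_of_hasDerivAt (a := c - r / 2) (b := c + r / 2)
    (fun t _ => hder t) (huc.intervalIntegrable _ _)
  rw [intervalIntegral.integral_of_le (by linarith), ← integral_Icc_eq_integral_Ioc] at hint
  have hle : ∫ t in Icc (c - r / 2) (c + r / 2), u t ≤
      ∫ t in Icc (c - r / 2) (c + r / 2), S.indicator (fun _ => (3 / 2 : ℝ)) t := by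
    refine setIntegral_mono_on huc.continuousOn.integrableOn_Icc ?_ measurableSet_Icc ?_
    · exact (integrableOn_const (by simp)).integrable.indicator hSm
    · intro t ht
      have h1 := Real.neg_one_le_sin (t / s)
      have h2 := Real.sin_le_one (t / s)
      by_cases htS : t ∈ S
      · rw [indicator_of_mem htS]
        simp only [hu]
        nlinarith
      · rw [indicator_of_notMem htS]
        have h3 : -(1 / 4) < Real.sin (t / s) := by
          by_contra hcon
          refine htS ⟨abs_le.2 ⟨by linarith [ht.1], by linarith [ht.2]⟩, not_lt.1 hcon⟩
        simp only [hu]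
        nlinarith
  rw [integral_indicator hSm, Measure.restrict_restrict hSm, inter_eq_left.2 hSsub,
    setIntegral_const, smul_eq_mul] at hle
  have h1 := Real.neg_one_le_sin (2 * ((c - r / 2) / s))
  have h2 := Real.sin_le_one (2 * ((c + r / 2) / s))
  have h3 := Real.neg_one_le_cos ((c + r / 2) / s)
  have h4 := Real.cos_le_one ((c - r / 2) / s)
  nlinarith

/-- Perturbation of a density by rapid oscillations near `c`, with amplitude of order `s` for the
distribution function and of order `1 / s` for the derivative of the density. -/
theorem HasSmoothDensity.exists_oscillating {P : Measure ℝ} [IsProbabilityMeasure P] {f : ℝ → ℝ}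
    (hf : HasSmoothDensity P f) {c r b : ℝ} (hr : 0 < r) (hb : 0 < b)
    (hlow : ∀ t, |t - c| ≤ r → b ≤ f t) {ε : ℝ} (hε : 0 < ε) (A₀ : ℝ) :
    ∃ (Q : Measure ℝ) (q : ℝ → ℝ) (s A : ℝ), IsProbabilityMeasure Q ∧ HasSmoothDensity Q q ∧
      levyDist P Q ≤ ε ∧ 0 < s ∧ 112 * s ≤ r ∧ A₀ ≤ A ∧ 0 < A ∧
      (∀ t, |t - c| ≤ 3 * r / 4 → deriv q t = deriv f t - A * Real.sin (t / s)) ∧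
      (∀ t, r < |t - c| → deriv q t = deriv f t) ∧
      b * r / 24 ≤ Q.real {t | |t - c| ≤ r / 2 ∧ Real.sin (t / s) ≤ -(1 / 4)} := by
  obtain ⟨I, hd⟩ := hf.density
  obtain ⟨Cf, hCf⟩ := hf.bounded
  obtain ⟨Cf', hCf'⟩ := hf.bounded_deriv
  obtain ⟨Lf, hLf⟩ := hf.lipschitz_deriv
  -- The cutoff is constant in a neighbourhood of the part `|t - c| ≤ 3 * r / 4`, so its derivatives
  -- play no role there.
  let χ : ContDiffBump c := ⟨7 * r / 8, r, by positivity, by linarith⟩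
  have hχd : ContDiff ℝ 3 χ := χ.contDiff
  have hχs : HasCompactSupport χ := χ.hasCompactSupport
  obtain ⟨M, hM⟩ := hχs.deriv.exists_bound_of_continuous (hχd.continuous_deriv (by norm_num))
  have hM0 : 0 ≤ M := (norm_nonneg _).trans (hM 0)
  set a := b / 4 with ha
  have ha0 : 0 < a := by positivity
  -- In turn: short period, negligible derivative of the cutoff, small Lévy distance, and slope `a /
  -- s` at least `A₀`. The number `112` is `7 * 16`: one period is at most `7 * s`, to be at most `r
  -- / 16`.
  set s := min (min (r / 112) (1 / (M + 1))) (min (ε / a) (a / (|A₀| + 1))) with hs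
  have hs0 : 0 < s := by positivity
  have hs1 : s ≤ r / 112 := (min_le_left _ _).trans (min_le_left _ _)
  have hs2 : s * M ≤ 1 := by
    have h1 : s ≤ 1 / (M + 1) := (min_le_left _ _).trans (min_le_right _ _)
    rw [le_div_iff₀ (by positivity)] at h1
    linarith
  have hs3 : a * s ≤ ε := by
    have h1 : s ≤ ε / a := (min_le_right _ _).trans (min_le_left _ _)
    rw [le_div_iff₀ ha0] at h1
    linarith
  have hs4 : A₀ ≤ a / s := by
    have h1 : s ≤ a / (|A₀| + 1) := (min_le_right _ _).trans (min_le_right _ _)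
    rw [le_div_iff₀ (by positivity)] at h1
    rw [le_div_iff₀ hs0]
    nlinarith [le_abs_self A₀]
  set B : ℝ → ℝ := fun y => χ y * (a * s * Real.sin (y / s)) with hB
  have hBd : ContDiff ℝ 3 B := by
    refine hχd.mul ?_
    fun_prop
  have hBs : HasCompactSupport B := hχs.mul_right
  have hB1 : ContDiff ℝ 2 (deriv B) := hBd.deriv'
  have hB1s : HasCompactSupport (deriv B) := hBs.deriv
  have hB2 : Continuous (deriv (deriv B)) := hB1.continuous_deriv (by norm_num)
  have hBdiff : Differentiable ℝ B := hBd.differentiable (by norm_num)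
  have hB1diff : Differentiable ℝ (deriv B) := hB1.differentiable (by norm_num)
  have hin : ∀ t, HasDerivAt (fun y => a * s * Real.sin (y / s)) (a * Real.cos (t / s)) t := by
    intro t
    have h1 : HasDerivAt (fun t => t / s) (1 / s) t := (hasDerivAt_id t).div_const s
    refine (h1.sin.const_mul (a * s)).congr_deriv ?_
    field_simp
  have hBbound : ∀ t, |B t| ≤ ε := by
    intro t
    rw [hB, abs_mul, abs_of_nonneg χ.nonneg, abs_mul, abs_of_pos (by positivity : 0 < a * s)]
    have h1 := Real.abs_sin_le_one (t / s)
    calc χ t * (a * s * |Real.sin (t / s)|) ≤ 1 * (a * s * 1) := by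
          have := χ.le_one (x := t)
          gcongr
      _ ≤ ε := by linarith
  have hB1bound : ∀ t, |deriv B t| ≤ b / 2 := by
    intro t
    have h1 := ((hχd.differentiable (by norm_num) t).hasDerivAt.mul (hin t)).deriv
    have h2 : deriv B t = _ := h1
    rw [h2]
    have h3 : |deriv χ t| ≤ M := hM t
    have h4 := Real.abs_sin_le_one (t / s)
    have h5 := Real.abs_cos_le_one (t / s)
    have h6 := χ.le_one (x := t)
    have h7 : 0 ≤ χ t := χ.nonneg
    calc _ ≤ |deriv χ t * (a * s * Real.sin (t / s))| + |χ t * (a * Real.cos (t / s))| :=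
          abs_add_le _ _
      _ = |deriv χ t| * (a * s * |Real.sin (t / s)|) + χ t * (a * |Real.cos (t / s)|) := by
          rw [abs_mul, abs_mul, abs_mul, abs_mul, abs_of_pos ha0, abs_of_nonneg h7,
            abs_mul, abs_of_pos ha0, abs_of_pos hs0]
      _ ≤ M * (a * s * 1) + 1 * (a * 1) := by gcongr
      _ = a * (s * M) + a := by ring
      _ ≤ a * 1 + a := by gcongr
      _ = b / 2 := by rw [ha]; ring
  have hout : ∀ t, r < |t - c| → B =ᶠ[𝓝 t] 0 := by
    intro t ht
    rw [← notMem_tsupport_iff_eventuallyEq]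
    intro hmem
    have h1 := tsupport_mul_subset_left hmem
    rw [χ.tsupport_eq, Metric.mem_closedBall, Real.dist_eq] at h1
    exact absurd h1 (not_le.2 ht)
  have hmid : ∀ t, |t - c| ≤ 3 * r / 4 → deriv (deriv B) t = -(a / s) * Real.sin (t / s) := by
    intro t ht
    have h1 : ∀ᶠ y in 𝓝 t, χ =ᶠ[𝓝 y] 1 := by
      refine (χ.eventuallyEq_one_of_mem_ball ?_).eventually_nhds
      rw [Metric.mem_ball, Real.dist_eq]
      show |t - c| < 7 * r / 8
      linarith
    have h2 : deriv B =ᶠ[𝓝 t] fun y => a * Real.cos (y / s) := by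
      filter_upwards [h1] with y hy
      have h3 : B =ᶠ[𝓝 y] fun y => a * s * Real.sin (y / s) := by
        filter_upwards [hy] with z hz
        simp only [hB]
        rw [hz, Pi.one_apply, one_mul]
      rw [h3.deriv_eq]
      exact (hin y).deriv
    rw [h2.deriv_eq]
    have h4 : HasDerivAt (fun t => t / s) (1 / s) t := (hasDerivAt_id t).div_const s
    rw [(h4.cos.const_mul a).deriv]
    ring
  -- `B` is the change of the distribution function. Its derivative is at most `b / 2`, so `q` stays
  -- a density, and compact support of `B` preserves the total mass.
  set q : ℝ → ℝ := fun y => f y + deriv B y with hq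
  have hqlow : ∀ t, |t - c| ≤ r → b / 2 ≤ q t := fun t ht => by
    have := abs_le.1 (hB1bound t)
    simp only [hq]
    linarith [hlow t ht, this.1]
  have hq0 : ∀ t, 0 ≤ q t := by
    intro t
    by_cases ht : |t - c| ≤ r
    · linarith [hqlow t ht]
    · simp only [hq]
      rw [(hout t (not_le.1 ht)).deriv_eq]
      simpa using hd.nonneg t
  have hqdiff : Differentiable ℝ q := hf.differentiable.add hB1diff
  have hqderiv : ∀ t, deriv q t = deriv f t + deriv (deriv B) t := fun t =>
    deriv_add (hf.differentiable t) (hB1diff t)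
  have hB1int : Integrable (deriv B) := hB1.continuous.integrable_of_hasCompactSupport hB1s
  have hqint : Integrable q := hd.integrable.add hB1int
  set Q : Measure ℝ := volume.withDensity fun y => ENNReal.ofReal (q y) with hQ
  have hQd : HasDensityOn Q q univ :=
    ⟨hqdiff.continuous.measurable, hq0, rfl, ordConnected_univ, fun y hy => absurd (mem_univ y) hy⟩
  have hQp : IsProbabilityMeasure Q := by
    refine ⟨?_⟩
    rw [hQ, withDensity_apply _ MeasurableSet.univ, Measure.restrict_univ,
      ← ofReal_integral_eq_lintegral_ofReal hqint (Eventually.of_forall hq0)]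
    simp only [hq]
    rw [integral_add hd.integrable hB1int, hd.integral_eq_one,
      integral_eq_zero_of_hasDerivAt_of_integrable (fun x => (hBdiff x).hasDerivAt) hB1int
        (hBd.continuous.integrable_of_hasCompactSupport hBs), add_zero, ENNReal.ofReal_one]
  have hcdf : ∀ y, Q.real (Iic y) = P.real (Iic y) + B y := by
    intro y
    rw [hQd.measureReal_eq measurableSet_Iic, hd.measureReal_eq measurableSet_Iic]
    simp only [hq]
    rw [integral_add hd.integrable.integrableOn hB1int.integrableOn,
      HasCompactSupport.integral_Iic_deriv_eq (hBd.of_le (by norm_num)) hBs]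
  obtain ⟨M₂, hM₂⟩ := hB1s.deriv.exists_bound_of_continuous hB2
  obtain ⟨LB, hLB⟩ := ContDiff.lipschitzWith_of_hasCompactSupport (𝕂 := ℝ) (n := 1) hB1s.deriv
    (hB1.deriv' : ContDiff ℝ 1 _) one_ne_zero
  refine ⟨Q, q, s, a / s, hQp, ⟨⟨univ, hQd⟩, hqdiff, ⟨Cf + b / 2, fun y => ?_⟩,
    ⟨Cf' + M₂, fun y => ?_⟩, ⟨Lf + LB, ?_⟩⟩, levyDist_le hε.le fun y => ⟨?_, ?_⟩, hs0,
    by linarith, hs4, by positivity, fun t ht => ?_, fun t ht => ?_, ?_⟩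
  · exact add_le_add (hCf y) ((le_abs_self _).trans (hB1bound y))
  · rw [hqderiv]
    exact (abs_add_le _ _).trans (add_le_add (hCf' y) (hM₂ y))
  · rw [show deriv q = fun t => deriv f t + deriv (deriv B) t from funext hqderiv]
    exact hLf.add hLB
  · rw [hcdf]
    have h1 : P.real (Iic (y - ε)) ≤ P.real (Iic y) :=
      measureReal_mono (Iic_subset_Iic.2 (by linarith))
    linarith [(abs_le.1 (hBbound y)).1]
  · rw [hcdf]
    have h1 : P.real (Iic y) ≤ P.real (Iic (y + ε)) :=
      measureReal_mono (Iic_subset_Iic.2 (by linarith))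
    linarith [(abs_le.1 (hBbound y)).2]
  · rw [hqderiv, hmid t ht]
    ring
  · rw [hqderiv, (hout t ht).deriv.deriv_eq]
    simp
  · set S : Set ℝ := {t | |t - c| ≤ r / 2 ∧ Real.sin (t / s) ≤ -(1 / 4)} with hS
    have hSm : MeasurableSet S := measurableSet_sin_le c r s
    have hSfin : volume S ≠ ∞ := by
      refine ((measure_mono (fun t ht => ?_)).trans_lt
        (isCompact_closedBall c (r / 2)).measure_lt_top).ne
      rw [Metric.mem_closedBall, Real.dist_eq]
      exact ht.1
    have h1 : ∫ _t in S, b / 2 ≤ ∫ t in S, q t :=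
      setIntegral_mono_on (integrableOn_const hSfin) hqint.integrableOn hSm fun t ht =>
        hqlow t (by linarith [ht.1])
    rw [hQd.measureReal_eq hSm]
    refine le_trans ?_ h1
    rw [setIntegral_const, smul_eq_mul]
    have h2 := le_volume_sin_le c hr hs0
    have h3 : r / 12 ≤ volume.real S := by linarith
    nlinarith

end MSmoother

namespace MSmoother

/-! ### Lack of robustness for vanishing scale parameters -/

/-- There is an interval with positive density where both kinds of pixels pull the density
estimate in the same direction. -/
theorem IsSmoothUnimodal.exists_monotone_interval {f : ℝ → ℝ} (hf : IsSmoothUnimodal f)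
    {m₀ m₁ d : ℝ} (hd : 0 < d) (hm : m₁ = m₀ + d ∨ m₀ = m₁ + d) :
    ∃ c r η b, 0 < r ∧ 2 * r < d ∧ 0 < η ∧ 0 < b ∧ (0 : ℝ) ∉ Ioo (m₀ + c - r) (m₀ + c + r) ∧
      (∀ t, |t - c| ≤ r → b ≤ f t) ∧
      ((∀ t, |t - c| ≤ r → deriv f t ≤ -η ∧ deriv f (t + m₀ - m₁) ≤ 0) ∨
        ∀ t, |t - c| ≤ r → η ≤ deriv f t ∧ 0 ≤ deriv f (t + m₀ - m₁)) := by
  have hc := hf.differentiable.continuous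
  have hc' : Continuous (deriv f) := by
    obtain ⟨C, hC⟩ := hf.lipschitz_deriv
    exact hC.continuous
  have h0 : ∀ {c r : ℝ}, -m₀ ∉ Ioo (c - r) (c + r) → (0 : ℝ) ∉ Ioo (m₀ + c - r) (m₀ + c + r) :=
    fun h h' => h ⟨by linarith [h'.1], by linarith [h'.2]⟩
  rcases hm with rfl | rfl
  -- With the other level above, the search is for negative `t` with increasing density: the shift
  -- to `t - d` remains on the increasing branch.
  · obtain ⟨y, hy, hpos, hfy⟩ := hf.exists_deriv_pos
    have hU : IsOpen ({t | t < 0} ∩ {t | deriv f y / 2 < deriv f t} ∩ {t | f y / 2 < f t}) :=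
      ((isOpen_lt continuous_id continuous_const).inter (isOpen_lt continuous_const hc')).inter
        (isOpen_lt continuous_const hc)
    obtain ⟨c, r, hr, hrd, hb, hsub⟩ := exists_interval_subset hU
      ⟨y, ⟨hy, half_lt_self hpos⟩, half_lt_self hfy⟩ (-m₀) hd
    refine ⟨c, r, deriv f y / 2, f y / 2, hr, hrd, half_pos hpos, half_pos hfy, h0 hb,
      fun t ht => le_of_lt (hsub t ht).2, Or.inr fun t ht =>
        ⟨le_of_lt (hsub t ht).1.2, hf.deriv_nonneg ?_⟩⟩
    have : t < 0 := (hsub t ht).1.1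
    linarith
  · obtain ⟨y, hy, hneg, hfy⟩ := hf.exists_deriv_neg
    have hU : IsOpen ({t | 0 < t} ∩ {t | deriv f t < deriv f y / 2} ∩ {t | f y / 2 < f t}) :=
      ((isOpen_lt continuous_const continuous_id).inter (isOpen_lt hc' continuous_const)).inter
        (isOpen_lt continuous_const hc)
    obtain ⟨c, r, hr, hrd, hb, hsub⟩ := exists_interval_subset hU
      ⟨y, ⟨hy, show deriv f y < deriv f y / 2 by linarith⟩, half_lt_self hfy⟩ (-(m₁ + d)) hd
    refine ⟨c, r, -(deriv f y / 2), f y / 2, hr, hrd, by linarith, half_pos hfy, h0 hb,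
      fun t ht => le_of_lt (hsub t ht).2, Or.inl fun t ht => ⟨?_, hf.deriv_nonpos ?_⟩⟩
    · have : deriv f t < deriv f y / 2 := (hsub t ht).1.2
      linarith
    · have : 0 < t := (hsub t ht).1.1
      linarith

namespace VanishingScale

variable {K : Plane → ℝ} {L : ℝ → ℝ} {μ : Plane → ℝ} {d : ℝ} {D : Set Plane} {h g : ℕ → ℝ}

/-- The M-smoother avoids an interval where the mean score is bounded away from zero. -/
theorem eventually_law_le (hv : VanishingScale K L μ d D h g) {P : Measure ℝ}
    [IsProbabilityMeasure P] {f : ℝ → ℝ} (hf : HasSmoothDensity P f) (x₀ : Plane)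
    {Cω α m₀ m₁ c r η κ : ℝ} (hCω : 0 < Cω) (hα : 0 < α) (hη : 0 < η) (hκ : 0 < κ) (hr : 0 < r)
    (h0 : (0 : ℝ) ∉ Ioo (m₀ + c - r) (m₀ + c + r))
    (hsign : (∀ t, |t - c| ≤ r → deriv f t ≤ -η ∧ deriv f (t + m₀ - m₁) ≤ 0) ∨
      ∀ t, |t - c| ≤ r → η ≤ deriv f t ∧ 0 ≤ deriv f (t + m₀ - m₁)) :
    ∃ τ₀ > 0, ∀ᶠ n : ℕ in atTop, ∀ (m : Plane → ℝ) (p₀ : Pixel n) (τ : ℝ), τ ≤ τ₀ →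
      LocalModel K m n (h n) x₀ p₀ (Cω / (n * h n) ^ 2) α τ m₀ m₁ →
      (estimatorLaw m (mSmoother K L n (h n) (g n) x₀) P).real
        (Ioo (m₀ + c - r) (m₀ + c + r)) ≤ κ := by
  obtain ⟨Λ, hΛ, hlip⟩ := hf.exists_lipschitz
  -- A quarter of the main term `α * η` goes to the variation of the levels and a quarter to the
  -- random deviations.
  refine ⟨α * η / (8 * Λ), by positivity, ?_⟩
  filter_upwards [hv.eventually_deviation_le hf x₀ hCω (σ := α * η / 4) (by positivity) hκ
    (R := 2 * r) (by positivity)] with n hn m p₀ τ hτ M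
  have hdev := hn m p₀ α τ m₀ m₁ M (m₀ + c - r) (m₀ + c + r) (by linarith) (by linarith)
  have hL := hv.score
  rw [estimatorLaw_real
    (measurable_mSmoother K hL.differentiable hL.continuous_deriv n (h n) (g n) x₀)
    measurableSet_Ioo]
  refine (measureReal_mono fun e he => ?_).trans hdev
  by_contra hcon
  simp only [mem_ofPred_eq, not_exists, not_and, not_le] at hcon
  refine mSmoother_notMem_Ioo h0 (fun y hy => ?_) he
  have h1 := abs_lt.1 (hcon y ⟨hy.1.le, hy.2.le⟩)
  have hg := hv.g_pos n
  have hg2 : 0 < g n ^ 2 := by positivity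
  have hτ' : 2 * Λ * τ ≤ α * η / 4 := by
    rw [le_div_iff₀ (by positivity)] at hτ
    linarith
  have hτ0 : |y - m₀ - (y - m₀)| ≤ τ := by
    rw [sub_self, abs_zero]
    exact (abs_nonneg _).trans M.centre
  have hyc : |y - m₀ - c| ≤ r := abs_le.2 ⟨by linarith [hy.1], by linarith [hy.2]⟩
  have hαη : 0 < α * η := by positivity
  rcases hsign with hs | hs
  · have h2 := M.weighted_sum_le hv.kernel hΛ.le hlip hτ0 hη.le le_rfl (hs _ hyc).1
      (Or.inr (hs _ hyc).2)
    have h3 : scoreSum K L n (h n) (g n) x₀ (fun p => m (designPoint n p) + e p) y /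
        (∑ p, weight K n (h n) x₀ p) / g n ^ 2 < 0 := by linarith [h1.2]
    rw [div_lt_iff₀ hg2, zero_mul, ← M.scoreSum_neg_iff,
      ← deriv_densityEstimate_neg_iff hL.differentiable M.size_pos (hv.h_pos n) hg] at h3
    exact h3.ne
  · have h2 := M.le_weighted_sum hv.kernel hΛ.le hlip hτ0 hη.le le_rfl (hs _ hyc).1
      (Or.inr (by rw [neg_zero]; exact (hs _ hyc).2))
    have h3 : 0 < scoreSum K L n (h n) (g n) x₀ (fun p => m (designPoint n p) + e p) y /
        (∑ p, weight K n (h n) x₀ p) / g n ^ 2 := by linarith [h1.1]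
    rw [div_pos_iff_of_pos_right hg2, ← M.scoreSum_pos_iff,
      ← deriv_densityEstimate_pos_iff hL.differentiable M.size_pos (hv.h_pos n) hg] at h3
    exact h3.ne'

/-- Steep oscillations of the error density stop the ascent of the M-smoother near its start. -/
theorem eventually_le_law (hv : VanishingScale K L μ d D h g) {Q : Measure ℝ}
    [IsProbabilityMeasure Q] {q : ℝ → ℝ} (hq : HasSmoothDensity Q q) (x₀ : Plane)
    {Cω α m₀ m₁ c r s A F κ : ℝ} (hCω : 0 < Cω) (hα : 0 < α) (hκ : 0 < κ) (hs : 0 < s)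
    (hsr : 112 * s ≤ r) (hrd : 2 * r < |m₀ - m₁|) (hF : 0 ≤ F) (hA : 2 + F ≤ α * (A / 4 - F))
    (hA0 : 0 < A)
    (hin : ∀ t, |t - c| ≤ 3 * r / 4 → |deriv q t + A * Real.sin (t / s)| ≤ F)
    (hout : ∀ t, r < |t - c| → |deriv q t| ≤ F) :
    ∃ τ₀ > 0, ∀ᶠ n : ℕ in atTop, ∀ (m : Plane → ℝ) (p₀ : Pixel n) (τ : ℝ), τ ≤ τ₀ →
      LocalModel K m n (h n) x₀ p₀ (Cω / (n * h n) ^ 2) α τ m₀ m₁ →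
      Q.real {t | |t - c| ≤ r / 2 ∧ Real.sin (t / s) ≤ -(1 / 4)} ≤
        (estimatorLaw m (mSmoother K L n (h n) (g n) x₀) Q).real
          (Icc (m₀ + c - 3 * r / 4) (m₀ + c + 3 * r / 4)) + κ := by
  have hr : 0 < r := by linarith
  obtain ⟨Λ, hΛ, hlip⟩ := hq.exists_lipschitz
  refine ⟨min (r / 16) (1 / (2 * Λ)), by positivity, ?_⟩
  filter_upwards [hv.eventually_deviation_le hq x₀ hCω (σ := 1 / 2) (by positivity) hκ
    (R := 2 * r) (by positivity)] with n hn m p₀ τ hτ M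
  have hdev := hn m p₀ α τ m₀ m₁ M (m₀ + c - r) (m₀ + c + r) (by linarith) (by linarith)
  have hL := hv.score
  have hg := hv.g_pos n
  have hg2 : 0 < g n ^ 2 := by positivity
  have hτ1 : τ ≤ r / 16 := hτ.trans (min_le_left _ _)
  have hτ2 : 2 * Λ * τ ≤ 1 := by
    have h1 := hτ.trans (min_le_right _ _)
    rw [le_div_iff₀ (by positivity)] at h1
    linarith
  have hτ0 : 0 ≤ τ := (abs_nonneg _).trans M.centre
  have hη : 0 ≤ A / 4 - F := by
    by_contra hneg
    nlinarith
  -- The two levels differ by more than `2 * r`, so pixels of the other level do not see the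
  -- oscillations and contribute at most `F`.
  have hother : ∀ t, |t - c| ≤ r → |deriv q (t + m₀ - m₁)| ≤ F := by
    intro t ht
    refine hout _ ?_
    have h1 : |m₀ - m₁| ≤ |t + m₀ - m₁ - c| + |t - c| := by
      have := abs_sub (t + m₀ - m₁ - c) (t - c)
      rwa [show t + m₀ - m₁ - c - (t - c) = m₀ - m₁ by ring] at this
    linarith
  rw [estimatorLaw_real
    (measurable_mSmoother K hL.differentiable hL.continuous_deriv n (h n) (g n) x₀)
    measurableSet_Icc, ← pi_real_eval p₀ (measurableSet_sin_le c r s)]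
  refine (measureReal_mono fun e he => ?_).trans ((measureReal_union_le _ _).trans
    (add_le_add_right hdev _))
  by_contra hcon
  simp only [mem_union, not_or, mem_ofPred_eq, not_exists, not_and, not_le] at hcon
  obtain ⟨hno, hcon⟩ := hcon
  set Y : Pixel n → ℝ := fun p => m (designPoint n p) + e p with hY
  set t := e p₀ with ht
  have htc : |t - c| ≤ r / 2 := he.1
  have htc' := abs_le.1 htc
  have hcen := abs_le.1 M.centre
  have hstart : startValue n x₀ Y = m (designPoint n p₀) + t := M.start Y
  -- Where the sine is at most `-1 / 4`, the perturbed density has slope at least `A / 4 - F`. By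
  -- the choice of `A` its share `α` outweighs the other level by `2`, leaving room for an error of
  -- `1` from `τ` and `1 / 2` from the deviations.
  have hpos : 0 < deriv (densityEstimate K L n (h n) (g n) x₀ Y) (startValue n x₀ Y) := by
    have h1 := abs_lt.1 (hcon (startValue n x₀ Y) ⟨by linarith, by linarith⟩)
    have h2 := M.le_weighted_sum hv.kernel hΛ.le hlip (y := startValue n x₀ Y) (t := t)
      (by rw [hstart, show m (designPoint n p₀) + t - m₀ - t = m (designPoint n p₀) - m₀ by ring]
          exact M.centre) hη hF
      (by
        have h3 := abs_le.1 (hin t (by linarith))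
        have h4 : Real.sin (t / s) ≤ -(1 / 4) := he.2
        nlinarith [h3.1])
      (Or.inr (abs_le.1 (hother t (by linarith))).1)
    have h3 : 0 < scoreSum K L n (h n) (g n) x₀ Y (startValue n x₀ Y) /
        (∑ p, weight K n (h n) x₀ p) / g n ^ 2 := by linarith [h1.1]
    rwa [div_pos_iff_of_pos_right hg2, ← M.scoreSum_pos_iff,
      ← deriv_densityEstimate_pos_iff hL.differentiable M.size_pos (hv.h_pos n) hg] at h3
  have hper : Function.Periodic (fun u => Real.sin (u / s)) (2 * Real.pi * s) := fun u => by
    show Real.sin ((u + 2 * Real.pi * s) / s) = Real.sin (u / s)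
    rw [add_div, mul_div_cancel_right₀ _ hs.ne', Real.sin_add_two_pi]
  -- The next crest of the sine beyond `t + τ`, where the density falls steeply. Starting from `t +
  -- τ` ensures that it lies to the right of the starting value, whatever the exact level at the
  -- centre.
  obtain ⟨w, hw, hw1⟩ := hper.exists_mem_Ioc (by positivity) (Real.pi / 2 * s) (t + τ)
  have hws : Real.sin (w / s) = 1 := by
    have h1 : Real.sin (Real.pi / 2 * s / s) = Real.sin (w / s) := hw1
    rw [← h1, mul_div_cancel_right₀ _ hs.ne', Real.sin_pi_div_two]
  have hw2 : w ≤ t + r / 8 := by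
    have h1 : 2 * Real.pi * s ≤ 7 * s := by nlinarith [Real.pi_lt_d2]
    linarith [hw.2]
  have hwc : |w - c| ≤ 3 * r / 4 := abs_le.2 ⟨by linarith [hw.1], by linarith⟩
  have hneg : deriv (densityEstimate K L n (h n) (g n) x₀ Y) (m₀ + w) < 0 := by
    have hwc' := abs_le.1 hwc
    have h1 := abs_lt.1 (hcon (m₀ + w) ⟨by linarith, by linarith⟩)
    have h2 := M.weighted_sum_le hv.kernel hΛ.le hlip (y := m₀ + w) (t := w)
      (by rwa [add_sub_cancel_left, sub_self, abs_zero]) hη hF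
      (by
        have h3 := abs_le.1 (hin w hwc)
        rw [hws] at h3
        linarith [h3.2])
      (Or.inr (abs_le.1 (hother w (by linarith))).2)
    have h3 : scoreSum K L n (h n) (g n) x₀ Y (m₀ + w) /
        (∑ p, weight K n (h n) x₀ p) / g n ^ 2 < 0 := by linarith [h1.2]
    rwa [div_lt_iff₀ hg2, zero_mul, ← M.scoreSum_neg_iff,
      ← deriv_densityEstimate_neg_iff hL.differentiable M.size_pos (hv.h_pos n) hg] at h3
  have hmem := mSmoother_mem_Icc_of_pos hL.differentiable hpos (by linarith [hw.1]) hneg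
  exact hno ⟨by linarith [hmem.1], by linarith [hmem.2]⟩

/-- The interval and the lower bound `ρ` for the perturbed mass depend on the order of the levels
but not on `ε`. Hence one `δ` serves all neighbourhoods of `P`. -/
theorem exists_levyDist_gt (hv : VanishingScale K L μ d D h g) {P : Measure ℝ}
    [IsProbabilityMeasure P] (hP : SmoothUnimodalError P) (x₀ : Plane) {Cω α m₀ m₁ : ℝ}
    (hCω : 0 < Cω) (hα : 0 < α) (hm : m₁ = m₀ + d ∨ m₀ = m₁ + d) :
    ∃ δ > 0, ∀ ε > 0, ∃ Q : Measure ℝ, IsProbabilityMeasure Q ∧ levyDist P Q ≤ ε ∧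
      ∃ τ₀ > 0, ∀ᶠ n : ℕ in atTop, ∀ (m : Plane → ℝ) (p₀ : Pixel n) (τ : ℝ), τ ≤ τ₀ →
        LocalModel K m n (h n) x₀ p₀ (Cω / (n * h n) ^ 2) α τ m₀ m₁ →
        δ < levyDist (estimatorLaw m (mSmoother K L n (h n) (g n) x₀) P)
          (estimatorLaw m (mSmoother K L n (h n) (g n) x₀) Q) := by
  obtain ⟨f, hf, hu⟩ := hP.exists_density
  obtain ⟨c, r, η, b, hr, hrd, hη, hb, h0, hlow, hsign⟩ :=
    hu.exists_monotone_interval hv.image.jump_pos hm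
  obtain ⟨F, hF⟩ := hf.bounded_deriv
  have hF0 : 0 ≤ F := (abs_nonneg _).trans (hF 0)
  set ρ := b * r / 24 with hρ
  have hρ0 : 0 < ρ := by positivity
  -- A Lévy distance of at most `δ` would give `7 * ρ / 8 ≤ ρ / 8 + ρ / 2`, as the interval enlarged
  -- by `2 * δ` still lies in the one avoided under `P`.
  set δ := min (r / 4) (ρ / 4) / 2 with hδ
  have hδ0 : 0 < δ := by positivity
  refine ⟨δ, hδ0, fun ε hε => ?_⟩
  obtain ⟨Q, q, s, A, hQ, hq, hPQ, hs, hsr, hA, hA0, hin, hout, hmass⟩ :=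
    hf.exists_oscillating hr hb hlow hε (4 * ((2 + F) / α + F))
  obtain ⟨τ₁, hτ₁, hev₁⟩ := hv.eventually_law_le hf x₀ hCω hα hη (κ := ρ / 8) (by positivity) hr
    h0 hsign
  obtain ⟨τ₂, hτ₂, hev₂⟩ := hv.eventually_le_law hq x₀ (α := α) (m₀ := m₀) (m₁ := m₁) (κ := ρ / 8)
    hCω hα (by positivity) hs hsr
    (by
      rcases hm with rfl | rfl
      · rwa [sub_add_cancel_left, abs_neg, abs_of_pos hv.image.jump_pos]
      · rwa [add_sub_cancel_left, abs_of_pos hv.image.jump_pos])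
    hF0
    (by
      have h1 : (2 + F) / α ≤ A / 4 - F := by linarith
      rw [div_le_iff₀ hα] at h1
      linarith)
    hA0 (fun t ht => by rw [hin t ht, sub_add_cancel]; exact hF t)
    (fun t ht => by rw [hout t ht]; exact hF t)
  refine ⟨Q, hQ, hPQ, min τ₁ τ₂, by positivity, ?_⟩
  filter_upwards [hev₁, hev₂] with n hn₁ hn₂ m p₀ τ hτ M
  have h1 := hn₁ m p₀ τ (hτ.trans (min_le_left _ _)) M
  have h2 := hn₂ m p₀ τ (hτ.trans (min_le_right _ _)) M
  have hmeas := measurable_mSmoother K hv.score.differentiable hv.score.continuous_deriv n (h n)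
    (g n) x₀
  have hP1 := isProbabilityMeasure_estimatorLaw (m := m) (Q := P) hmeas
  have hQ1 := isProbabilityMeasure_estimatorLaw (m := m) (Q := Q) hmeas
  by_contra hcon
  have h3 := measureReal_Icc_le_of_levyDist_lt (ε := 2 * δ)
    (lt_of_le_of_lt (not_lt.1 hcon) (by linarith))
    (show m₀ + c - 3 * r / 4 ≤ m₀ + c + 3 * r / 4 by linarith)
  have h4 : 2 * δ ≤ r / 4 := by linarith [min_le_left (r / 4) (ρ / 4)]
  have h5 : 2 * δ ≤ ρ / 4 := by linarith [min_le_right (r / 4) (ρ / 4)]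
  have h6 := h3.trans (add_le_add_left ((measureReal_mono (Ioo_subset_Ioo
    (show m₀ + c - r ≤ m₀ + c - 3 * r / 4 - 2 * δ by linarith)
    (show m₀ + c + 3 * r / 4 + 2 * δ ≤ m₀ + c + r by linarith))).trans h1) _)
  linarith

theorem not_robustForLargeSamples (hv : VanishingScale K L μ d D h g) {P : Measure ℝ}
    [IsProbabilityMeasure P] (hP : SmoothUnimodalError P) {x₀ : Plane}
    (hx₀ : x₀ ∈ openUnitSquare) :
    ¬ RobustForLargeSamples (regression μ d D) (fun n => mSmoother K L n (h n) (g n) x₀) P := by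
  intro hrob
  obtain ⟨α, hα, Cω, hCω, hmodel⟩ := exists_localModel hv.image hv.kernel hv.h_pos hv.h_tendsto
    hv.tendsto_mul hx₀
  -- The centre may lie on either side of the boundary depending on `n`, so a bad `Q` is prepared
  -- for each order of the levels and the one matching a large `n` is used.
  obtain ⟨δ, hδ, hlow⟩ := hv.exists_levyDist_gt hP x₀ hCω hα (m₀ := μ x₀) (Or.inl rfl)
  obtain ⟨δ', hδ', hhigh⟩ := hv.exists_levyDist_gt hP x₀ hCω hα (m₁ := μ x₀) (Or.inr rfl)
  obtain ⟨ε, hε, N, hN⟩ := hrob (min δ δ') (by positivity)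
  obtain ⟨Q, hQ, hPQ, τ, hτ, hev⟩ := hlow ε hε
  obtain ⟨Q', hQ', hPQ', τ', hτ', hev'⟩ := hhigh ε hε
  obtain ⟨n, ⟨⟨h1, h2⟩, h3⟩, hn⟩ := (((hev.and hev').and
    (hmodel (min τ τ') (by positivity))).and (eventually_ge_atTop N)).exists
  obtain ⟨p₀, m₀, m₁, ⟨rfl, rfl⟩ | ⟨rfl, rfl⟩, M, -⟩ := h3
  · exact absurd ((hN Q hQ hPQ n hn).trans (min_le_left _ _))
      (not_le.2 (h1 _ p₀ _ (min_le_left _ _) M))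
  · exact absurd ((hN Q' hQ' hPQ' n hn).trans (min_le_right _ _))
      (not_le.2 (h2 _ p₀ _ (min_le_right _ _) M))

end VanishingScale

end MSmoother

theorem theorem3 (K : MSmoother.Plane → ℝ) (L : ℝ → ℝ) (μ : MSmoother.Plane → ℝ) (d : ℝ)
    (D : Set MSmoother.Plane) (h : ℕ → ℝ)
    (P : MeasureTheory.Measure ℝ) (hP : MeasureTheory.IsProbabilityMeasure P)
    (x₀ : MSmoother.Plane) (hx₀ : x₀ ∈ MSmoother.openUnitSquare) :
    (∀ g : ℕ → ℝ, MSmoother.VanishingScale K L μ d D h g → MSmoother.SmoothUnimodalError P →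
      ¬ MSmoother.RobustForLargeSamples (MSmoother.regression μ d D)
        (fun n => MSmoother.mSmoother K L n (h n) (g n) x₀) P) ∧
    (∀ g : ℝ, MSmoother.FixedScale K L μ d D h g → MSmoother.UnimodalError g P →
      x₀ ∉ frontier D →
      MSmoother.RobustForLargeSamples (MSmoother.regression μ d D)
        (fun n => MSmoother.mSmoother K L n (h n) g x₀) P) ∧
    (∀ g : ℝ, MSmoother.FixedScale K L μ d D h g → MSmoother.NarrowUnimodalError g d P →
      x₀ ∈ frontier D → (∃ (n : ℕ) (p : MSmoother.Pixel n), x₀ = MSmoother.designPoint n p) →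
      MSmoother.RobustForLargeSamples (MSmoother.regression μ d D)
        (fun n => MSmoother.mSmoother K L n (h n) g x₀) P) := by
  exact ⟨fun g hv herr => hv.not_robustForLargeSamples herr hx₀,
    fun g hfs herr hfr => MSmoother.robustForLargeSamples_of_notMem_frontier hfs herr hx₀ hfr,
    fun g hfs herr _ _ => MSmoother.robustForLargeSamples_of_narrow hfs herr hx₀⟩
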